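/- Let $T>0$, $\mathbb T^3=\mathbb R^3/\mathbb Z^3$, and let $b$ be a weak solution on $(0,T)\times\mathbb T^3$ of the electron MHD equations $$b_t+\nabla\times[(\nabla\times b)\times b]=0,\qquad \operatorname{div} b=0,$$ with electric current $j=\nabla\times b$ (all equations being understood in the sense of distributions on $(0,T)\times\mathbb T^3$). Let $1<p,q,m,n<\infty$ satisfy $\frac2p+\frac1m=1$ and $\frac2q+\frac1n=1$, and assume $$b\in L^\infty(0,T;L^2(\mathbb T^3))\cap L^p(0,T;L^q(\mathbb T^3)),\qquad j\in L^m(0,T;L^n(\mathbb T^3)).$$ Write $\delta f(\ell)=f(\cdot+\ell)-f(\cdot)$ for $\ell\in\mathbb R^3$. For a smooth, non-negative, compactly supported $\varphi$ on $\mathbb R^3$ with unit integral put $\varphi_\varepsilon(x)=\varepsilon^{-3}\varphi(x/\varepsilon)$, let $f^\varepsilon=\varphi_\varepsilon*f$ be the mollification in space, and set $$D(b,j;\varepsilon)=\tfrac18\int\nabla\varphi_\varepsilon(\ell)\cdot\delta j(\ell)\,|\delta b(\ell)|^2\,d\ell-\tfrac14\int\nabla\varphi_\varepsilon(\ell)\cdot\delta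 b(\ell)\,\big(\delta j(\ell)\cdot\delta b(\ell)\big)\,d\ell .$$ For $\lambda>0$, with $\sigma$ the surface measure on $\partial B=\{|\ell|=1\}$, set $$S_1(j,b,b;\lambda)=\frac1\lambda\int_{\partial B}\ell\cdot\delta j(\lambda\ell)\,|\delta b(\lambda\ell)|^2\,\frac{d\sigma(\ell)}{4\pi},\qquad S_2(b,j,b;\lambda)=\frac1\lambda\int_{\partial B}\ell\cdot\delta b(\lambda\ell)\,\big(\delta j(\lambda\ell)\cdot\delta b(\lambda\ell)\big)\,\frac{d\sigma(\ell)}{4\pi}.$$ These integrands are absolutely integrable, jointly in $(t,x,\ell)$, for all $\varepsilon,\lambda>0$, and there is a distribution $D(b,j)$ on $(0,T)\times\mathbb T^3$, independent of $\varphi$, such that: 1. $D(b,j;\varepsilon)\to D(b,j)$ in the sense of distributions as $\varepsilon\to0^+$, for every such $\varphi$. 2. The local energy equation $$\partial_t\big(\tfrac12|b|^2\big)+\tfrac12\operatorname{div}\big([\operatorname{div}(b\otimes b)]\times b\big)-\tfrac14\operatorname{div}\big(j|b|^2\big)+\tfrac12\operatorname{div}\big(b\,(j\cdot b)\big)=D(b,j)$$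 holds in the sense of distributions. Here $[\operatorname{div}(b\otimes b)]\times b$ is the product of a distribution and a function, that is, the limit in the sense of distributions, which exists and does not depend on $\varphi$, of $[\operatorname{div}(b\otimes b)]^\varepsilon\times b$ as $\varepsilon\to0^+$; it is the pointwise product $G\times b$ whenever $\operatorname{div}(b\otimes b)$ is a function $G\in L^{p/(p-1)}(0,T;L^{q/(q-1)}(\mathbb T^3))$. 3. The $4/3$ law: in the sense of distributions, $$-\lim_{\lambda\to0^+}\Big(-\tfrac12S_1(j,b,b;\lambda)+S_2(b,j,b;\lambda)\Big)=-\tfrac43D(b,j),$$ the limit being part of the assertion. In particular, if $S_1(j,b,b)=-\lim_{\lambda\to0^+}S_1(j,b,b;\lambda)$ and $S_2(b,j,b)=-\lim_{\lambda\to0^+}S_2(b,j,b;\lambda)$ exist in the sense of distributions, then $-\tfrac12S_1(j,b,b)+S_2(b,j,b)=-\tfrac43D(b,j)$. -/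

import Mathlib

open MeasureTheory Filter Topology Set
open scoped ContDiff RealInnerProductSpace ENNReal

noncomputable section

namespace EMHD

/-- Three-dimensional Euclidean space. -/
abbrev E3 : Type := EuclideanSpace ℝ (Fin 3)

/-- The flat torus `ℝ³ / ℤ³`; its `volume` is Lebesgue measure. -/
abbrev T3 : Type := UnitAddTorus (Fin 3)

/-- The covering map `ℝ³ → 𝕋³`. A displacement `ℓ : ℝ³` acts on `x : 𝕋³` by `x + proj ℓ`. -/
def proj (y : E3) : T3 := fun i => (y i : UnitAddCircle)

/-- The `i`-th standard basis vector of `ℝ³`. -/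
def basisVec (i : Fin 3) : E3 := EuclideanSpace.single i (1 : ℝ)

/-- The cross product on Euclidean 3-space. -/
def cross (v w : E3) : E3 := WithLp.toLp 2 (crossProduct v.ofLp w.ofLp)

/-- Lebesgue measure on `(0,T) × 𝕋³`. -/
def spaceTime (T : ℝ) : Measure (ℝ × T3) := (volume.restrict (Ioo 0 T)).prod volume

/-- `f ∈ L^p(0,T; L^q(𝕋³))`, for a vector field given by a jointly measurable representative. -/
def MemLpLq (T : ℝ) (p q : ℝ≥0∞) (f : ℝ → T3 → E3) : Prop :=
  AEStronglyMeasurable (fun z : ℝ × T3 => f z.1 z.2) (spaceTime T) ∧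
    eLpNorm (fun t => eLpNorm (f t) q volume) p (volume.restrict (Ioo 0 T)) < ⊤

/-! ### Differential operators applied to smooth functions on the torus -/

/-- Partial derivative `∂ᵢ f` of a function on the torus. -/
def pderiv (i : Fin 3) (f : T3 → ℝ) (x : T3) : ℝ :=
  deriv (fun s : ℝ => f (x + proj (s • basisVec i))) 0

/-- Gradient of a function on the torus. -/
def grad (f : T3 → ℝ) (x : T3) : E3 := WithLp.toLp 2 fun i => pderiv i f x

/-- Curl of a vector field on the torus. -/
def curl (f : T3 → E3) (x : T3) : E3 :=
  !₂[pderiv 1 (fun y => f y 2) x - pderiv 2 (fun y => f y 1) x,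
     pderiv 2 (fun y => f y 0) x - pderiv 0 (fun y => f y 2) x,
     pderiv 0 (fun y => f y 1) x - pderiv 1 (fun y => f y 0) x]

/-- Time derivative. -/
def tderiv {V : Type*} [NormedAddCommGroup V] [NormedSpace ℝ V]
    (f : ℝ → T3 → V) (t : ℝ) (x : T3) : V := deriv (fun s => f s x) t

/-! ### Test functions and distributions on `(0,T) × 𝕋³` -/

/-- The lift of a function on `ℝ × 𝕋³` to a function on `ℝ × ℝ³`, periodic in space. -/
def lift {V : Type*} (f : ℝ → T3 → V) (z : ℝ × E3) : V := f z.1 (proj z.2)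

/-- `C_c^∞((0,T) × 𝕋³; V)`. -/
def testSpace (T : ℝ) (V : Type*) [NormedAddCommGroup V] [NormedSpace ℝ V] :
    Submodule ℝ (ℝ → T3 → V) where
  carrier := {f | ContDiff ℝ ∞ (lift f) ∧
    ∃ K : Set ℝ, IsCompact K ∧ K ⊆ Ioo 0 T ∧ ∀ t, t ∉ K → ∀ x, f t x = 0}
  zero_mem' := ⟨contDiff_const, ∅, isCompact_empty, empty_subset _, fun _ _ _ => rfl⟩
  add_mem' := by
    rintro f g ⟨hf, K, hK, hKT, hfK⟩ ⟨hg, L, hL, hLT, hgL⟩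
    refine ⟨hf.add hg, K ∪ L, hK.union hL, union_subset hKT hLT, fun t ht x => ?_⟩
    have h1 := hfK t (fun h => ht (Or.inl h)) x
    have h2 := hgL t (fun h => ht (Or.inr h)) x
    simp [h1, h2]
  smul_mem' := by
    rintro c f ⟨hf, K, hK, hKT, hfK⟩
    refine ⟨hf.const_smul c, K, hK, hKT, fun t ht x => ?_⟩
    simp [hfK t ht x]

theorem pderiv_proj {f : ℝ → T3 → ℝ} (hf : ContDiff ℝ ∞ (lift f)) (i : Fin 3) (t : ℝ) (y : E3) :
    pderiv i (f t) (proj y) = fderiv ℝ (lift f) (t, y) (0, basisVec i) := by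
  have hd : HasFDerivAt (lift f) (fderiv ℝ (lift f) (t, y)) (t, y) :=
    (hf.differentiable (by simp) (t, y)).hasFDerivAt
  have hl : HasDerivAt (fun s : ℝ => ((t, y) : ℝ × E3) + s • ((0 : ℝ), basisVec i))
      ((0 : ℝ), basisVec i) 0 := by
    simpa using ((hasDerivAt_id (0 : ℝ)).smul_const ((0 : ℝ), basisVec i)).const_add (t, y)
  have hd' : HasFDerivAt (lift f) (fderiv ℝ (lift f) (t, y))
      (((t, y) : ℝ × E3) + (0 : ℝ) • ((0 : ℝ), basisVec i)) := by simpa using hd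
  have hc := hd'.comp_hasDerivAt (0 : ℝ) hl
  have he : (fun s : ℝ => f t (proj y + proj (s • basisVec i))) =
      lift f ∘ fun s : ℝ => ((t, y) : ℝ × E3) + s • ((0 : ℝ), basisVec i) := by
    funext s
    have : proj y + proj (s • basisVec i) = proj (y + s • basisVec i) := by
      funext k
      simp [proj]
    simp [lift, this]
  unfold pderiv
  rw [he]
  exact hc.deriv

theorem grad_mem {T : ℝ} {f : ℝ → T3 → ℝ} (hf : f ∈ testSpace T ℝ) :
    (fun t => grad (f t)) ∈ testSpace T E3 := by
  obtain ⟨hs, K, hK, hKT, hfK⟩ := hf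
  refine ⟨?_, K, hK, hKT, fun t ht x => ?_⟩
  · rw [contDiff_euclidean]
    intro i
    have : (fun z : ℝ × E3 => lift (fun t => grad (f t)) z i) =
        fun z => fderiv ℝ (lift f) z (0, basisVec i) := by
      funext z
      exact pderiv_proj hs i z.1 z.2
    rw [this]
    exact (hs.fderiv_right (m := ∞) (by simp)).clm_apply contDiff_const
  · have h0 : f t = fun _ => 0 := funext (hfK t ht)
    ext i
    simp [grad, pderiv, h0]

/-- The spatial gradient of a scalar test function, as a vector-valued test function. -/
def testGrad {T : ℝ} (f : testSpace T ℝ) : testSpace T E3 :=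
  ⟨fun t => grad ((f : ℝ → T3 → ℝ) t), grad_mem f.2⟩

/-- Distributions on `(0,T) × 𝕋³` (acting on `V`-valued test functions): linear functionals which,
on the test functions supported in a given compact set, are bounded by finitely many derivatives. -/
structure Distrib (T : ℝ) (V : Type*) [NormedAddCommGroup V] [NormedSpace ℝ V] where
  toFun : testSpace T V →ₗ[ℝ] ℝ
  bounded : ∀ K : Set ℝ, IsCompact K → K ⊆ Ioo 0 T → ∃ (N : ℕ) (C : ℝ),
    ∀ f : testSpace T V, (∀ t, t ∉ K → ∀ x, (f : ℝ → T3 → V) t x = 0) →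
      ∀ M : ℝ, (∀ k ≤ N, ∀ z, ‖iteratedFDeriv ℝ k (lift (f : ℝ → T3 → V)) z‖ ≤ M) →
        |toFun f| ≤ C * M

/-- The pairing `∫₀ᵀ ∫_{𝕋³} g f dx dt` of a scalar function with a test function. -/
def pair {T : ℝ} (g : ℝ → T3 → ℝ) (f : testSpace T ℝ) : ℝ :=
  ∫ z, g z.1 z.2 * (f : ℝ → T3 → ℝ) z.1 z.2 ∂(spaceTime T)

/-- The pairing `∫₀ᵀ ∫_{𝕋³} g · f dx dt` of a vector field with a vector-valued test function. -/
def vpair {T : ℝ} (g : ℝ → T3 → E3) (f : testSpace T E3) : ℝ :=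
  ∫ z, ⟪g z.1 z.2, (f : ℝ → T3 → E3) z.1 z.2⟫ ∂(spaceTime T)

/-- The functions `g ε` converge, as `ε → 0⁺`, to `D` in the sense of distributions. -/
def TendstoDistrib {T : ℝ} (g : ℝ → ℝ → T3 → ℝ) (D : Distrib T ℝ) : Prop :=
  ∀ ψ : testSpace T ℝ, Tendsto (fun ε => pair (g ε) ψ) (𝓝[>] 0) (𝓝 (D.toFun ψ))

/-- The vector fields `g ε` converge, as `ε → 0⁺`, to `F` in the sense of distributions. -/
def VTendstoDistrib {T : ℝ} (g : ℝ → ℝ → T3 → E3) (F : Distrib T E3) : Prop :=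
  ∀ χ : testSpace T E3, Tendsto (fun ε => vpair (g ε) χ) (𝓝[>] 0) (𝓝 (F.toFun χ))

/-! ### Weak solutions -/

/-- `∇ × b = j` in the sense of distributions. -/
def IsWeakCurl (T : ℝ) (b j : ℝ → T3 → E3) : Prop :=
  ∀ Ψ : testSpace T E3,
    ∫ z, ⟪b z.1 z.2, curl ((Ψ : ℝ → T3 → E3) z.1) z.2⟫ ∂(spaceTime T) = vpair j Ψ

/-- `b` is a weak solution of `∂ₜ b + ∇ × [(∇ × b) × b] = 0`, `div b = 0` on `(0,T) × 𝕋³`, with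
electric current `j = ∇ × b`. -/
structure IsWeakSolution (T : ℝ) (b j : ℝ → T3 → E3) : Prop where
  current : IsWeakCurl T b j
  div_free : ∀ ψ : testSpace T ℝ, vpair b (testGrad ψ) = 0
  momentum : ∀ Ψ : testSpace T E3,
    ∫ z, (⟪b z.1 z.2, tderiv (Ψ : ℝ → T3 → E3) z.1 z.2⟫
      - ⟪cross (j z.1 z.2) (b z.1 z.2), curl ((Ψ : ℝ → T3 → E3) z.1) z.2⟫) ∂(spaceTime T) = 0

/-! ### Mollifiers, increments, the dissipation term and the structure functions -/

/-- A smooth non-negative compactly supported function on `ℝ³` with unit integral. -/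
structure IsMollifier (φ : E3 → ℝ) : Prop where
  smooth : ContDiff ℝ ∞ φ
  compact : HasCompactSupport φ
  nonneg : ∀ x, 0 ≤ φ x
  integral_eq_one : ∫ x, φ x = 1

/-- `φ_ε(ℓ) = ε⁻³ φ(ℓ / ε)`. -/
def rescale (φ : E3 → ℝ) (ε : ℝ) (ℓ : E3) : ℝ := (ε ^ 3)⁻¹ * φ (ε⁻¹ • ℓ)

/-- The spatial mollification `f^ε = φ_ε * f` of a function on the torus. -/
def mollify (φ : E3 → ℝ) (ε : ℝ) (f : T3 → ℝ) (x : T3) : ℝ :=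
  ∫ ℓ : E3, rescale φ ε ℓ * f (x - proj ℓ)

/-- The increment `δf(ℓ)(x) = f(x + ℓ) - f(x)`. -/
def incr (f : T3 → E3) (ℓ : E3) (x : T3) : E3 := f (x + proj ℓ) - f x

/-- `(v · δf(ℓ)) (δg(ℓ) · δh(ℓ))` at the point `x`. -/
def cubic (f g h : T3 → E3) (v ℓ : E3) (x : T3) : ℝ :=
  ⟪v, incr f ℓ x⟫ * ⟪incr g ℓ x, incr h ℓ x⟫

/-- `∫ ∇φ_ε(ℓ) · δf(ℓ) (δg(ℓ) · δh(ℓ)) dℓ`. -/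
def transfer (φ : E3 → ℝ) (f g h : T3 → E3) (ε : ℝ) (x : T3) : ℝ :=
  ∫ ℓ : E3, cubic f g h (gradient (rescale φ ε) ℓ) ℓ x

/-- The dissipation term
`D(b,j;ε) = 1/8 ∫ ∇φ_ε(ℓ) · δj(ℓ) |δb(ℓ)|² dℓ - 1/4 ∫ ∇φ_ε(ℓ) · δb(ℓ) (δj(ℓ) · δb(ℓ)) dℓ`. -/
def dissipation (φ : E3 → ℝ) (b j : ℝ → T3 → E3) (ε : ℝ) (t : ℝ) (x : T3) : ℝ :=
  (1 / 8) * transfer φ (j t) (b t) (b t) ε x - (1 / 4) * transfer φ (b t) (j t) (b t) ε x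

/-- Surface measure on the unit sphere of `ℝ³` (of total mass `4π`). -/
def sphereMeasure : Measure (Metric.sphere (0 : E3) 1) := (volume : Measure E3).toSphere

/-- The mixed third-order structure function
`S(f,g,h;λ) = (1/λ) ∫_{|ℓ| = 1} ℓ · δf(λℓ) (δg(λℓ) · δh(λℓ)) dσ(ℓ) / (4π)`. -/
def structureFn (f g h : ℝ → T3 → E3) (lam : ℝ) (t : ℝ) (x : T3) : ℝ :=
  (1 / lam) * ∫ ℓ, cubic (f t) (g t) (h t) (ℓ : E3) (lam • (ℓ : E3)) x / (4 * Real.pi)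
    ∂sphereMeasure

/-! ### The energy flux `[div(b ⊗ b)] × b` -/

/-- The function `[div(b ⊗ b)]^ε`, with components `∑ₖ ∂ₖ (bₖ bᵢ)^ε`. -/
def mollifiedDiv (φ : E3 → ℝ) (ε : ℝ) (b : T3 → E3) (x : T3) : E3 :=
  WithLp.toLp 2 fun i => ∑ k : Fin 3, pderiv k (mollify φ ε fun y => b y k * b y i) x

/-- The distribution `F` is the product `[div(b ⊗ b)] × b` of the distribution `div(b ⊗ b)` and the
function `b`: whatever the mollifier, `[div(b ⊗ b)]^ε × b → F` in the sense of distributions. -/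
def IsDivCross {T : ℝ} (b : ℝ → T3 → E3) (F : Distrib T E3) : Prop :=
  ∀ φ : E3 → ℝ, IsMollifier φ →
    VTendstoDistrib (fun ε t x => cross (mollifiedDiv φ ε (b t) x) (b t x)) F

/-- `div(b ⊗ b)` is the function `G`, in the sense of distributions. -/
def IsWeakDivTensor (T : ℝ) (b G : ℝ → T3 → E3) : Prop :=
  ∀ Ψ : testSpace T E3,
    -∫ z, (∑ i : Fin 3, ∑ k : Fin 3, b z.1 z.2 k * b z.1 z.2 i *
      pderiv k (fun y => (Ψ : ℝ → T3 → E3) z.1 y i) z.2) ∂(spaceTime T) = vpair G Ψ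

/-- The local energy equation
`∂ₜ(½|b|²) + ½ div F - ¼ div(j |b|²) + ½ div(b (j · b)) = D` in the sense of distributions. -/
def LocalEnergyBalance {T : ℝ} (b j : ℝ → T3 → E3) (F : Distrib T E3) (D : Distrib T ℝ) : Prop :=
  ∀ ψ : testSpace T ℝ,
    -(∫ z, (1 / 2) * ‖b z.1 z.2‖ ^ 2 * tderiv (ψ : ℝ → T3 → ℝ) z.1 z.2 ∂(spaceTime T))
      - (1 / 2) * F.toFun (testGrad ψ)
      + (1 / 4) * vpair (fun t x => ‖b t x‖ ^ 2 • j t x) (testGrad ψ)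
      - (1 / 2) * vpair (fun t x => ⟪j t x, b t x⟫ • b t x) (testGrad ψ) = D.toFun ψ

end EMHD

end

/-! Everything is expressed through the correlations `corr f g h` = ∫ f(z+h) g(z) dz. Expanding the
increments, D(b,j;ε) tested against ψ becomes Σₖ ∫ ∂ₖφ_ε(ℓ) Aₖ(ℓ) dℓ, where A (`fluxCorr`) combines
correlations built from one factor j and two factors b. The heart of the matter is that −div A, a
priori a distribution in ℓ, is a continuous function H: the identity Σₖ ∫ ∂ₖφ Aₖ = ∫ φ H holds
exactly for every smooth compactly supported φ (`flux_eq_lowerFlux`, `hasTrace_flux`). Both limits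
then follow. Since φ_ε is an approximate identity, D(b,j;ε) tends to H(0). The divergence theorem on
balls gives (1/λ) ∫ θ·A(λθ) dσ → −(4π/3) H(0) (`tendsto_sphereFlux_div`), which is the 4/3 law,
because −½S₁ + S₂ is −4 times the spherical mean flux of A.

The derivative is moved off φ by point splitting. At separated points no product has to be
differentiated, so a linear conservation law may be tested with a convolution, on the translated
factor (`WeakDiv.primed`) or on the fixed one, weighted by ψ (`WeakDiv.unprimed`). For the induction
equation both are done at once and the time derivatives cancel (`WeakDiv.exchange`). The laws used
are div b = 0, div j = 0, curl b = j, the induction equation, and the stress law div(b⊗b − ½|b|² I)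
= j×b, which is itself obtained by point splitting at displacement zero (`weakDiv_stress`). What
remains has its derivatives on ψ only, and H(0) is the integral of −½|b|²∂ₜψ + (|b|²j − (j·b)b)·∇ψ,
the weak form of ∂ₜ½|b|² + div((j×b)×b).

Continuity of the correlations rests on a uniform integrability condition, `Pairable`, which
Hölder's inequality in mixed norms supplies for at most two powers of |b| and one of |j|. Some
intermediate terms are cubic in b alone, while p or q may lie below 3. The bound b ∈ L³ is therefore
derived from the equations: Δb = −curl j, tested against a truncation of |b|b, controls the
derivative in r of ∫ (φ_r * b)·|b|b by the norm of |j||b|², and at scale r = 1 the energy bound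
suffices (`exists_third_moment_bound`).

The product [div(b⊗b)]×b is identified in the same way with (j×b)×b + ½(curl(|b|²b) − |b|²j), which
makes sense because |b|³ is integrable. Against ∇ψ the curl drops out, and the local energy equation
becomes a comparison of coefficients with H(0). -/

noncomputable section

namespace EMHD

/-! ### Space-time as a measured group -/

/-- Space-time `ℝ × 𝕋³`. -/
abbrev ST : Type := ℝ × T3

instance : IsProbabilityMeasure (volume : Measure UnitAddCircle) :=
  ⟨by rw [AddCircle.measure_univ]; simp⟩

instance : IsProbabilityMeasure (volume : Measure T3) :=
  inferInstanceAs (IsProbabilityMeasure (Measure.pi fun _ : Fin 3 => (volume : Measure UnitAddCircle)))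

instance : (volume : Measure T3).IsAddHaarMeasure :=
  inferInstanceAs (Measure.pi fun _ : Fin 3 => (volume : Measure UnitAddCircle)).IsAddHaarMeasure

instance : (volume : Measure ST).IsAddHaarMeasure :=
  inferInstanceAs (((volume : Measure ℝ).prod (volume : Measure T3)).IsAddHaarMeasure)

instance : (volume : Measure (ℝ × E3)).IsAddHaarMeasure :=
  inferInstanceAs (((volume : Measure ℝ).prod (volume : Measure E3)).IsAddHaarMeasure)

instance : (volume : Measure ST).Regular :=
  Measure.Regular.of_sigmaCompactSpace_of_isLocallyFiniteMeasure _

/-- The covering map `ℝ × ℝ³ → ℝ × 𝕋³`. -/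
def cov (w : ℝ × E3) : ST := (w.1, proj w.2)

/-- A purely spatial displacement. -/
def sp (l : E3) : ST := (0, proj l)

theorem proj_add (x y : E3) : proj (x + y) = proj x + proj y := by
  funext k; simp [proj]

theorem proj_neg (x : E3) : proj (-x) = -proj x := by
  funext k; simp [proj]

theorem proj_zero : proj 0 = 0 := by
  funext k; simp [proj]

theorem continuous_proj : Continuous proj := by
  refine continuous_pi fun i => ?_
  exact (AddCircle.continuous_mk' 1).comp (by fun_prop)

theorem continuous_cov : Continuous cov :=
  continuous_fst.prodMk (continuous_proj.comp continuous_snd)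

theorem continuous_sp : Continuous sp :=
  continuous_const.prodMk continuous_proj

theorem cov_add (x y : ℝ × E3) : cov (x + y) = cov x + cov y := by
  simp [cov, proj_add]

theorem cov_neg (x : ℝ × E3) : cov (-x) = -cov x := by
  simp [cov, proj_neg]

theorem cov_zero : cov 0 = 0 := by simp [cov, proj_zero]

theorem sp_neg (x : E3) : sp (-x) = -sp x := by simp [sp, proj_neg]

theorem sp_zero : sp 0 = 0 := by simp [sp, proj_zero]

theorem proj_surjective : Function.Surjective proj := by
  intro x
  choose y hy using fun i => QuotientAddGroup.mk_surjective (x i)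
  exact ⟨WithLp.toLp 2 y, funext fun i => hy i⟩

theorem cov_surjective : Function.Surjective cov := by
  rintro ⟨t, x⟩
  obtain ⟨y, rfl⟩ := proj_surjective x
  exact ⟨(t, y), rfl⟩

/-- Translations act on space-time in a jointly quasi-measure-preserving way. -/
theorem quasiMeasurePreserving_translate {H : Type*} [MeasurableSpace H] (ν : Measure H) [SFinite ν]
    {π : H → ST} (hπ : Measurable π) :
    Measure.QuasiMeasurePreserving (fun y : ST × H => y.1 + π y.2)
      ((volume : Measure ST).prod ν) volume := by
  have h1 : MeasurePreserving (fun p : H × ST => (p.1, p.2 + π p.1)) (ν.prod volume)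
      (ν.prod volume) :=
    (MeasurePreserving.id ν).skew_product (g := fun a c => c + π a)
      (measurable_snd.add (hπ.comp measurable_fst))
      (Eventually.of_forall fun a => map_add_right_eq_self _ _)
  have h2 : Measure.QuasiMeasurePreserving (fun y : ST × H => y.1 + π y.2)
      ((volume : Measure ST).prod ν) volume := by
    have h3 := (Measure.quasiMeasurePreserving_snd (μ := ν) (ν := (volume : Measure ST))).comp
      h1.quasiMeasurePreserving
    exact h3.comp (Measure.measurePreserving_swap.quasiMeasurePreserving)
  exact h2

/-! ### Correlations -/

/-- The correlation `∫ f(z + h) g(z) dz`. -/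
def corr (f g : ST → ℝ) (h : ST) : ℝ := ∫ z, f (z + h) * g z

/-- The part of `|f|` above level `N`. -/
def tailPart (N : ℝ) (f : ST → ℝ) (z : ST) : ℝ≥0∞ := {w | N < ‖f w‖}.indicator (fun w => ‖f w‖ₑ) z

/-- The products `f(z + h) g(z)` are integrable in `z`, uniformly in the displacement `h`. -/
structure Pairable (f g : ST → ℝ) : Prop where
  aesm : AEStronglyMeasurable f volume
  integrable : Integrable g volume
  tail : ∀ ε : ℝ≥0∞, ε ≠ 0 → ∃ N : ℝ, 0 ≤ N ∧
    ∀ h, ∫⁻ z, tailPart N f (z + h) * ‖g z‖ₑ ≤ ε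

theorem aestronglyMeasurable_translate {f : ST → ℝ} (hf : AEStronglyMeasurable f volume) (h : ST) :
    AEStronglyMeasurable (fun z => f (z + h)) volume :=
  hf.comp_quasiMeasurePreserving (measurePreserving_add_right volume h).quasiMeasurePreserving

theorem aemeasurable_translate {f : ST → ℝ≥0∞} (hf : AEMeasurable f volume) (h : ST) :
    AEMeasurable (fun z => f (z + h)) volume :=
  hf.comp_quasiMeasurePreserving (measurePreserving_add_right volume h).quasiMeasurePreserving

theorem enorm_le_tailPart_add (N : ℝ) (f : ST → ℝ) (z : ST) :
    ‖f z‖ₑ ≤ tailPart N f z + ENNReal.ofReal N := by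
  unfold tailPart
  by_cases h : N < ‖f z‖
  · simp [indicator, h, -Real.norm_eq_abs]
  · simp only [indicator, mem_ofPred_eq, h, if_false, zero_add]
    rw [← ofReal_norm]
    exact ENNReal.ofReal_le_ofReal (not_lt.mp h)

theorem aemeasurable_tailPart {N : ℝ} {f : ST → ℝ} (hf : AEStronglyMeasurable f volume) :
    AEMeasurable (tailPart N f) volume := by
  have h1 : tailPart N f = fun z => (Ioi N).indicator (fun r => ENNReal.ofReal r) ‖f z‖ := by
    funext z
    simp only [tailPart, indicator, mem_ofPred_eq, mem_Ioi, ofReal_norm]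
  rw [h1]
  exact (ENNReal.measurable_ofReal.indicator measurableSet_Ioi).comp_aemeasurable
    hf.norm.aemeasurable

namespace Pairable

variable {f g f' g' : ST → ℝ}

theorem exists_bound (P : Pairable f g) :
    ∃ C : ℝ≥0∞, C ≠ ⊤ ∧ ∀ h, ∫⁻ z, ‖f (z + h)‖ₑ * ‖g z‖ₑ ≤ C := by
  -- Any positive tail budget would do; below the level `N` the integral is at most `N` times the L¹
  -- norm of `g`.
  obtain ⟨N, -, hN⟩ := P.tail 1 one_ne_zero
  refine ⟨1 + ENNReal.ofReal N * ∫⁻ z, ‖g z‖ₑ, ?_, fun h => ?_⟩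
  · exact ENNReal.add_ne_top.2 ⟨ENNReal.one_ne_top,
      ENNReal.mul_ne_top ENNReal.ofReal_ne_top P.integrable.2.ne⟩
  · calc ∫⁻ z, ‖f (z + h)‖ₑ * ‖g z‖ₑ
        ≤ ∫⁻ z, (tailPart N f (z + h) * ‖g z‖ₑ + ENNReal.ofReal N * ‖g z‖ₑ) := by
          refine lintegral_mono fun z => ?_
          rw [← add_mul]
          exact mul_le_mul_left (enorm_le_tailPart_add N f _) _
      _ = (∫⁻ z, tailPart N f (z + h) * ‖g z‖ₑ) + ENNReal.ofReal N * ∫⁻ z, ‖g z‖ₑ := by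
          rw [lintegral_add_left', lintegral_const_mul'' _ P.integrable.1.enorm]
          exact (aemeasurable_translate (aemeasurable_tailPart P.aesm) h).mul P.integrable.1.enorm
      _ ≤ _ := by gcongr; exact hN h

theorem integrable_mul (P : Pairable f g) (h : ST) : Integrable (fun z => f (z + h) * g z) := by
  obtain ⟨C, hC, hb⟩ := P.exists_bound
  refine ⟨(aestronglyMeasurable_translate P.aesm h).mul P.integrable.1, ?_⟩
  rw [HasFiniteIntegral]
  simp only [enorm_mul]
  exact (hb h).trans_lt hC.lt_top

theorem exists_corr_bound (P : Pairable f g) :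
    ∃ C : ℝ, 0 ≤ C ∧ ∀ h, ∫ z, ‖f (z + h) * g z‖ ≤ C := by
  obtain ⟨C, hC, hb⟩ := P.exists_bound
  refine ⟨C.toReal, ENNReal.toReal_nonneg, fun h => ?_⟩
  rw [integral_norm_eq_lintegral_enorm (P.integrable_mul h).1]
  refine ENNReal.toReal_mono hC ?_
  simpa only [enorm_mul] using hb h

theorem mono (P : Pairable f g) (hf' : AEStronglyMeasurable f' volume)
    (hg' : AEStronglyMeasurable g' volume) {c d : ℝ}
    (hf : ∀ z, ‖f' z‖ ≤ c * ‖f z‖) (hg : ∀ z, ‖g' z‖ ≤ d * ‖g z‖) : Pairable f' g' := by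
  -- Both constants are enlarged to be positive, so that a tail of `f'` above level `c * N` forces
  -- `f` above level `N`.
  wlog hc : 0 < c generalizing c
  · exact this (c := max c 1) (fun z => (hf z).trans (by gcongr; exact le_max_left _ _))
      (by positivity)
  wlog hd : 0 < d generalizing d
  · exact this (d := max d 1) (fun z => (hg z).trans (by gcongr; exact le_max_left _ _))
      (by positivity)
  refine ⟨hf', (P.integrable.norm.const_mul d).mono' hg' (Eventually.of_forall hg),
    fun ε hε => ?_⟩
  have hcd : ENNReal.ofReal c * ENNReal.ofReal d ≠ 0 := by positivity
  have hcd' : ENNReal.ofReal c * ENNReal.ofReal d ≠ ⊤ :=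
    ENNReal.mul_ne_top ENNReal.ofReal_ne_top ENNReal.ofReal_ne_top
  obtain ⟨N, hN0, hN⟩ := P.tail (ε / (ENNReal.ofReal c * ENNReal.ofReal d))
    (ENNReal.div_pos hε hcd').ne'
  refine ⟨c * N, by positivity, fun h => ?_⟩
  have key : ∀ z, tailPart (c * N) f' z ≤ ENNReal.ofReal c * tailPart N f z := by
    intro z
    unfold tailPart
    by_cases h1 : c * N < ‖f' z‖
    · have h2 : N < ‖f z‖ := lt_of_mul_lt_mul_left (h1.trans_le (hf z)) hc.le
      simp only [indicator, mem_ofPred_eq, h1, h2, if_true]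
      rw [← ofReal_norm, ← ofReal_norm, ← ENNReal.ofReal_mul hc.le]
      exact ENNReal.ofReal_le_ofReal (hf z)
    · simp [indicator, h1, -Real.norm_eq_abs]
  have key2 : ∀ z, ‖g' z‖ₑ ≤ ENNReal.ofReal d * ‖g z‖ₑ := by
    intro z
    rw [← ofReal_norm, ← ofReal_norm, ← ENNReal.ofReal_mul hd.le]
    exact ENNReal.ofReal_le_ofReal (hg z)
  calc ∫⁻ z, tailPart (c * N) f' (z + h) * ‖g' z‖ₑ
      ≤ ∫⁻ z, (ENNReal.ofReal c * ENNReal.ofReal d) * (tailPart N f (z + h) * ‖g z‖ₑ) := by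
        refine lintegral_mono fun z => ?_
        calc _ ≤ (ENNReal.ofReal c * tailPart N f (z + h)) * (ENNReal.ofReal d * ‖g z‖ₑ) :=
              mul_le_mul' (key _) (key2 _)
          _ = _ := by ring
    _ = (ENNReal.ofReal c * ENNReal.ofReal d) * ∫⁻ z, (tailPart N f (z + h) * ‖g z‖ₑ) :=
        lintegral_const_mul' _ _ hcd'
    _ ≤ (ENNReal.ofReal c * ENNReal.ofReal d) * (ε / (ENNReal.ofReal c * ENNReal.ofReal d)) := by
        gcongr; exact hN h
    _ ≤ ε := ENNReal.mul_div_le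

theorem of_bounded (hf : AEStronglyMeasurable f volume) (hg : Integrable g) {c : ℝ}
    (hc : ∀ z, ‖f z‖ ≤ c) : Pairable f g := by
  refine ⟨hf, hg, fun ε _ => ⟨max c 0, le_max_right _ _, fun h => ?_⟩⟩
  have : ∀ z, tailPart (max c 0) f z = 0 := fun z => by
    simp [tailPart, indicator, (hc z).not_gt, -Real.norm_eq_abs]
  simp [this]

/-- Joint integrability of a weighted product of translates. -/
theorem integrable_prod (P : Pairable f g) {H : Type*} [MeasurableSpace H] {ν : Measure H}
    [SFinite ν] {π : H → ST} (hπ : Measurable π) {w : H → ℝ} (hw : Integrable w ν) :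
    Integrable (fun y : ST × H => w y.2 * (f (y.1 + π y.2) * g y.1))
      ((volume : Measure ST).prod ν) := by
  obtain ⟨C, -, hC⟩ := P.exists_corr_bound
  have hm : AEStronglyMeasurable (fun y : ST × H => w y.2 * (f (y.1 + π y.2) * g y.1))
      ((volume : Measure ST).prod ν) :=
    hw.1.comp_snd.mul ((P.aesm.comp_quasiMeasurePreserving
      (quasiMeasurePreserving_translate ν hπ)).mul P.integrable.1.comp_fst)
  rw [integrable_prod_iff' hm]
  refine ⟨Eventually.of_forall fun h => (P.integrable_mul (π h)).const_mul (w h), ?_⟩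
  refine (hw.norm.mul_const C).mono' hm.norm.prod_swap.integral_prod_right' ?_
  refine Eventually.of_forall fun h => ?_
  simp only [norm_mul (w _), integral_const_mul]
  rw [norm_mul, norm_norm, Real.norm_of_nonneg (integral_nonneg fun _ => norm_nonneg _)]
  gcongr
  exact hC _

theorem integral_swap (P : Pairable f g) {H : Type*} [MeasurableSpace H] {ν : Measure H}
    [SFinite ν] {π : H → ST} (hπ : Measurable π) {w : H → ℝ} (hw : Integrable w ν) :
    ∫ z, ∫ h, w h * (f (z + π h) * g z) ∂ν = ∫ h, w h * corr f g (π h) ∂ν := by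
  rw [integral_integral_swap (P.integrable_prod hπ hw)]
  simp only [integral_const_mul, corr]

end Pairable

/-- Translations act strongly continuously on L¹; the translation is realised as the action of
`DomAddAct` on `Lp`. -/
theorem tendsto_integral_translate_sub {g : ST → ℝ} (hg : Integrable g) (h₀ : ST) :
    Tendsto (fun h => ∫ z, ‖g (z - h) - g (z - h₀)‖) (𝓝 h₀) (𝓝 0) := by
  have hm : MemLp g 1 (volume : Measure ST) := memLp_one_iff_integrable.2 hg
  have : Fact ((1 : ℝ≥0∞) ≠ ⊤) := ⟨ENNReal.one_ne_top⟩
  have : ContinuousVAdd STᵈᵃᵃ (Lp ℝ 1 (volume : Measure ST)) := Lp.instContinuousVAddDomAddAct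
  let F : ST → Lp ℝ 1 (volume : Measure ST) := fun h => DomAddAct.mk (-h) +ᵥ hm.toLp
  have hF : Continuous F :=
    Continuous.vadd (f := fun h : ST => DomAddAct.mk (-h)) (g := fun _ => hm.toLp)
      (DomAddAct.mkHomeomorph.continuous.comp continuous_neg) continuous_const
  have h1 := (tendsto_iff_norm_sub_tendsto_zero.1 (hF.tendsto h₀))
  refine h1.congr fun h => ?_
  rw [L1.norm_eq_integral_norm]
  refine integral_congr_ae ?_
  have e : ∀ h, (F h : ST → ℝ) =ᵐ[volume] fun z => g (z - h) := by
    intro h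
    have : F h = MemLp.toLp (fun z => g (-h +ᵥ z))
      (hm.comp_measurePreserving (measurePreserving_vadd (-h) volume)) := rfl
    rw [this]
    refine (MemLp.coeFn_toLp _).trans (Eventually.of_forall fun z => ?_)
    simp [sub_eq_neg_add]
  filter_upwards [Lp.coeFn_sub (F h) (F h₀), e h, e h₀] with z h2 h3 h4
  rw [h2, Pi.sub_apply, h3, h4]

/-- Invariance of the measure moves the displacement onto the integrable factor, where continuity of
translation in L¹ is available. -/
theorem corr_eq_integral_sub (f g : ST → ℝ) (h : ST) : corr f g h = ∫ z, f z * g (z - h) := by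
  rw [corr, ← integral_add_right_eq_self (fun z => f z * g (z - h)) h]
  simp only [add_sub_cancel_right]

theorem continuous_corr_of_bounded {f g : ST → ℝ} (hf : AEStronglyMeasurable f volume)
    (hg : Integrable g) {c : ℝ} (hc : ∀ z, ‖f z‖ ≤ c) : Continuous (corr f g) := by
  have P : Pairable f g := .of_bounded hf hg hc
  rw [continuous_iff_continuousAt]
  intro h₀
  rw [ContinuousAt, tendsto_iff_norm_sub_tendsto_zero]
  have hi : ∀ h, Integrable fun z => f z * g (z - h) := fun h => by
    simpa using (P.integrable_mul h).comp_sub_right h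
  refine squeeze_zero (fun _ => norm_nonneg _) (fun h => ?_)
    (by simpa using (tendsto_integral_translate_sub hg h₀).const_mul c)
  rw [corr_eq_integral_sub, corr_eq_integral_sub, ← integral_sub (hi h) (hi h₀),
    ← integral_const_mul]
  refine (norm_integral_le_integral_norm _).trans (integral_mono_of_nonneg
    (Eventually.of_forall fun _ => norm_nonneg _) ?_ (Eventually.of_forall fun z => ?_))
  · exact (((hg.comp_sub_right h).sub (hg.comp_sub_right h₀)).norm).const_mul c
  · simp only [← mul_sub, norm_mul]
    exact mul_le_mul_of_nonneg_right (hc z) (norm_nonneg _)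

/-- Truncating `f` at height `N n` changes the correlation by at most the tail integral, which is
small uniformly in the displacement. A uniform limit of continuous functions is continuous. -/
theorem Pairable.continuous_corr {f g : ST → ℝ} (P : Pairable f g) : Continuous (corr f g) := by
  choose N hN0 hN using fun n : ℕ => P.tail (ENNReal.ofReal (1 / ((n : ℝ) + 1)))
    (by have : (0 : ℝ) < 1 / ((n : ℝ) + 1) := by positivity
        simpa using this)
  let fN : ℕ → ST → ℝ := fun n z => (Icc (-(N n)) (N n)).indicator id (f z)
  have hm : ∀ n, AEStronglyMeasurable (fN n) volume := fun n =>
    ((measurable_id.indicator measurableSet_Icc).comp_aemeasurable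
      P.aesm.aemeasurable).aestronglyMeasurable
  have hb : ∀ n z, ‖fN n z‖ ≤ N n := by
    intro n z
    simp only [fN, indicator, id]
    split_ifs with h
    · exact abs_le.2 h
    · simpa using hN0 n
  have hd : ∀ n z, ‖f z - fN n z‖ₑ ≤ tailPart (N n) f z := by
    intro n z
    simp only [fN, tailPart, indicator, id, mem_ofPred_eq]
    by_cases h : f z ∈ Icc (-(N n)) (N n)
    · simp [h]
    · have : N n < ‖f z‖ := by
        by_contra h'
        exact h (abs_le.1 (not_lt.1 h'))
      simp [h, this, -Real.norm_eq_abs]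
  have hcont : ∀ n, Continuous (corr (fN n) g) := fun n =>
    continuous_corr_of_bounded (hm n) P.integrable (hb n)
  have hunif : TendstoUniformly (fun n => corr (fN n) g) (corr f g) atTop := by
    rw [Metric.tendstoUniformly_iff]
    intro ε hε
    obtain ⟨n₀, hn₀⟩ := exists_nat_one_div_lt hε
    filter_upwards [eventually_ge_atTop n₀] with n hn h
    have hPn : Pairable (fN n) g := .of_bounded (hm n) P.integrable (hb n)
    rw [dist_eq_norm, corr, corr, ← integral_sub (P.integrable_mul h) (hPn.integrable_mul h)]
    refine lt_of_le_of_lt ?_ ((one_div_le_one_div_of_le (by positivity)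
      (by gcongr : (n₀ : ℝ) + 1 ≤ n + 1)).trans_lt hn₀)
    refine (norm_integral_le_integral_norm _).trans ?_
    have hms := ((P.integrable_mul h).sub (hPn.integrable_mul h)).1
    simp only [Pi.sub_def] at hms
    rw [integral_norm_eq_lintegral_enorm hms]
    refine ENNReal.toReal_le_of_le_ofReal (by positivity) (le_trans ?_ (hN n h))
    refine lintegral_mono fun z => ?_
    rw [← sub_mul, enorm_mul]
    gcongr
    exact hd n _
  exact hunif.continuous (Frequently.of_forall hcont)

/-! ### Local integrability of periodic lifts -/

/-- The half-open unit cube with corner `a`. -/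
def cube (a : E3) : Set E3 := {y | ∀ i, y i ∈ Ioc (a i) (a i + 1)}

theorem measurePreserving_proj_cube (a : E3) :
    MeasurePreserving proj (volume.restrict (cube a)) volume := by
  have h1 : MeasurePreserving (fun (x : Fin 3 → ℝ) => (fun i => x i : T3))
      (Measure.pi fun i => volume.restrict (Ioc (a i) (a i + 1))) volume :=
    measurePreserving_pi _ _ (fun i => UnitAddCircle.measurePreserving_mk (a i))
  rw [← Measure.restrict_pi_pi] at h1
  have h2 := h1.comp ((PiLp.volume_preserving_ofLp (Fin 3)).restrict_preimage
    (MeasurableSet.univ_pi fun i => measurableSet_Ioc))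
  have h3 : cube a = WithLp.ofLp ⁻¹' univ.pi fun i => Ioc (a i) (a i + 1) := by
    ext y
    simp [cube]
  rw [h3]
  exact h2

theorem cube_mem_nhds (y : E3) : cube (y - WithLp.toLp 2 fun _ => 1 / 2) ∈ 𝓝 y := by
  have : (⋂ i : Fin 3, {x : E3 | x i ∈ Ioo (y i - 1 / 2) (y i + 1 / 2)}) ∈ 𝓝 y := by
    refine (isOpen_iInter_of_finite fun i => ?_).mem_nhds ?_
    · exact isOpen_Ioo.preimage (by fun_prop)
    · simp
  refine mem_of_superset this fun x hx i => ?_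
  simp only [mem_iInter, mem_ofPred_eq, mem_Ioo] at hx
  have := hx i
  simp only [PiLp.sub_apply, mem_Ioc]
  constructor <;> linarith

theorem locallyIntegrable_comp_proj {f : T3 → ℝ} (hf : Integrable f) :
    LocallyIntegrable (fun y => f (proj y)) := fun y =>
  ⟨_, cube_mem_nhds y, (measurePreserving_proj_cube _).integrable_comp_of_integrable hf⟩

theorem locallyIntegrable_comp_cov {g : ST → ℝ} (hg : Integrable g) :
    LocallyIntegrable (fun w => g (cov w)) := fun w => by
  refine ⟨univ ×ˢ cube (w.2 - WithLp.toLp 2 fun _ => 1 / 2),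
    prod_mem_nhds univ_mem (cube_mem_nhds _), ?_⟩
  have h1 : MeasurePreserving cov ((volume.restrict univ).prod
      (volume.restrict (cube (w.2 - WithLp.toLp 2 fun _ => 1 / 2)))) volume := by
    rw [Measure.restrict_univ]
    exact (MeasurePreserving.id volume).prod (measurePreserving_proj_cube _)
  rw [Measure.prod_restrict] at h1
  exact h1.integrable_comp_of_integrable hg

/-! ### Smoothing by convolution -/

section Smoothing

variable {W : Type*} [NormedAddCommGroup W] [NormedSpace ℝ W] [FiniteDimensional ℝ W]
  [MeasurableSpace W] [BorelSpace W] {μ : Measure W} [μ.IsAddHaarMeasure]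

theorem integral_mul_sub_eq_convolution (Φ G : W → ℝ) (w : W) :
    ∫ h, Φ h * G (w - h) ∂μ = (MeasureTheory.convolution G Φ (ContinuousLinearMap.mul ℝ ℝ) μ) w := by
  rw [convolution_mul_swap]
  simp only [mul_comm]

theorem contDiff_integral_mul_sub {Φ G : W → ℝ} (hΦ : ContDiff ℝ ∞ Φ) (hc : HasCompactSupport Φ)
    (hG : LocallyIntegrable G μ) : ContDiff ℝ ∞ (fun w => ∫ h, Φ h * G (w - h) ∂μ) := by
  simp only [integral_mul_sub_eq_convolution]
  exact hc.contDiff_convolution_right (n := ⊤) _ hG hΦ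

theorem fderiv_integral_mul_sub {Φ G : W → ℝ} (hΦ : ContDiff ℝ ∞ Φ) (hc : HasCompactSupport Φ)
    (hG : LocallyIntegrable G μ) (w v : W) :
    fderiv ℝ (fun w => ∫ h, Φ h * G (w - h) ∂μ) w v = ∫ h, fderiv ℝ Φ h v * G (w - h) ∂μ := by
  have h1 : ContDiff ℝ 1 Φ := hΦ.of_le (by simp)
  simp only [integral_mul_sub_eq_convolution]
  have h2 := hc.hasFDerivAt_convolution_right (ContinuousLinearMap.mul ℝ ℝ) hG h1 w
  have h3 := convolution_precompR_apply (ContinuousLinearMap.mul ℝ ℝ) hG (hc.fderiv ℝ)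
    (h1.continuous_fderiv one_ne_zero) w v
  exact (congrArg (· v) h2.fderiv).trans h3

end Smoothing

/-! ### Test functions -/

/-- This lets continuity on the torus be checked on periodic lifts, the only place where derivatives
are computed. -/
theorem isOpenQuotientMap_proj : IsOpenQuotientMap proj := by
  have h1 : IsOpenQuotientMap (fun (x : Fin 3 → ℝ) => (fun i => x i : T3)) :=
    IsOpenQuotientMap.piMap fun _ => QuotientAddGroup.isOpenQuotientMap_mk
  exact h1.comp (EuclideanSpace.equiv (Fin 3) ℝ).toHomeomorph.isOpenQuotientMap

theorem isOpenQuotientMap_cov : IsOpenQuotientMap cov :=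
  IsOpenQuotientMap.id.prodMap isOpenQuotientMap_proj

section TestFunctions

variable {T : ℝ}

/-- A scalar test function, as a function on space-time. -/
def tf (ψ : testSpace T ℝ) (z : ST) : ℝ := (ψ : ℝ → T3 → ℝ) z.1 z.2

/-- The time derivative of a test function. -/
def dt (ψ : testSpace T ℝ) (z : ST) : ℝ := tderiv (ψ : ℝ → T3 → ℝ) z.1 z.2

/-- The spatial partial derivatives of a test function. -/
def dx (k : Fin 3) (ψ : testSpace T ℝ) (z : ST) : ℝ := pderiv k ((ψ : ℝ → T3 → ℝ) z.1) z.2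

theorem tf_cov (ψ : testSpace T ℝ) (w : ℝ × E3) : tf ψ (cov w) = lift (ψ : ℝ → T3 → ℝ) w := rfl

theorem dx_cov (k : Fin 3) (ψ : testSpace T ℝ) (w : ℝ × E3) :
    dx k ψ (cov w) = fderiv ℝ (lift (ψ : ℝ → T3 → ℝ)) w (0, basisVec k) :=
  pderiv_proj ψ.2.1 k w.1 w.2

theorem tderiv_proj {V : Type*} [NormedAddCommGroup V] [NormedSpace ℝ V] {f : ℝ → T3 → V}
    (hf : ContDiff ℝ ∞ (lift f)) (w : ℝ × E3) :
    tderiv f w.1 (proj w.2) = fderiv ℝ (lift f) w (1, 0) := by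
  have hd : HasFDerivAt (lift f) (fderiv ℝ (lift f) w) w :=
    (hf.differentiable (by simp) w).hasFDerivAt
  have hl : HasDerivAt (fun s : ℝ => ((s, w.2) : ℝ × E3)) ((1 : ℝ), (0 : E3)) w.1 :=
    (hasDerivAt_id w.1).prodMk (hasDerivAt_const _ _)
  exact (hd.comp_hasDerivAt w.1 hl).deriv

theorem dt_cov (ψ : testSpace T ℝ) (w : ℝ × E3) :
    dt ψ (cov w) = fderiv ℝ (lift (ψ : ℝ → T3 → ℝ)) w (1, 0) :=
  tderiv_proj ψ.2.1 w

theorem continuous_of_cov {f : ST → ℝ} (hf : Continuous fun w => f (cov w)) : Continuous f :=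
  isOpenQuotientMap_cov.isQuotientMap.continuous_iff.2 hf

theorem continuous_tf (ψ : testSpace T ℝ) : Continuous (tf ψ) :=
  continuous_of_cov ψ.2.1.continuous

theorem continuous_fderiv_lift (ψ : testSpace T ℝ) (v : ℝ × E3) :
    Continuous fun w => fderiv ℝ (lift (ψ : ℝ → T3 → ℝ)) w v :=
  (ψ.2.1.continuous_fderiv (by simp)).clm_apply continuous_const

theorem continuous_dx (k : Fin 3) (ψ : testSpace T ℝ) : Continuous (dx k ψ) := by
  refine continuous_of_cov ?_
  simp only [dx_cov]
  exact continuous_fderiv_lift ψ _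

theorem continuous_dt (ψ : testSpace T ℝ) : Continuous (dt ψ) := by
  refine continuous_of_cov ?_
  simp only [dt_cov]
  exact continuous_fderiv_lift ψ _

/-- All test functions and their first derivatives vanish outside a compact set of times. -/
theorem exists_compact_support (ψ : testSpace T ℝ) :
    ∃ K : Set ℝ, IsCompact K ∧ K ⊆ Ioo 0 T ∧
      ∀ z : ST, z.1 ∉ K → tf ψ z = 0 ∧ dt ψ z = 0 ∧ ∀ k, dx k ψ z = 0 := by
  obtain ⟨K, hK, hKT, h⟩ := ψ.2.2
  refine ⟨K, hK, hKT, fun z hz => ⟨h _ hz _, ?_, fun k => ?_⟩⟩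
  · have : ∀ᶠ s in 𝓝 z.1, (ψ : ℝ → T3 → ℝ) s z.2 = 0 := by
      filter_upwards [hK.isClosed.isOpen_compl.mem_nhds hz] with s hs using h s hs _
    have h2 := Filter.EventuallyEq.deriv_eq (f := fun _ => (0:ℝ)) this
    simpa [dt, tderiv] using h2
  · have h0 : (ψ : ℝ → T3 → ℝ) z.1 = fun _ => 0 := funext (h z.1 hz)
    simp [dx, pderiv, h0]

theorem exists_bound_of_continuous {f : ST → ℝ} (hf : Continuous f) {K : Set ℝ}
    (hK : IsCompact K) (h : ∀ z : ST, z.1 ∉ K → f z = 0) : ∃ C : ℝ, ∀ z, ‖f z‖ ≤ C := by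
  obtain ⟨C, hC⟩ := (hK.prod (isCompact_univ (X := T3))).exists_bound_of_continuousOn hf.continuousOn
  refine ⟨max C 0, fun z => ?_⟩
  by_cases hz : z.1 ∈ K
  · exact (hC z ⟨hz, mem_univ _⟩).trans (le_max_left _ _)
  · simp [h z hz]

theorem exists_bound_tf (ψ : testSpace T ℝ) : ∃ C : ℝ, ∀ z, ‖tf ψ z‖ ≤ C := by
  obtain ⟨K, hK, -, h⟩ := exists_compact_support ψ
  exact exists_bound_of_continuous (continuous_tf ψ) hK fun z hz => (h z hz).1

theorem exists_bound_dt (ψ : testSpace T ℝ) : ∃ C : ℝ, ∀ z, ‖dt ψ z‖ ≤ C := by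
  obtain ⟨K, hK, -, h⟩ := exists_compact_support ψ
  exact exists_bound_of_continuous (continuous_dt ψ) hK fun z hz => (h z hz).2.1

theorem exists_bound_dx (k : Fin 3) (ψ : testSpace T ℝ) : ∃ C : ℝ, ∀ z, ‖dx k ψ z‖ ≤ C := by
  obtain ⟨K, hK, -, h⟩ := exists_compact_support ψ
  exact exists_bound_of_continuous (continuous_dx k ψ) hK fun z hz => (h z hz).2.2 k

/-! ### Test functions obtained by smoothing -/

/-- The convolution on space-time of a kernel on `ℝ × ℝ³` with a function on `ℝ × 𝕋³`. -/
def conv (Φ : ℝ × E3 → ℝ) (g : ST → ℝ) (z : ST) : ℝ := ∫ h, Φ h * g (z - cov h)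

theorem conv_cov (Φ : ℝ × E3 → ℝ) (g : ST → ℝ) (w : ℝ × E3) :
    conv Φ g (cov w) = ∫ h, Φ h * g (cov (w - h)) := by
  simp only [conv, sub_eq_add_neg, cov_add, cov_neg]

/-- The kernel carries all the smoothness, so rough fields can be inserted into test functions. -/
theorem contDiff_conv {Φ : ℝ × E3 → ℝ} {g : ST → ℝ} (hΦ : ContDiff ℝ ∞ Φ)
    (hc : HasCompactSupport Φ) (hg : Integrable g) :
    ContDiff ℝ ∞ (lift fun t x => conv Φ g (t, x)) := by
  have : (lift fun t x => conv Φ g (t, x)) = fun w => ∫ h, Φ h * g (cov (w - h)) := by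
    funext w
    exact conv_cov Φ g w
  rw [this]
  exact contDiff_integral_mul_sub (G := fun w => g (cov w)) hΦ hc (locallyIntegrable_comp_cov hg)

theorem fderiv_conv {Φ : ℝ × E3 → ℝ} {g : ST → ℝ} (hΦ : ContDiff ℝ ∞ Φ)
    (hc : HasCompactSupport Φ) (hg : Integrable g) (w v : ℝ × E3) :
    fderiv ℝ (lift fun t x => conv Φ g (t, x)) w v = conv (fun h => fderiv ℝ Φ h v) g (cov w) := by
  have : (lift fun t x => conv Φ g (t, x)) = fun w => ∫ h, Φ h * g (cov (w - h)) := by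
    funext w
    exact conv_cov Φ g w
  rw [this, conv_cov]
  exact fderiv_integral_mul_sub (G := fun w => g (cov w)) hΦ hc (locallyIntegrable_comp_cov hg) w v

/-- Products of test functions with smooth functions. -/
def mulTest (ψ : testSpace T ℝ) (u : ℝ → T3 → ℝ) (hu : ContDiff ℝ ∞ (lift u)) : testSpace T ℝ :=
  ⟨fun t x => (ψ : ℝ → T3 → ℝ) t x * u t x, ψ.2.1.mul hu, by
    obtain ⟨K, hK, hKT, h⟩ := ψ.2.2
    exact ⟨K, hK, hKT, fun t ht x => by simp [h t ht x]⟩⟩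

theorem fderiv_mulTest (ψ : testSpace T ℝ) {u : ℝ → T3 → ℝ} (hu : ContDiff ℝ ∞ (lift u))
    (w v : ℝ × E3) :
    fderiv ℝ (lift (mulTest ψ u hu : ℝ → T3 → ℝ)) w v =
      lift (ψ : ℝ → T3 → ℝ) w * fderiv ℝ (lift u) w v +
      fderiv ℝ (lift (ψ : ℝ → T3 → ℝ)) w v * lift u w := by
  have : lift (mulTest ψ u hu : ℝ → T3 → ℝ) = lift (ψ : ℝ → T3 → ℝ) * lift u := rfl
  rw [this, fderiv_mul (ψ.2.1.differentiable (by simp) w) (hu.differentiable (by simp) w)]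
  simp [mul_comm]

end TestFunctions

theorem measurePreserving_shear :
    MeasurePreserving (fun y : ST × (ℝ × E3) => (y.1 - cov y.2, y.2))
      ((volume : Measure ST).prod volume) ((volume : Measure ST).prod volume) := by
  have h1 : MeasurePreserving (fun p : (ℝ × E3) × ST => (p.1, p.2 - cov p.1))
      (volume.prod volume) (volume.prod volume) :=
    (MeasurePreserving.id volume).skew_product (g := fun a c => c - cov a)
      (measurable_snd.sub (continuous_cov.measurable.comp measurable_fst))
      (Eventually.of_forall fun a => map_sub_right_eq_self _ _)
  exact (Measure.measurePreserving_swap.comp h1).comp Measure.measurePreserving_swap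

namespace Pairable

variable {f g : ST → ℝ} {Φ : ℝ × E3 → ℝ}

theorem integrable_mul_conv_aux (P : Pairable f g) (hΦ : Integrable Φ) :
    Integrable (fun y : ST × (ℝ × E3) => f y.1 * (Φ y.2 * g (y.1 - cov y.2)))
      ((volume : Measure ST).prod volume) := by
  have h1 := measurePreserving_shear.integrable_comp_of_integrable
    (P.integrable_prod continuous_cov.measurable hΦ)
  refine h1.congr (Eventually.of_forall fun y => ?_)
  simp only [Function.comp, sub_add_cancel]
  ring

theorem integrable_mul_conv (P : Pairable f g) (hΦ : Integrable Φ) :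
    Integrable (fun z => f z * conv Φ g z) := by
  have := (P.integrable_mul_conv_aux hΦ).integral_prod_left
  simp only [integral_const_mul] at this
  exact this

theorem integral_mul_conv (P : Pairable f g) (hΦ : Integrable Φ) :
    ∫ z, f z * conv Φ g z = ∫ w, Φ w * corr f g (cov w) := by
  have := integral_integral_swap
    (f := fun z h => f z * (Φ h * g (z - cov h))) (P.integrable_mul_conv_aux hΦ)
  simp only [conv, ← integral_const_mul]
  rw [this]
  simp only [corr_eq_integral_sub, ← integral_const_mul, mul_left_comm]

/-- Reflecting the kernel turns `z - cov h` into `z + cov h`, so that `g` becomes the translated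
factor of the correlation. -/
theorem conv_neg_eq (Φ : ℝ × E3 → ℝ) (g : ST → ℝ) (z : ST) :
    conv (fun h => Φ (-h)) g z = ∫ h, Φ h * g (z + cov h) := by
  rw [conv, ← integral_neg_eq_self]
  simp [cov_neg]

theorem integrable_mul_conv_neg (P : Pairable g f) (hΦ : Integrable Φ) :
    Integrable (fun z => f z * conv (fun h => Φ (-h)) g z) := by
  have := (P.integrable_prod continuous_cov.measurable hΦ).integral_prod_left
  refine this.congr (Eventually.of_forall fun z => ?_)
  simp only [conv_neg_eq, ← integral_const_mul]
  exact integral_congr_ae (Eventually.of_forall fun h => by ring)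

theorem integral_mul_conv_neg (P : Pairable g f) (hΦ : Integrable Φ) :
    ∫ z, f z * conv (fun h => Φ (-h)) g z = ∫ w, Φ w * corr g f (cov w) := by
  rw [← P.integral_swap continuous_cov.measurable hΦ]
  simp only [conv_neg_eq, ← integral_const_mul]
  exact integral_congr_ae (Eventually.of_forall fun z =>
    integral_congr_ae (Eventually.of_forall fun h => by ring))

end Pairable

/-! ### Conservation laws tested against translates -/

/-- `∂ₜ u + ∑ₖ ∂ₖ fₖ = F` in the sense of distributions on `(0,T) × 𝕋³`. -/
def WeakDiv (T : ℝ) (u : ST → ℝ) (f : Fin 3 → ST → ℝ) (F : ST → ℝ) : Prop :=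
  ∀ ψ : testSpace T ℝ, ∫ z, (u z * dt ψ z + ∑ k, f k z * dx k ψ z) = -∫ z, F z * tf ψ z

theorem integrable_fderiv_apply {W : Type*} [NormedAddCommGroup W] [NormedSpace ℝ W]
    [MeasurableSpace W] [BorelSpace W] {μ : Measure W}
    [IsFiniteMeasureOnCompacts μ] {Φ : W → ℝ} (hΦ : ContDiff ℝ ∞ Φ)
    (hc : HasCompactSupport Φ) (v : W) : Integrable (fun w => fderiv ℝ Φ w v) μ :=
  ((hΦ.continuous_fderiv (by simp)).clm_apply continuous_const).integrable_of_hasCompactSupport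
    ((hc.fderiv ℝ).comp_left (g := fun L : W →L[ℝ] ℝ => L v) rfl)

section

variable {T : ℝ} {u F g : ST → ℝ} {f : Fin 3 → ST → ℝ} {Φ : ℝ × E3 → ℝ}

/-- The law is tested with the convolution of `Φ` and `g`: derivatives fall on `Φ`, and unfolding
the convolution leaves correlations in which the fields of the law are translated. -/
theorem WeakDiv.spaceTime_primed (hW : WeakDiv T u f F) (Pu : Pairable u g)
    (Pf : ∀ k, Pairable (f k) g) (PF : Pairable F g) (hΦ : ContDiff ℝ ∞ Φ)
    (hc : HasCompactSupport Φ) {K : Set ℝ} (hK : IsCompact K) {κ : ℝ}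
    (hKκ : ∀ t ∈ K, ∀ s, |s| ≤ κ → t + s ∈ Ioo 0 T) (hg : ∀ z : ST, z.1 ∉ K → g z = 0)
    (hs : ∀ w, κ < |w.1| → Φ w = 0) :
    (∫ w, fderiv ℝ Φ w (1, 0) * corr u g (cov w)) +
      ∑ k, ∫ w, fderiv ℝ Φ w (0, basisVec k) * corr (f k) g (cov w) =
      -∫ w, Φ w * corr F g (cov w) := by
  have hgi := Pu.integrable
  -- The time support spreads from `K` by at most `κ`, which keeps it inside the open interval.
  let γ : testSpace T ℝ := ⟨fun t x => conv Φ g (t, x), contDiff_conv hΦ hc hgi,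
    (fun p : ℝ × ℝ => p.1 + p.2) '' (K ×ˢ Icc (-κ) κ),
    (hK.prod isCompact_Icc).image (by fun_prop), by
      rintro _ ⟨⟨t, s⟩, ⟨ht, hs'⟩, rfl⟩
      exact hKκ t ht s (abs_le.2 hs'), by
      intro t ht x
      refine integral_eq_zero_of_ae (Eventually.of_forall fun h => ?_)
      by_cases h1 : κ < |h.1|
      · simp [hs h h1]
      · have : t - h.1 ∉ K := fun h2 => ht ⟨(t - h.1, h.1), ⟨h2, abs_le.1 (not_lt.1 h1)⟩, by simp⟩
        simp [hg ((t, x) - cov h) this]⟩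
  have h0 := hW γ
  have e1 : ∀ z, dt γ z = conv (fun h => fderiv ℝ Φ h (1, 0)) g z := by
    intro z
    obtain ⟨w, rfl⟩ := cov_surjective z
    rw [dt_cov]
    exact fderiv_conv hΦ hc hgi w _
  have e2 : ∀ k z, dx k γ z = conv (fun h => fderiv ℝ Φ h (0, basisVec k)) g z := by
    intro k z
    obtain ⟨w, rfl⟩ := cov_surjective z
    rw [dx_cov]
    exact fderiv_conv hΦ hc hgi w _
  have e3 : ∀ z, tf γ z = conv Φ g z := fun z => rfl
  simp only [e1, e2, e3] at h0
  have i1 := integrable_fderiv_apply (μ := volume) hΦ hc ((1 : ℝ), (0 : E3))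
  have i2 := fun k => integrable_fderiv_apply (μ := volume) hΦ hc ((0 : ℝ), basisVec k)
  have i3 := hΦ.continuous.integrable_of_hasCompactSupport (μ := volume) hc
  rw [integral_add (Pu.integrable_mul_conv i1)
    (integrable_finsetSum _ fun k _ => (Pf k).integrable_mul_conv (i2 k)),
    integral_finsetSum _ fun k _ => (Pf k).integrable_mul_conv (i2 k),
    Pu.integral_mul_conv i1, PF.integral_mul_conv i3] at h0
  rw [← h0]
  congr 1
  exact Finset.sum_congr rfl fun k _ => ((Pf k).integral_mul_conv (i2 k)).symm

/-- Here the test function is `ψ` times a convolution of `g`, so `ψ` localises in time and no margin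
is needed. Derivatives that hit `ψ` give the terms on the right with an undifferentiated kernel. -/
theorem WeakDiv.spaceTime_unprimed (hW : WeakDiv T u f F) (hg : Integrable g) (ψ : testSpace T ℝ)
    (Pu : Pairable g (tf ψ * u)) (Pf : ∀ k, Pairable g (tf ψ * f k))
    (PF : Pairable g (tf ψ * F)) (Pu' : Pairable g (u * dt ψ))
    (Pf' : ∀ k, Pairable g (f k * dx k ψ)) (hΦ : ContDiff ℝ ∞ Φ) (hc : HasCompactSupport Φ) :
    (∫ w, fderiv ℝ Φ w (1, 0) * corr g (tf ψ * u) (cov w)) +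
      ∑ k, ∫ w, fderiv ℝ Φ w (0, basisVec k) * corr g (tf ψ * f k) (cov w) =
      (∫ w, Φ w * corr g (tf ψ * F) (cov w)) + (∫ w, Φ w * corr g (u * dt ψ) (cov w)) +
        ∑ k, ∫ w, Φ w * corr g (f k * dx k ψ) (cov w) := by
  -- The reflected kernel makes `g` the translated factor; its derivative is minus the reflected
  -- derivative of `Φ`.
  let Φ' : ℝ × E3 → ℝ := fun h => Φ (-h)
  have hΦ' : ContDiff ℝ ∞ Φ' := hΦ.comp contDiff_neg
  have hc' : HasCompactSupport Φ' := hc.comp_homeomorph (Homeomorph.neg _)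
  have hd : ∀ v, (fun h => fderiv ℝ Φ' h v) = fun h => (fun w => -fderiv ℝ Φ w v) (-h) := by
    intro v
    funext h
    have h1 : HasFDerivAt Φ' ((fderiv ℝ Φ (-h)).comp (-ContinuousLinearMap.id ℝ (ℝ × E3))) h :=
      ((hΦ.differentiable (by simp) (-h)).hasFDerivAt).comp h ((hasFDerivAt_id h).neg)
    rw [h1.fderiv]
    simp
  let γ := mulTest ψ (fun t x => conv Φ' g (t, x)) (contDiff_conv hΦ' hc' hg)
  have h0 := hW γ
  have e1 : ∀ z, dt γ z = tf ψ z * conv (fun h => fderiv ℝ Φ' h (1, 0)) g z +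
      dt ψ z * conv Φ' g z := by
    intro z
    obtain ⟨w, rfl⟩ := cov_surjective z
    rw [dt_cov, dt_cov, ← fderiv_conv hΦ' hc' hg]
    exact fderiv_mulTest ψ _ w _
  have e2 : ∀ k z, dx k γ z = tf ψ z * conv (fun h => fderiv ℝ Φ' h (0, basisVec k)) g z +
      dx k ψ z * conv Φ' g z := by
    intro k z
    obtain ⟨w, rfl⟩ := cov_surjective z
    rw [dx_cov, dx_cov, ← fderiv_conv hΦ' hc' hg]
    exact fderiv_mulTest ψ _ w _
  have e3 : ∀ z, tf γ z = tf ψ z * conv Φ' g z := fun z => rfl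
  have i1 := (integrable_fderiv_apply (μ := volume) hΦ hc ((1 : ℝ), (0 : E3))).neg
  have i2 := fun k => (integrable_fderiv_apply (μ := volume) hΦ hc ((0 : ℝ), basisVec k)).neg
  have i3 := hΦ.continuous.integrable_of_hasCompactSupport (μ := volume) hc
  have h1 := Pu.integrable_mul_conv_neg i1
  have h2 := fun k => (Pf k).integrable_mul_conv_neg (i2 k)
  have h3 := PF.integrable_mul_conv_neg i3
  have h4 : Integrable (fun z => (u * dt ψ) z * conv Φ' g z) := Pu'.integrable_mul_conv_neg i3
  have h5 : ∀ k, Integrable (fun z => (f k * dx k ψ) z * conv Φ' g z) := fun k =>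
    (Pf' k).integrable_mul_conv_neg i3
  have j1 := Pu.integral_mul_conv_neg i1
  have j2 := fun k => (Pf k).integral_mul_conv_neg (i2 k)
  have j3 := PF.integral_mul_conv_neg i3
  have j4 := Pu'.integral_mul_conv_neg i3
  have j5 := fun k => (Pf' k).integral_mul_conv_neg i3
  simp only [Pi.neg_def, neg_mul, integral_neg] at h1 h2 j1 j2
  have key : ∀ z, u z * dt γ z + ∑ k, f k z * dx k γ z =
      ((tf ψ * u) z * conv (fun h => -fderiv ℝ Φ (-h) (1, 0)) g z +
        ∑ k, (tf ψ * f k) z * conv (fun h => -fderiv ℝ Φ (-h) (0, basisVec k)) g z) +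
      ((u * dt ψ) z * conv Φ' g z + ∑ k, (f k * dx k ψ) z * conv Φ' g z) := by
    intro z
    simp only [e1, e2, hd, Pi.mul_apply]
    rw [add_add_add_comm, ← Finset.sum_add_distrib]
    congr 1
    · ring
    · exact Finset.sum_congr rfl fun k _ => by ring
  simp only [key] at h0
  have h2s : Integrable (fun z => ∑ k, (tf ψ * f k) z *
      conv (fun h => -fderiv ℝ Φ (-h) (0, basisVec k)) g z) := integrable_finsetSum _ fun k _ => h2 k
  have h5s : Integrable (fun z => ∑ k, (f k * dx k ψ) z * conv Φ' g z) :=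
    integrable_finsetSum _ fun k _ => h5 k
  have hsum := integral_add (h1.add h2s) (h4.add h5s)
  simp only [Pi.add_apply] at hsum
  rw [hsum, integral_add h1 h2s, integral_add h4 h5s,
    integral_finsetSum _ (fun k _ => h2 k), integral_finsetSum _ (fun k _ => h5 k), j1] at h0
  simp only [Φ', j2, j4, j5, Finset.sum_neg_distrib] at h0
  have e4 : ∫ z, F z * tf γ z = ∫ w, Φ w * corr g (tf ψ * F) (cov w) := by
    rw [← j3]
    exact integral_congr_ae (Eventually.of_forall fun z => by
      simp only [e3, Pi.mul_apply, Φ']; ring)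
  rw [e4] at h0
  linarith

end

/-! ### From space-time kernels to spatial kernels -/

/-- The pairing `∫ φ(ℓ) ∫ f(t, x + ℓ) g(t, x) dt dx dℓ`. -/
def pairing (φ : E3 → ℝ) (f g : ST → ℝ) : ℝ := ∫ l, φ l * corr f g (sp l)

/-- Partial derivative of a function on `ℝ³`. -/
def pd (k : Fin 3) (φ : E3 → ℝ) (l : E3) : ℝ := fderiv ℝ φ l (basisVec k)

/-- Arbitrary time weights near zero force the spatial integral to vanish for almost every small
time displacement; its continuity gives the value at exactly zero. -/
theorem integral_slice_eq_zero {Ψ : ℝ × E3 → ℝ} (hΨ : Continuous Ψ) {L : Set E3}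
    (hL : IsCompact L) (hsupp : ∀ w, w.2 ∉ L → Ψ w = 0) {κ : ℝ} (hκ : 0 < κ)
    (h : ∀ η : ℝ → ℝ, ContDiff ℝ ∞ η → HasCompactSupport η → tsupport η ⊆ Ioo (-κ) κ →
      ∫ w, η w.1 * Ψ w = 0) : ∫ l, Ψ (0, l) = 0 := by
  let Q : ℝ → ℝ := fun s => ∫ l in L, Ψ (s, l)
  have hQ' : ∀ s, Q s = ∫ l, Ψ (s, l) := fun s =>
    setIntegral_eq_integral_of_forall_compl_eq_zero fun l hl => hsupp (s, l) hl
  have hQ : Continuous Q :=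
    continuous_parametric_integral_of_continuous (f := fun s l => Ψ (s, l)) hΨ hL
  have h1 : ∀ᵐ s, s ∈ Ioo (-κ) κ → Q s = 0 := by
    refine isOpen_Ioo.ae_eq_zero_of_integral_contDiff_smul_eq_zero
      (hQ.locallyIntegrable.locallyIntegrableOn _) fun η hη hηc hηs => ?_
    rw [← h η hη hηc hηs]
    have hi : Integrable (fun w : ℝ × E3 => η w.1 * Ψ w) (volume.prod volume) := by
      refine ((hη.continuous.comp continuous_fst).mul hΨ).integrable_of_hasCompactSupport
        (HasCompactSupport.intro (hηc.isCompact.prod hL) fun w hw => ?_)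
      simp only [mem_prod, not_and_or] at hw
      rcases hw with hw | hw
      · simp [image_eq_zero_of_notMem_tsupport hw]
      · simp [hsupp w hw]
    rw [Measure.volume_eq_prod, integral_prod _ hi]
    simp only [integral_const_mul, hQ', smul_eq_mul]
  have h2 : EqOn Q 0 (Ioo (-κ) κ) := by
    refine Measure.eqOn_open_of_ae_eq (μ := volume) ?_ isOpen_Ioo hQ.continuousOn
      continuousOn_const
    rw [EventuallyEq, ae_restrict_iff' measurableSet_Ioo]
    exact h1
  rw [← hQ']
  exact h2 ⟨by linarith, hκ⟩

theorem contDiff_pd {φ : E3 → ℝ} (hφ : ContDiff ℝ ∞ φ) (k : Fin 3) : ContDiff ℝ ∞ (pd k φ) :=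
  (hφ.fderiv_right (m := ∞) (by simp)).clm_apply contDiff_const

theorem hasCompactSupport_pd {φ : E3 → ℝ} (hc : HasCompactSupport φ) (k : Fin 3) :
    HasCompactSupport (pd k φ) :=
  (hc.fderiv ℝ).comp_left (g := fun L : E3 →L[ℝ] ℝ => L (basisVec k)) rfl

theorem fderiv_tensor {η : ℝ → ℝ} {φ : E3 → ℝ} (hη : ContDiff ℝ ∞ η) (hφ : ContDiff ℝ ∞ φ)
    (w v : ℝ × E3) :
    fderiv ℝ (fun w : ℝ × E3 => η w.1 * φ w.2) w v =
      η w.1 * fderiv ℝ φ w.2 v.2 + φ w.2 * fderiv ℝ η w.1 v.1 := by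
  have h1 : HasFDerivAt (fun w : ℝ × E3 => η w.1) _ w :=
    (hη.differentiable (by simp) w.1).hasFDerivAt.comp w hasFDerivAt_fst
  have h2 : HasFDerivAt (fun w : ℝ × E3 => φ w.2) _ w :=
    (hφ.differentiable (by simp) w.2).hasFDerivAt.comp w hasFDerivAt_snd
  change fderiv ℝ ((fun w : ℝ × E3 => η w.1) * fun w => φ w.2) w v = _
  rw [(h1.mul h2).fderiv]
  simp

theorem exists_time_margin {T : ℝ} {K : Set ℝ} (hK : IsCompact K) (hKT : K ⊆ Ioo 0 T) :
    ∃ κ > 0, ∀ t ∈ K, ∀ s, |s| ≤ κ → t + s ∈ Ioo 0 T := by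
  obtain ⟨κ, hκ, h⟩ := hK.exists_cthickening_subset_open isOpen_Ioo hKT
  refine ⟨κ, hκ, fun t ht s hs => h (Metric.mem_cthickening_of_dist_le _ t _ _ ht ?_)⟩
  simpa [Real.dist_eq] using hs

section Spatial

variable {φ : E3 → ℝ}

theorem hasCompactSupport_tensor {η : ℝ → ℝ} (hη : HasCompactSupport η)
    (hc : HasCompactSupport φ) : HasCompactSupport fun w : ℝ × E3 => η w.1 * φ w.2 := by
  refine HasCompactSupport.intro (hη.isCompact.prod hc.isCompact) fun w hw => ?_
  simp only [mem_prod, not_and_or] at hw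
  rcases hw with hw | hw
  · simp [image_eq_zero_of_notMem_tsupport hw]
  · simp [image_eq_zero_of_notMem_tsupport hw]

/-- An identity between space-time averages of continuous functions, valid for all time kernels
concentrated near zero, restricts to time displacement zero. -/
theorem slice_identity {A : Fin 3 → ST → ℝ} {B : ST → ℝ} (hA : ∀ k, Continuous (A k))
    (hB : Continuous B) (hφ : ContDiff ℝ ∞ φ) (hc : HasCompactSupport φ) {κ : ℝ} (hκ : 0 < κ)
    (h : ∀ η : ℝ → ℝ, ContDiff ℝ ∞ η → HasCompactSupport η → (∀ s, κ < |s| → η s = 0) →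
      ∑ k, ∫ w : ℝ × E3, η w.1 * pd k φ w.2 * A k (cov w) =
        ∫ w : ℝ × E3, η w.1 * φ w.2 * B (cov w)) :
    ∑ k, ∫ l, pd k φ l * A k (sp l) = ∫ l, φ l * B (sp l) := by
  have cA : ∀ k, Continuous fun w : ℝ × E3 => pd k φ w.2 * A k (cov w) := fun k =>
    ((contDiff_pd hφ k).continuous.comp continuous_snd).mul ((hA k).comp continuous_cov)
  have cB : Continuous fun w : ℝ × E3 => φ w.2 * B (cov w) :=
    (hφ.continuous.comp continuous_snd).mul (hB.comp continuous_cov)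
  have h0 : ∀ k l, l ∉ tsupport φ → pd k φ l = 0 := fun k l hl =>
    (image_eq_zero_of_notMem_tsupport fun h' => hl
      ((tsupport_fderiv_apply_subset ℝ (f := φ) (basisVec k)) h'))
  have key := integral_slice_eq_zero
    (Ψ := fun w => ∑ k, pd k φ w.2 * A k (cov w) - φ w.2 * B (cov w))
    ((continuous_finsetSum _ fun k _ => cA k).sub cB) hc.isCompact
    (fun w hw => by simp [h0 _ _ hw, image_eq_zero_of_notMem_tsupport hw]) hκ
    (fun η hη hηc hηs => by
      have iA : ∀ k, Integrable fun w : ℝ × E3 => η w.1 * pd k φ w.2 * A k (cov w) := fun k =>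
        (((hη.continuous.comp continuous_fst).mul ((contDiff_pd hφ k).continuous.comp
          continuous_snd)).mul ((hA k).comp continuous_cov)).integrable_of_hasCompactSupport
          ((hasCompactSupport_tensor hηc (hasCompactSupport_pd hc k)).mul_right)
      have iB : Integrable fun w : ℝ × E3 => η w.1 * φ w.2 * B (cov w) :=
        (((hη.continuous.comp continuous_fst).mul (hφ.continuous.comp
          continuous_snd)).mul (hB.comp continuous_cov)).integrable_of_hasCompactSupport
          ((hasCompactSupport_tensor hηc hc).mul_right)
      have h1 := h η hη hηc fun s hs => image_eq_zero_of_notMem_tsupport fun h' =>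
        (abs_lt.2 (hηs h')).not_gt hs
      rw [← integral_finsetSum _ fun k _ => iA k] at h1
      rw [← sub_eq_zero, ← integral_sub (integrable_finsetSum _ fun k _ => iA k) iB] at h1
      rw [← h1]
      refine integral_congr_ae (Eventually.of_forall fun w => ?_)
      simp only [mul_sub, Finset.mul_sum, mul_assoc])
  have cA' : ∀ k, Integrable fun l => pd k φ l * A k (sp l) := fun k =>
    ((contDiff_pd hφ k).continuous.mul ((hA k).comp continuous_sp)).integrable_of_hasCompactSupport
      (hasCompactSupport_pd hc k).mul_right
  have cB' : Integrable fun l => φ l * B (sp l) :=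
    (hφ.continuous.mul (hB.comp continuous_sp)).integrable_of_hasCompactSupport hc.mul_right
  rw [← sub_eq_zero, ← integral_finsetSum _ fun k _ => cA' k,
    ← integral_sub (integrable_finsetSum _ fun k _ => cA' k) cB']
  exact key

variable {T : ℝ} {u F g : ST → ℝ} {f : Fin 3 → ST → ℝ}

theorem integrable_mul_corr {f' g' : ST → ℝ} (P : Pairable f' g') (hφ : Continuous φ) (hc : HasCompactSupport φ) :
    Integrable fun l => φ l * corr f' g' (sp l) :=
  (hφ.mul (P.continuous_corr.comp continuous_sp)).integrable_of_hasCompactSupport hc.mul_right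

theorem fderiv_tensor_space {η : ℝ → ℝ} (hη : ContDiff ℝ ∞ η) (hφ : ContDiff ℝ ∞ φ)
    (w : ℝ × E3) (k : Fin 3) : fderiv ℝ (fun w : ℝ × E3 => η w.1 * φ w.2) w (0, basisVec k) =
      η w.1 * pd k φ w.2 := by
  rw [fderiv_tensor hη hφ]; simp [pd]

theorem contDiff_tensor {η : ℝ → ℝ} (hη : ContDiff ℝ ∞ η) (hφ : ContDiff ℝ ∞ φ) :
    ContDiff ℝ ∞ fun w : ℝ × E3 => η w.1 * φ w.2 :=
  (hη.comp contDiff_fst).mul (hφ.comp contDiff_snd)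

theorem corr_zero_left (g : ST → ℝ) (h : ST) : corr 0 g h = 0 := by simp [corr]

theorem corr_zero_right (f : ST → ℝ) (h : ST) : corr f 0 h = 0 := by simp [corr]

theorem Pairable.zero_left {g : ST → ℝ} (hg : Integrable g) : Pairable 0 g :=
  .of_bounded aestronglyMeasurable_zero hg (c := 0) (by simp)

theorem Pairable.zero_right {f : ST → ℝ} (hf : AEStronglyMeasurable f volume) : Pairable f 0 :=
  ⟨hf, integrable_zero _ _ _, fun _ _ => ⟨0, le_rfl, by simp⟩⟩

/-- A spatial conservation law, applied to the translated factor of a correlation. -/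
theorem WeakDiv.primed (hW : WeakDiv T 0 f F) (Pf : ∀ k, Pairable (f k) g) (PF : Pairable F g)
    {K : Set ℝ} (hK : IsCompact K) (hKT : K ⊆ Ioo 0 T) (hg : ∀ z : ST, z.1 ∉ K → g z = 0)
    (hφ : ContDiff ℝ ∞ φ) (hc : HasCompactSupport φ) :
    ∑ k, pairing (pd k φ) (f k) g = -pairing φ F g := by
  obtain ⟨κ, hκ, hKκ⟩ := exists_time_margin hK hKT
  have := slice_identity (A := fun k => corr (f k) g) (B := fun z => -corr F g z)
    (fun k => (Pf k).continuous_corr) PF.continuous_corr.neg hφ hc hκ fun η hη hηc hηs => by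
      have h1 := hW.spaceTime_primed (.zero_left PF.integrable) Pf PF (contDiff_tensor hη hφ)
        (hasCompactSupport_tensor hηc hc) hK hKκ hg (fun w hw => by simp [hηs _ hw])
      simp only [fderiv_tensor_space hη hφ, corr_zero_left, mul_zero, integral_zero, zero_add] at h1
      rw [h1]
      simp only [mul_neg, integral_neg]
  simpa only [pairing, mul_neg, integral_neg] using this

/-- A spatial conservation law, applied to the fixed factor of a correlation. -/
theorem WeakDiv.unprimed (hW : WeakDiv T 0 f F) (hg : Integrable g) (ψ : testSpace T ℝ)
    (Pf : ∀ k, Pairable g (tf ψ * f k)) (PF : Pairable g (tf ψ * F))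
    (Pf' : ∀ k, Pairable g (f k * dx k ψ)) (hφ : ContDiff ℝ ∞ φ) (hc : HasCompactSupport φ) :
    ∑ k, pairing (pd k φ) g (tf ψ * f k) =
      pairing φ g (tf ψ * F) + ∑ k, pairing φ g (f k * dx k ψ) := by
  have := slice_identity (A := fun k => corr g (tf ψ * f k))
    (B := fun z => corr g (tf ψ * F) z + ∑ k, corr g (f k * dx k ψ) z)
    (fun k => (Pf k).continuous_corr) (PF.continuous_corr.add
      (continuous_finsetSum _ fun k _ => (Pf' k).continuous_corr)) hφ hc one_pos
      fun η hη hηc hηs => by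
      have h1 := hW.spaceTime_unprimed hg ψ (by simpa using .zero_right hg.1) Pf PF
        (by simpa using .zero_right hg.1) Pf' (contDiff_tensor hη hφ)
        (hasCompactSupport_tensor hηc hc)
      simp only [fderiv_tensor_space hη hφ, corr_zero_right, mul_zero, zero_mul, integral_zero,
        zero_add, add_zero] at h1
      have ii : ∀ {g' : ST → ℝ}, Pairable g g' → Integrable fun w : ℝ × E3 =>
          η w.1 * φ w.2 * corr g g' (cov w) := fun P =>
        ((contDiff_tensor hη hφ).continuous.mul (P.continuous_corr.comp
          continuous_cov)).integrable_of_hasCompactSupport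
          (hasCompactSupport_tensor hηc hc).mul_right
      rw [h1]
      simp only [mul_add, Finset.mul_sum]
      rw [integral_add (ii PF) (integrable_finsetSum _ fun k _ => ii (Pf' k)),
        integral_finsetSum _ fun k _ => ii (Pf' k)]
  simp only [mul_add, Finset.mul_sum] at this
  rw [integral_add (integrable_mul_corr PF hφ.continuous hc)
    (integrable_finsetSum _ fun k _ => integrable_mul_corr (Pf' k) hφ.continuous hc),
    integral_finsetSum _ fun k _ => integrable_mul_corr (Pf' k) hφ.continuous hc] at this
  exact this

/-- An evolution law, applied to both factors of the correlation of the evolving quantity with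
itself: the time derivatives cancel. -/
theorem WeakDiv.exchange (hW : WeakDiv T u f 0) (hu : Integrable u) (ψ : testSpace T ℝ)
    (Pu : Pairable u (tf ψ * u)) (Pf : ∀ k, Pairable (f k) (tf ψ * u))
    (Pf₂ : ∀ k, Pairable u (tf ψ * f k)) (Pu' : Pairable u (u * dt ψ))
    (Pf' : ∀ k, Pairable u (f k * dx k ψ)) (hφ : ContDiff ℝ ∞ φ) (hc : HasCompactSupport φ) :
    ∑ k, pairing (pd k φ) (f k) (tf ψ * u) - ∑ k, pairing (pd k φ) u (tf ψ * f k) =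
      -pairing φ u (u * dt ψ) - ∑ k, pairing φ u (f k * dx k ψ) := by
  obtain ⟨K, hK, hKT, hψ⟩ := exists_compact_support ψ
  obtain ⟨κ, hκ, hKκ⟩ := exists_time_margin hK hKT
  have := slice_identity (A := fun k z => corr (f k) (tf ψ * u) z - corr u (tf ψ * f k) z)
    (B := fun z => -(corr u (u * dt ψ) z + ∑ k, corr u (f k * dx k ψ) z))
    (fun k => (Pf k).continuous_corr.sub (Pf₂ k).continuous_corr) (Pu'.continuous_corr.add
      (continuous_finsetSum _ fun k _ => (Pf' k).continuous_corr)).neg hφ hc hκ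
      fun η hη hηc hηs => by
      have h1 := hW.spaceTime_primed Pu Pf (.zero_left Pu.integrable) (contDiff_tensor hη hφ)
        (hasCompactSupport_tensor hηc hc) hK hKκ (fun z hz => by simp [(hψ z hz).1])
        (fun w hw => by simp [hηs _ hw])
      have h2 := hW.spaceTime_unprimed hu ψ Pu Pf₂ (by simpa using .zero_right hu.1) Pu' Pf'
        (contDiff_tensor hη hφ) (hasCompactSupport_tensor hηc hc)
      simp only [fderiv_tensor_space hη hφ, corr_zero_right, corr_zero_left, mul_zero,
        integral_zero, zero_add, neg_zero] at h1 h2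
      have ii : ∀ {f' g' : ST → ℝ}, Pairable f' g' → Integrable fun w : ℝ × E3 =>
          η w.1 * φ w.2 * corr f' g' (cov w) := fun P =>
        ((contDiff_tensor hη hφ).continuous.mul (P.continuous_corr.comp
          continuous_cov)).integrable_of_hasCompactSupport
          (hasCompactSupport_tensor hηc hc).mul_right
      have ij : ∀ {f' g' : ST → ℝ} k, Pairable f' g' → Integrable fun w : ℝ × E3 =>
          η w.1 * pd k φ w.2 * corr f' g' (cov w) := fun k P =>
        ((contDiff_tensor hη (contDiff_pd hφ k)).continuous.mul (P.continuous_corr.comp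
          continuous_cov)).integrable_of_hasCompactSupport
          (hasCompactSupport_tensor hηc (hasCompactSupport_pd hc k)).mul_right
      simp only [mul_sub, mul_add, Finset.mul_sum, mul_neg, integral_neg]
      rw [integral_add (ii Pu') (integrable_finsetSum _ fun k _ => ii (Pf' k)),
        integral_finsetSum _ fun k _ => ii (Pf' k)]
      simp only [fun k => integral_sub (ij k (Pf k)) (ij k (Pf₂ k)), Finset.sum_sub_distrib]
      -- The terms with the time derivative of the kernel in `h1` and `h2` are the same integral of
      -- `corr u (tf ψ * u)`, so they cancel in the difference.
      linarith
  have ij : ∀ {f' g' : ST → ℝ} k, Pairable f' g' → Integrable fun l =>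
      pd k φ l * corr f' g' (sp l) := fun k P =>
    integrable_mul_corr P (contDiff_pd hφ k).continuous (hasCompactSupport_pd hc k)
  simp only [mul_sub, mul_add, Finset.mul_sum, mul_neg, integral_neg] at this
  rw [integral_add (integrable_mul_corr Pu' hφ.continuous hc)
    (integrable_finsetSum _ fun k _ => integrable_mul_corr (Pf' k) hφ.continuous hc),
    integral_finsetSum _ fun k _ => integrable_mul_corr (Pf' k) hφ.continuous hc] at this
  simp only [fun k => integral_sub (ij k (Pf k)) (ij k (Pf₂ k)), Finset.sum_sub_distrib] at this
  simp only [pairing]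
  linarith

end Spatial

/-! ### More criteria for pairability -/

theorem tendsto_lintegral_tailPart {f : ST → ℝ} (hf : Integrable f) :
    Tendsto (fun n : ℕ => ∫⁻ z, tailPart n f z) atTop (𝓝 0) := by
  rw [← lintegral_zero (μ := (volume : Measure ST))]
  refine tendsto_lintegral_of_dominated_convergence' (fun z => ‖f z‖ₑ)
    (fun n => aemeasurable_tailPart hf.1) (fun n => Eventually.of_forall fun z => ?_) hf.2.ne
    (Eventually.of_forall fun z => ?_)
  · exact indicator_le_self _ (fun w => ‖f w‖ₑ) z
  · refine tendsto_const_nhds.congr' ?_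
    obtain ⟨n₀, hn₀⟩ := exists_nat_ge ‖f z‖
    filter_upwards [eventually_ge_atTop n₀] with n hn
    have : ¬ ((n : ℝ) < ‖f z‖) := not_lt.2 (hn₀.trans (by exact_mod_cast hn))
    simp [tailPart, indicator, this, -Real.norm_eq_abs]

namespace Pairable

variable {f f' g g' : ST → ℝ}

/-- With `g` bounded, the tail integral is at most `c` times the L¹ mass of the tail of `f`, which
does not see the translation. -/
theorem of_bounded_right (hf : Integrable f) (hg : Integrable g) {c : ℝ}
    (hc : ∀ z, ‖g z‖ ≤ c) : Pairable f g := by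
  refine ⟨hf.1, hg, fun ε hε => ?_⟩
  have h1 := ENNReal.Tendsto.const_mul (a := ENNReal.ofReal c) (tendsto_lintegral_tailPart hf)
    (Or.inr ENNReal.ofReal_ne_top)
  rw [mul_zero] at h1
  obtain ⟨n, hn⟩ := (h1.eventually_le_const (pos_iff_ne_zero.2 hε)).exists
  refine ⟨n, n.cast_nonneg, fun h => le_trans ?_ hn⟩
  calc ∫⁻ z, tailPart n f (z + h) * ‖g z‖ₑ
      ≤ ∫⁻ z, ENNReal.ofReal c * tailPart n f (z + h) := by
        refine lintegral_mono fun z => ?_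
        rw [mul_comm]
        refine mul_le_mul_left ?_ _
        rw [← ofReal_norm]
        exact ENNReal.ofReal_le_ofReal (hc z)
    _ = ENNReal.ofReal c * ∫⁻ z, tailPart n f z := by
        rw [lintegral_const_mul' _ _ ENNReal.ofReal_ne_top,
          lintegral_add_right_eq_self (tailPart n f) h]

end Pairable

/-! ### Bilinearity of the pairing -/

section Bilinear

variable {φ : E3 → ℝ} {f f' g g' : ST → ℝ}

theorem corr_add_left (P : Pairable f g) (P' : Pairable f' g) (h : ST) :
    corr (f + f') g h = corr f g h + corr f' g h := by
  simp only [corr, Pi.add_apply, add_mul]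
  exact integral_add (P.integrable_mul h) (P'.integrable_mul h)

theorem corr_sub_left (P : Pairable f g) (P' : Pairable f' g) (h : ST) :
    corr (f - f') g h = corr f g h - corr f' g h := by
  simp only [corr, Pi.sub_apply, sub_mul]
  exact integral_sub (P.integrable_mul h) (P'.integrable_mul h)

theorem corr_sub_right (P : Pairable f g) (P' : Pairable f g') (h : ST) :
    corr f (g - g') h = corr f g h - corr f g' h := by
  simp only [corr, Pi.sub_apply, mul_sub]
  exact integral_sub (P.integrable_mul h) (P'.integrable_mul h)

theorem corr_neg_left (f g : ST → ℝ) (h : ST) : corr (-f) g h = -corr f g h := by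
  simp [corr, integral_neg]

theorem corr_neg_right (f g : ST → ℝ) (h : ST) : corr f (-g) h = -corr f g h := by
  simp [corr, integral_neg]

theorem corr_smul_left (c : ℝ) (f g : ST → ℝ) (h : ST) : corr (c • f) g h = c * corr f g h := by
  simp [corr, mul_assoc, integral_const_mul]

theorem corr_smul_right (c : ℝ) (f g : ST → ℝ) (h : ST) : corr f (c • g) h = c * corr f g h := by
  simp [corr, mul_left_comm, integral_const_mul]

theorem pairing_neg_left (φ : E3 → ℝ) (f g : ST → ℝ) : pairing φ (-f) g = -pairing φ f g := by
  simp [pairing, corr_neg_left, integral_neg]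

theorem pairing_neg_right (φ : E3 → ℝ) (f g : ST → ℝ) : pairing φ f (-g) = -pairing φ f g := by
  simp [pairing, corr_neg_right, integral_neg]

theorem pairing_smul_left (c : ℝ) (φ : E3 → ℝ) (f g : ST → ℝ) :
    pairing φ (c • f) g = c * pairing φ f g := by
  simp only [pairing, corr_smul_left, mul_left_comm _ c, integral_const_mul]

theorem pairing_smul_right (c : ℝ) (φ : E3 → ℝ) (f g : ST → ℝ) :
    pairing φ f (c • g) = c * pairing φ f g := by
  simp only [pairing, corr_smul_right, mul_left_comm _ c, integral_const_mul]

theorem pairing_zero_left (φ : E3 → ℝ) (g : ST → ℝ) : pairing φ 0 g = 0 := by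
  simp [pairing, corr_zero_left]

theorem pairing_zero_right (φ : E3 → ℝ) (f : ST → ℝ) : pairing φ f 0 = 0 := by
  simp [pairing, corr_zero_right]

/-- Smooth compactly supported kernels on `ℝ³`. -/
structure IsKernel (φ : E3 → ℝ) : Prop where
  smooth : ContDiff ℝ ∞ φ
  compact : HasCompactSupport φ

theorem IsKernel.pd (hφ : IsKernel φ) (k : Fin 3) : IsKernel (pd k φ) :=
  ⟨contDiff_pd hφ.smooth k, hasCompactSupport_pd hφ.compact k⟩

theorem IsKernel.integrable_mul_corr (hφ : IsKernel φ) (P : Pairable f g) :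
    Integrable fun l => φ l * corr f g (sp l) :=
  EMHD.integrable_mul_corr P hφ.smooth.continuous hφ.compact

theorem IsKernel.pairing_sub_left (hφ : IsKernel φ) (P : Pairable f g) (P' : Pairable f' g) :
    pairing φ (f - f') g = pairing φ f g - pairing φ f' g := by
  simp only [pairing, corr_sub_left P P', mul_sub]
  exact integral_sub (hφ.integrable_mul_corr P) (hφ.integrable_mul_corr P')

theorem IsKernel.pairing_sub_right (hφ : IsKernel φ) (P : Pairable f g) (P' : Pairable f g') :
    pairing φ f (g - g') = pairing φ f g - pairing φ f g' := by
  simp only [pairing, corr_sub_right P P', mul_sub]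
  exact integral_sub (hφ.integrable_mul_corr P) (hφ.integrable_mul_corr P')

end Bilinear

/-! ### Field configurations -/

/-- The indicator function of `(0,T) × 𝕋³`. -/
def slab (T : ℝ) (z : ST) : ℝ := (Ioo 0 T).indicator 1 z.1

/-- The monomials `β^a ι^c` restricted to `(0,T) × 𝕋³`. -/
def monom (T : ℝ) (β ι : ST → ℝ) (a c : ℕ) (z : ST) : ℝ := slab T z * (β z ^ a * ι z ^ c)

/-- A magnetic field `B` and a current `J` on space-time, extended by zero outside `(0,T)`, together
with their pointwise sizes, solving the electron MHD equations in conservation form. -/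
structure Config (T : ℝ) where
  B : Fin 3 → ST → ℝ
  J : Fin 3 → ST → ℝ
  β : ST → ℝ
  ι : ST → ℝ
  B_aesm : ∀ i, AEStronglyMeasurable (B i) volume
  J_aesm : ∀ i, AEStronglyMeasurable (J i) volume
  β_eq : ∀ z, β z ^ 2 = ∑ i, B i z ^ 2
  ι_eq : ∀ z, ι z ^ 2 = ∑ i, J i z ^ 2
  β_nonneg : ∀ z, 0 ≤ β z
  ι_nonneg : ∀ z, 0 ≤ ι z
  β_supp : ∀ z : ST, z.1 ∉ Ioo 0 T → β z = 0
  ι_supp : ∀ z : ST, z.1 ∉ Ioo 0 T → ι z = 0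
  energy : ∃ C : ℝ≥0∞, C ≠ ⊤ ∧ ∀ᵐ t : ℝ, ∫⁻ x : T3, ‖β (t, x)‖ₑ ^ 2 ≤ C
  pair : ∀ a c a' c' : ℕ, a + a' ≤ 2 → c + c' ≤ 1 →
    Pairable (monom T β ι a c) (monom T β ι a' c')
  div_B : WeakDiv T 0 B 0
  div_J : WeakDiv T 0 J 0
  curl_zero : WeakDiv T 0 ![0, B 2, -B 1] (J 0)
  curl_one : WeakDiv T 0 ![-B 2, 0, B 0] (J 1)
  curl_two : WeakDiv T 0 ![B 1, -B 0, 0] (J 2)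
  induction_eq : ∀ i, WeakDiv T (B i) (fun k => J i * B k - J k * B i) 0

namespace Config

variable {T : ℝ} (D : Config T)

/-- Functions dominated by the monomial `β^a ι^c`. -/
class Dom (f : ST → ℝ) (a c : outParam ℕ) : Prop where
  aesm : AEStronglyMeasurable f volume
  bound : ∃ C : ℝ, ∀ z, ‖f z‖ ≤ C * ‖monom T D.β D.ι a c z‖

theorem slab_of_mem {z : ST} (h : z.1 ∈ Ioo 0 T) : slab T z = 1 := by
  simp [slab, indicator_of_mem h]

theorem slab_of_notMem {z : ST} (h : z.1 ∉ Ioo 0 T) : slab T z = 0 := by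
  simp [slab, indicator_of_notMem h]

theorem slab_mul_self (z : ST) : slab T z * slab T z = slab T z := by
  by_cases h : z.1 ∈ Ioo 0 T
  · simp [slab_of_mem h]
  · simp [slab_of_notMem h]

theorem norm_B_le (i : Fin 3) (z : ST) : ‖D.B i z‖ ≤ D.β z := by
  refine abs_le_of_sq_le_sq ?_ (D.β_nonneg z)
  rw [D.β_eq]
  exact Finset.single_le_sum (f := fun i => D.B i z ^ 2) (fun _ _ => sq_nonneg _) (Finset.mem_univ i)

theorem norm_J_le (i : Fin 3) (z : ST) : ‖D.J i z‖ ≤ D.ι z := by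
  refine abs_le_of_sq_le_sq ?_ (D.ι_nonneg z)
  rw [D.ι_eq]
  exact Finset.single_le_sum (f := fun i => D.J i z ^ 2) (fun _ _ => sq_nonneg _) (Finset.mem_univ i)

instance (i : Fin 3) : D.Dom (D.B i) 1 0 := ⟨D.B_aesm i, 1, fun z => by
  by_cases h : z.1 ∈ Ioo 0 T
  · simpa [monom, slab_of_mem h, abs_of_nonneg (D.β_nonneg z)] using D.norm_B_le i z
  · simpa [monom, slab_of_notMem h, D.β_supp z h] using D.norm_B_le i z⟩

instance (i : Fin 3) : D.Dom (D.J i) 0 1 := ⟨D.J_aesm i, 1, fun z => by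
  by_cases h : z.1 ∈ Ioo 0 T
  · simpa [monom, slab_of_mem h, abs_of_nonneg (D.ι_nonneg z)] using D.norm_J_le i z
  · simpa [monom, slab_of_notMem h, D.ι_supp z h] using D.norm_J_le i z⟩

theorem dom_of_continuous {f : ST → ℝ} (hf : Continuous f) {C : ℝ} (hC : ∀ z, ‖f z‖ ≤ C)
    (h0 : ∀ z : ST, z.1 ∉ Ioo 0 T → f z = 0) : D.Dom f 0 0 := ⟨hf.aestronglyMeasurable, C, fun z => by
  by_cases h : z.1 ∈ Ioo 0 T
  · simpa [monom, slab_of_mem h] using hC z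
  · simp [h0 z h, monom, slab_of_notMem h]⟩

instance (ψ : testSpace T ℝ) : D.Dom (tf ψ) 0 0 := by
  obtain ⟨C, hC⟩ := exists_bound_tf ψ
  obtain ⟨K, hK, hKT, h⟩ := exists_compact_support ψ
  exact D.dom_of_continuous (continuous_tf ψ) hC fun z hz => (h z fun h' => hz (hKT h')).1

instance (ψ : testSpace T ℝ) : D.Dom (dt ψ) 0 0 := by
  obtain ⟨C, hC⟩ := exists_bound_dt ψ
  obtain ⟨K, hK, hKT, h⟩ := exists_compact_support ψ
  exact D.dom_of_continuous (continuous_dt ψ) hC fun z hz => (h z fun h' => hz (hKT h')).2.1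

instance (k : Fin 3) (ψ : testSpace T ℝ) : D.Dom (dx k ψ) 0 0 := by
  obtain ⟨C, hC⟩ := exists_bound_dx k ψ
  obtain ⟨K, hK, hKT, h⟩ := exists_compact_support ψ
  exact D.dom_of_continuous (continuous_dx k ψ) hC fun z hz => (h z fun h' => hz (hKT h')).2.2 k

variable {f g : ST → ℝ} {a c a' c' : ℕ}

instance Dom.mul [hf : D.Dom f a c] [hg : D.Dom g a' c'] : D.Dom (f * g) (a + a') (c + c') := by
  obtain ⟨C, hC⟩ := hf.bound
  obtain ⟨C', hC'⟩ := hg.bound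
  refine ⟨hf.aesm.mul hg.aesm, C * C', fun z => ?_⟩
  have h1 := mul_le_mul (hC z) (hC' z) (norm_nonneg _) ((norm_nonneg _).trans (hC z))
  rw [Pi.mul_apply, norm_mul]
  refine h1.trans (le_of_eq ?_)
  rw [mul_mul_mul_comm, ← norm_mul]
  congr 2
  simp only [monom]
  rw [mul_mul_mul_comm, slab_mul_self]
  ring

instance Dom.sub [hf : D.Dom f a c] [hg : D.Dom g a c] : D.Dom (f - g) a c := by
  obtain ⟨C, hC⟩ := hf.bound
  obtain ⟨C', hC'⟩ := hg.bound
  refine ⟨hf.aesm.sub hg.aesm, C + C', fun z => ?_⟩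
  rw [Pi.sub_apply, add_mul]
  exact (norm_sub_le _ _).trans (add_le_add (hC z) (hC' z))

instance Dom.add [hf : D.Dom f a c] [hg : D.Dom g a c] : D.Dom (f + g) a c := by
  obtain ⟨C, hC⟩ := hf.bound
  obtain ⟨C', hC'⟩ := hg.bound
  refine ⟨hf.aesm.add hg.aesm, C + C', fun z => ?_⟩
  rw [Pi.add_apply, add_mul]
  exact (norm_add_le _ _).trans (add_le_add (hC z) (hC' z))

instance Dom.smul (r : ℝ) [hf : D.Dom f a c] : D.Dom (r • f) a c := by
  obtain ⟨C, hC⟩ := hf.bound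
  refine ⟨hf.aesm.const_smul r, |r| * C, fun z => ?_⟩
  rw [Pi.smul_apply, smul_eq_mul, norm_mul, mul_assoc]
  exact mul_le_mul_of_nonneg_left (hC z) (abs_nonneg r)

/-- Not an instance: the degrees are output parameters and zero has every degree. -/
theorem Dom.zero (a c : ℕ) : D.Dom 0 a c := ⟨aestronglyMeasurable_zero, 0, fun z => by simp⟩

/-- Instance search computes the degrees in |b| and |j| of a product expression and `norm_num`
checks the totals, so a bare `D.pairable` certifies all integrability in the identities below. -/
theorem pairable [hf : D.Dom f a c] [hg : D.Dom g a' c'] (h : a + a' ≤ 2 := by norm_num)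
    (h' : c + c' ≤ 1 := by norm_num) : Pairable f g := by
  obtain ⟨C, hC⟩ := hf.bound
  obtain ⟨C', hC'⟩ := hg.bound
  exact (D.pair a c a' c' h h').mono hf.aesm hg.aesm hC hC'

theorem integrable [hf : D.Dom f a c] (h : a ≤ 2 := by norm_num) (h' : c ≤ 1 := by norm_num) :
    Integrable f := by
  obtain ⟨C, hC⟩ := hf.bound
  exact ((D.pair 0 0 a c (by omega) (by omega)).mono aestronglyMeasurable_zero hf.aesm (c := 1)
    (f' := 0) (by intro z; simp) hC).integrable

theorem pairable_one [hf : D.Dom f a c] (h : a ≤ 2 := by norm_num) (h' : c ≤ 1 := by norm_num) :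
    Pairable 1 f :=
  .of_bounded aestronglyMeasurable_const (D.integrable h h') (c := 1) (by simp)

end Config

/-! ### Approximate identities -/

theorem isKernel_rescale {φ : E3 → ℝ} (hφ : IsKernel φ) {ε : ℝ} (hε : 0 < ε) :
    IsKernel (rescale φ ε) := by
  constructor
  · exact contDiff_const.mul (hφ.smooth.comp (contDiff_const_smul _))
  · exact (hφ.compact.comp_smul (inv_ne_zero hε.ne')).mul_left

theorem IsMollifier.isKernel {φ : E3 → ℝ} (hφ : IsMollifier φ) : IsKernel φ :=
  ⟨hφ.smooth, hφ.compact⟩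

theorem integral_rescale_mul (φ H : E3 → ℝ) {ε : ℝ} (hε : 0 < ε) :
    ∫ l, rescale φ ε l * H l = ∫ l, φ l * H (ε • l) := by
  have h1 := Measure.integral_comp_inv_smul_of_nonneg (μ := (volume : Measure E3))
    (fun l => φ l * H (ε • l)) hε.le
  have h2 : Module.finrank ℝ E3 = 3 := by simp
  simp only [smul_inv_smul₀ hε.ne', h2, smul_eq_mul] at h1
  simp only [rescale, mul_assoc, integral_const_mul]
  rw [h1]
  field_simp

theorem tendsto_integral_rescale_mul {φ H : E3 → ℝ} (hφ : Continuous φ) (hc : HasCompactSupport φ)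
    (hH : Continuous H) :
    Tendsto (fun ε => ∫ l, rescale φ ε l * H l) (𝓝[>] 0) (𝓝 ((∫ l, φ l) * H 0)) := by
  have h1 : Tendsto (fun ε : ℝ => ∫ l, φ l * H (ε • l)) (𝓝 0) (𝓝 ((∫ l, φ l) * H 0)) := by
    have h2 : Continuous fun ε : ℝ => ∫ l in tsupport φ, φ l * H (ε • l) :=
      continuous_parametric_integral_of_continuous (f := fun (ε : ℝ) l => φ l * H (ε • l))
        (by fun_prop) hc.isCompact
    have h3 : ∀ ε : ℝ, ∫ l in tsupport φ, φ l * H (ε • l) = ∫ l, φ l * H (ε • l) := fun ε =>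
      setIntegral_eq_integral_of_forall_compl_eq_zero fun l hl => by
        simp [image_eq_zero_of_notMem_tsupport hl]
    simp only [h3] at h2
    have h4 := h2.tendsto 0
    simpa only [zero_smul, integral_mul_const] using h4
  refine (h1.mono_left nhdsWithin_le_nhds).congr' ?_
  filter_upwards [self_mem_nhdsWithin] with ε hε
  exact (integral_rescale_mul φ H hε).symm

theorem exists_isMollifier : ∃ φ : E3 → ℝ, IsMollifier φ := by
  let b : ContDiffBump (0 : E3) := ⟨1, 2, one_pos, one_lt_two⟩
  exact ⟨b.normed volume, b.contDiff_normed, b.hasCompactSupport_normed, b.nonneg_normed,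
    b.integral_normed⟩

/-- The functional `L` on kernels is integration against the continuous function `H`. -/
structure Rep (L : (E3 → ℝ) → ℝ) (H : ST → ℝ) : Prop where
  continuous : Continuous H
  eq : ∀ φ, IsKernel φ → L φ = ∫ l, φ l * H (sp l)

namespace Rep

variable {L L' : (E3 → ℝ) → ℝ} {H H' : ST → ℝ}

theorem of_pairable {f g : ST → ℝ} (P : Pairable f g) :
    Rep (fun φ => pairing φ f g) (corr f g) := ⟨P.continuous_corr, fun _ _ => rfl⟩

theorem integrable (h : Rep L H) {φ : E3 → ℝ} (hφ : IsKernel φ) :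
    Integrable fun l => φ l * H (sp l) :=
  (hφ.smooth.continuous.mul (h.continuous.comp continuous_sp)).integrable_of_hasCompactSupport
    hφ.compact.mul_right

theorem add (h : Rep L H) (h' : Rep L' H') : Rep (fun φ => L φ + L' φ) (fun z => H z + H' z) :=
  ⟨h.continuous.add h'.continuous, fun φ hφ => by
    simp only [mul_add]
    rw [integral_add (h.integrable hφ) (h'.integrable hφ), h.eq φ hφ, h'.eq φ hφ]⟩

theorem sub (h : Rep L H) (h' : Rep L' H') : Rep (fun φ => L φ - L' φ) (fun z => H z - H' z) :=
  ⟨h.continuous.sub h'.continuous, fun φ hφ => by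
    simp only [mul_sub]
    rw [integral_sub (h.integrable hφ) (h'.integrable hφ), h.eq φ hφ, h'.eq φ hφ]⟩

theorem const_mul (c : ℝ) (h : Rep L H) : Rep (fun φ => c * L φ) (fun z => c * H z) :=
  ⟨continuous_const.mul h.continuous, fun φ hφ => by
    simp only [mul_left_comm _ c, integral_const_mul]
    rw [h.eq φ hφ]⟩

theorem neg (h : Rep L H) : Rep (fun φ => -L φ) (fun z => -H z) :=
  ⟨h.continuous.neg, fun φ hφ => by
    simp only [mul_neg, integral_neg]
    rw [h.eq φ hφ]⟩

theorem sum {ι : Type*} (s : Finset ι) {L : ι → (E3 → ℝ) → ℝ} {H : ι → ST → ℝ}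
    (h : ∀ i, Rep (L i) (H i)) : Rep (fun φ => ∑ i ∈ s, L i φ) (fun z => ∑ i ∈ s, H i z) :=
  ⟨continuous_finsetSum _ fun i _ => (h i).continuous, fun φ hφ => by
    simp only [Finset.mul_sum]
    rw [integral_finsetSum _ fun i _ => (h i).integrable hφ]
    exact Finset.sum_congr rfl fun i _ => (h i).eq φ hφ⟩

theorem congr (h : Rep L H) (h' : ∀ φ, IsKernel φ → L' φ = L φ) : Rep L' H :=
  ⟨h.continuous, fun φ hφ => (h' φ hφ).trans (h.eq φ hφ)⟩

theorem tendsto (h : Rep L H) {φ : E3 → ℝ} (hφ : IsKernel φ) :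
    Tendsto (fun ε => L (rescale φ ε)) (𝓝[>] 0) (𝓝 ((∫ l, φ l) * H 0)) := by
  have h1 := tendsto_integral_rescale_mul hφ.smooth.continuous hφ.compact
    (h.continuous.comp continuous_sp)
  simp only [Function.comp, sp_zero] at h1
  refine h1.congr' ?_
  filter_upwards [self_mem_nhdsWithin] with ε hε
  exact (h.eq _ (isKernel_rescale hφ hε)).symm

/-- An identity between functionals of kernels becomes, along a shrinking mollifier, an identity at
coinciding points. -/
theorem unique (h : Rep L H) (h' : Rep L' H') (hL : ∀ φ, IsKernel φ → L φ = L' φ) :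
    H 0 = H' 0 := by
  obtain ⟨φ, hφ⟩ := exists_isMollifier
  have h1 := h.tendsto hφ.isKernel
  have h2 := (h'.congr hL).tendsto hφ.isKernel
  simpa [hφ.integral_eq_one] using tendsto_nhds_unique h1 h2

end Rep

theorem corr_apply_zero (f g : ST → ℝ) : corr f g 0 = ∫ z, f z * g z := by simp [corr]

theorem weakDiv_of_corr {T : ℝ} {f : Fin 3 → ST → ℝ} {F : ST → ℝ}
    (P : ∀ (ψ : testSpace T ℝ) k, Pairable (f k) (dx k ψ))
    (h : ∀ ψ : testSpace T ℝ, ∑ k, corr (f k) (dx k ψ) 0 = -corr F (tf ψ) 0) :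
    WeakDiv T 0 f F := by
  intro ψ
  have h1 := h ψ
  simp only [corr_apply_zero] at h1
  rw [← h1]
  simp only [Pi.zero_apply, zero_mul, zero_add]
  exact integral_finsetSum _ fun k _ => by simpa using (P ψ k).integrable_mul 0

/-- `g` vanishes outside a compact subset of the open time interval `(0,T)`. -/
def TimeSupported (T : ℝ) (g : ST → ℝ) : Prop :=
  ∃ K : Set ℝ, IsCompact K ∧ K ⊆ Ioo 0 T ∧ ∀ z : ST, z.1 ∉ K → g z = 0

theorem timeSupported_tf_mul {T : ℝ} (ψ : testSpace T ℝ) (g : ST → ℝ) :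
    TimeSupported T (tf ψ * g) := by
  obtain ⟨K, hK, hKT, h⟩ := exists_compact_support ψ
  exact ⟨K, hK, hKT, fun z hz => by simp [(h z hz).1]⟩

/-! ### Lorentz force, magnetic energy and Maxwell stress -/

namespace Config

variable {T : ℝ} (D : Config T)

section Linear

variable {φ : E3 → ℝ} {f f' g g' : ST → ℝ} {a c a' c' : ℕ}

theorem pairing_sub_left (hφ : IsKernel φ) [D.Dom f a c] [D.Dom f' a c] [D.Dom g a' c']
    (h : a + a' ≤ 2) (h' : c + c' ≤ 1) :
    pairing φ (f - f') g = pairing φ f g - pairing φ f' g :=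
  hφ.pairing_sub_left (D.pairable h h') (D.pairable h h')

theorem pairing_sub_right (hφ : IsKernel φ) [D.Dom f a c] [D.Dom g a' c'] [D.Dom g' a' c']
    (h : a + a' ≤ 2) (h' : c + c' ≤ 1) :
    pairing φ f (g - g') = pairing φ f g - pairing φ f g' :=
  hφ.pairing_sub_right (D.pairable h h') (D.pairable h h')

theorem corr_add_left [D.Dom f a c] [D.Dom f' a c] [D.Dom g a' c'] (z : ST)
    (h : a + a' ≤ 2) (h' : c + c' ≤ 1) : corr (f + f') g z = corr f g z + corr f' g z :=
  EMHD.corr_add_left (D.pairable h h') (D.pairable h h') z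

theorem corr_sub_left [D.Dom f a c] [D.Dom f' a c] [D.Dom g a' c'] (z : ST)
    (h : a + a' ≤ 2) (h' : c + c' ≤ 1) : corr (f - f') g z = corr f g z - corr f' g z :=
  EMHD.corr_sub_left (D.pairable h h') (D.pairable h h') z

end Linear

/-- A spatial conservation law applied to the translated factor. -/
theorem primed {f : Fin 3 → ST → ℝ} {F g : ST → ℝ} {φ : E3 → ℝ} (hW : WeakDiv T 0 f F)
    (hφ : IsKernel φ) (hg : TimeSupported T g) (Pf : ∀ k, Pairable (f k) g) (PF : Pairable F g) :
    ∑ k, pairing (pd k φ) (f k) g = -pairing φ F g := by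
  obtain ⟨K, hK, hKT, h⟩ := hg
  exact hW.primed Pf PF hK hKT h hφ.smooth hφ.compact

/-- The Lorentz force `j × b`. -/
def V : Fin 3 → ST → ℝ :=
  ![D.J 1 * D.B 2 - D.J 2 * D.B 1, D.J 2 * D.B 0 - D.J 0 * D.B 2, D.J 0 * D.B 1 - D.J 1 * D.B 0]

/-- The magnetic energy `|b|²`. -/
def E : ST → ℝ := D.B 0 * D.B 0 + D.B 1 * D.B 1 + D.B 2 * D.B 2

/-- The Maxwell stress tensor `b ⊗ b - ½|b|² I`. -/
def stress (i k : Fin 3) : ST → ℝ := D.B k * D.B i - (if k = i then (1 / 2 : ℝ) • D.E else 0)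

instance : D.Dom D.E 2 0 := inferInstanceAs (D.Dom (D.B 0 * D.B 0 + D.B 1 * D.B 1 + D.B 2 * D.B 2) _ _)

instance (i : Fin 3) : D.Dom (D.V i) 1 1 := by
  fin_cases i
  · exact inferInstanceAs (D.Dom (D.J 1 * D.B 2 - D.J 2 * D.B 1) _ _)
  · exact inferInstanceAs (D.Dom (D.J 2 * D.B 0 - D.J 0 * D.B 2) _ _)
  · exact inferInstanceAs (D.Dom (D.J 0 * D.B 1 - D.J 1 * D.B 0) _ _)

instance dom_stress (i k : Fin 3) : D.Dom (D.stress i k) 2 0 := by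
  have h1 : D.Dom (D.B k * D.B i) 2 0 := inferInstanceAs (D.Dom (D.B k * D.B i) (1 + 1) (0 + 0))
  unfold stress
  split_ifs
  · exact Dom.sub D (hf := h1) (hg := inferInstance)
  · exact Dom.sub D (hf := h1) (hg := Dom.zero D 2 0)

end Config

/-- `(i, k, l)` is a cyclic permutation of the coordinate indices. -/
def Cyc (i k l : Fin 3) : Prop := k = i + 1 ∧ l = i + 2

theorem exists_cyc (i : Fin 3) : ∃ k l, Cyc i k l := ⟨i + 1, i + 2, rfl, rfl⟩

namespace Cyc

variable {i k l : Fin 3}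

theorem rot (h : Cyc i k l) : Cyc k l i := by
  obtain ⟨rfl, rfl⟩ := h
  revert i
  unfold Cyc
  decide

theorem sum_eq (h : Cyc i k l) (f : Fin 3 → ℝ) : ∑ x, f x = f i + f k + f l := by
  obtain ⟨rfl, rfl⟩ := h
  fin_cases i <;> simp [Fin.sum_univ_three] <;> ring

theorem eq_or (h : Cyc i k l) (x : Fin 3) : x = i ∨ x = k ∨ x = l := by
  obtain ⟨rfl, rfl⟩ := h
  revert i x
  decide

theorem ne (h : Cyc i k l) : k ≠ i ∧ l ≠ i := by
  obtain ⟨rfl, rfl⟩ := h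
  revert i
  decide

end Cyc

theorem Rep.zero : Rep (fun _ => 0) (fun _ => 0) := ⟨continuous_const, fun φ _ => by simp⟩

theorem Pairable.neg_left {f g : ST → ℝ} (P : Pairable f g) : Pairable (-f) g :=
  P.mono (c := 1) (d := 1) P.aesm.neg P.integrable.1 (by simp) (by simp)

theorem Pairable.neg_right {f g : ST → ℝ} (P : Pairable f g) : Pairable f (-g) :=
  P.mono (c := 1) (d := 1) P.aesm P.integrable.1.neg (by simp) (by simp)

/-! ### Two-point forms of div b = 0, div j = 0 and curl b = j; the stress law -/

namespace Config

variable {T : ℝ} (D : Config T) {i k l : Fin 3}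

theorem V_eq (h : Cyc i k l) : D.V i = D.J k * D.B l - D.J l * D.B k := by
  obtain ⟨rfl, rfl⟩ := h
  fin_cases i <;> rfl

theorem E_eq (h : Cyc i k l) : D.E = D.B i * D.B i + D.B k * D.B k + D.B l * D.B l := by
  obtain ⟨rfl, rfl⟩ := h
  fin_cases i
  · rfl
  · ext z; simp [E]; ring
  · ext z; simp [E]; ring

/-- The rows of the antisymmetric matrix field whose divergence is the curl of `D.B`. -/
def curlRow (i : Fin 3) : Fin 3 → ST → ℝ :=
  ![![0, D.B 2, -D.B 1], ![-D.B 2, 0, D.B 0], ![D.B 1, -D.B 0, 0]] i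

theorem weakDiv_curlRow (i : Fin 3) : WeakDiv T 0 (D.curlRow i) (D.J i) := by
  fin_cases i
  · exact D.curl_zero
  · exact D.curl_one
  · exact D.curl_two

theorem curlRow_eq (h : Cyc i k l) :
    D.curlRow i i = 0 ∧ D.curlRow i k = D.B l ∧ D.curlRow i l = -D.B k := by
  obtain ⟨rfl, rfl⟩ := h
  fin_cases i <;> exact ⟨rfl, rfl, rfl⟩

variable {φ : E3 → ℝ} {g : ST → ℝ} {ψ : testSpace T ℝ}

theorem div_primed (hφ : IsKernel φ) (h : Cyc i k l) (hg : TimeSupported T g) (P : ∀ x, Pairable (D.B x) g) :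
    pairing (pd i φ) (D.B i) g + pairing (pd k φ) (D.B k) g
      + pairing (pd l φ) (D.B l) g = 0 := by
  have h1 := primed D.div_B hφ hg P (.zero_left (P 0).integrable)
  rwa [pairing_zero_left, neg_zero, h.sum_eq] at h1

theorem curl_primed (hφ : IsKernel φ) (h : Cyc i k l) (hg : TimeSupported T g) (P : ∀ x, Pairable (D.B x) g)
    (Q : Pairable (D.J i) g) :
    pairing (pd k φ) (D.B l) g - pairing (pd l φ) (D.B k) g
      = -pairing φ (D.J i) g := by
  obtain ⟨h0, h1, h2⟩ := D.curlRow_eq h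
  have P' : ∀ x, Pairable (D.curlRow i x) g := by
    intro x
    rcases h.eq_or x with rfl | rfl | rfl
    · rw [h0]; exact .zero_left Q.integrable
    · rw [h1]; exact P _
    · rw [h2]
      exact (P k).neg_left
  have h3 := primed (D.weakDiv_curlRow i) hφ hg P' Q
  rw [h.sum_eq, h0, h1, h2, pairing_zero_left, pairing_neg_left] at h3
  rw [← h3]; ring

theorem div_unprimed (hφ : IsKernel φ) (h : Cyc i k l) (hg : Integrable g)
    (P : ∀ x, Pairable g (tf ψ * D.B x)) (P' : ∀ x y, Pairable g (D.B x * dx y ψ)) :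
    pairing (pd i φ) g (tf ψ * D.B i) + pairing (pd k φ) g (tf ψ * D.B k)
      + pairing (pd l φ) g (tf ψ * D.B l) = pairing φ g (D.B i * dx i ψ)
      + pairing φ g (D.B k * dx k ψ) + pairing φ g (D.B l * dx l ψ) := by
  have h1 := D.div_B.unprimed hg ψ P (by rw [mul_zero]; exact .zero_right (P 0).aesm) (fun x => P' x x)
    hφ.smooth hφ.compact
  rwa [mul_zero, pairing_zero_right, zero_add, h.sum_eq, h.sum_eq] at h1

theorem divJ_unprimed (hφ : IsKernel φ) (h : Cyc i k l) (hg : Integrable g)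
    (P : ∀ x, Pairable g (tf ψ * D.J x)) (P' : ∀ x y, Pairable g (D.J x * dx y ψ)) :
    pairing (pd i φ) g (tf ψ * D.J i) + pairing (pd k φ) g (tf ψ * D.J k)
      + pairing (pd l φ) g (tf ψ * D.J l) = pairing φ g (D.J i * dx i ψ)
      + pairing φ g (D.J k * dx k ψ) + pairing φ g (D.J l * dx l ψ) := by
  have h1 := D.div_J.unprimed hg ψ P (by rw [mul_zero]; exact .zero_right (P 0).aesm) (fun x => P' x x)
    hφ.smooth hφ.compact
  rwa [mul_zero, pairing_zero_right, zero_add, h.sum_eq, h.sum_eq] at h1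

theorem divJ_primed (hφ : IsKernel φ) (h : Cyc i k l) (hg : TimeSupported T g) (P : ∀ x, Pairable (D.J x) g) :
    pairing (pd i φ) (D.J i) g + pairing (pd k φ) (D.J k) g
      + pairing (pd l φ) (D.J l) g = 0 := by
  have h1 := primed D.div_J hφ hg P (.zero_left (P 0).integrable)
  rwa [pairing_zero_left, neg_zero, h.sum_eq] at h1

theorem curl_unprimed (hφ : IsKernel φ) (h : Cyc i k l) (hg : Integrable g)
    (P : ∀ x, Pairable g (tf ψ * D.B x)) (P' : ∀ x y, Pairable g (D.B x * dx y ψ))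
    (Q : Pairable g (tf ψ * D.J i)) :
    pairing (pd k φ) g (tf ψ * D.B l) - pairing (pd l φ) g (tf ψ * D.B k)
      = pairing φ g (tf ψ * D.J i) + pairing φ g (D.B l * dx k ψ)
        - pairing φ g (D.B k * dx l ψ) := by
  obtain ⟨h0, h1, h2⟩ := D.curlRow_eq h
  have h3 := (D.weakDiv_curlRow i).unprimed hg ψ (fun x => ?_) Q (fun x => ?_) hφ.smooth hφ.compact
  · simp only [h.sum_eq, h0, h1, h2, pairing_zero_right, mul_neg, neg_mul, pairing_neg_right,
      mul_zero, zero_mul] at h3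
    rw [sub_eq_add_neg, ← zero_add (pairing (pd k φ) g (tf ψ * D.B l)), h3]; ring
  · rcases h.eq_or x with rfl | rfl | rfl
    · rw [h0, mul_zero]; exact .zero_right Q.aesm
    · rw [h1]; exact P _
    · rw [h2, mul_neg]; exact (P _).neg_right
  · rcases h.eq_or x with rfl | rfl | rfl
    · rw [h0, zero_mul]; exact .zero_right Q.aesm
    · rw [h1]; exact P' _ _
    · rw [h2, neg_mul]; exact (P' _ _).neg_right

theorem stress_eq_self (i : Fin 3) : D.stress i i = D.B i * D.B i - (1 / 2 : ℝ) • D.E := by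
  simp [stress]

theorem stress_eq_of_ne (h : k ≠ i) : D.stress i k = D.B k * D.B i := by
  simp [stress, h]

/-- The components of the magnetic field satisfy `∑ₖ ∂ₖ(bₖ bᵢ - ½|b|² δₖᵢ) = (j × b)ᵢ`. -/
theorem weakDiv_stress (i : Fin 3) : WeakDiv T 0 (D.stress i) (D.V i) := by
  refine weakDiv_of_corr (fun ψ k => D.pairable) fun ψ => ?_
  obtain ⟨k, l, h⟩ := exists_cyc i
  -- The product rule for b⊗b is not available for weak derivatives, so it is replaced by an
  -- identity at separated points, where each law acts on one factor only.
  have key : ∀ φ, IsKernel φ →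
      pairing φ (D.J l) (tf ψ * D.B k) - pairing φ (D.J k) (tf ψ * D.B l)
      + pairing φ (D.B k) (tf ψ * D.J l) + pairing φ (D.B k) (D.B k * dx i ψ)
      - pairing φ (D.B k) (D.B i * dx k ψ)
      - pairing φ (D.B l) (tf ψ * D.J k) - pairing φ (D.B l) (D.B i * dx l ψ)
      + pairing φ (D.B l) (D.B l * dx i ψ)
      - (pairing φ (D.B i) (D.B i * dx i ψ) + pairing φ (D.B i) (D.B k * dx k ψ)
        + pairing φ (D.B i) (D.B l * dx l ψ)) = 0 := by
    intro φ hφ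
    have e1 := D.div_unprimed (ψ := ψ) (g := D.B i) hφ h D.integrable (fun x => D.pairable)
      (fun x y => D.pairable)
    have e2 := D.div_primed (g := tf ψ * D.B i) hφ h (timeSupported_tf_mul ψ _) (fun x => D.pairable)
    have e3 := D.curl_primed (g := tf ψ * D.B k) hφ h.rot.rot (timeSupported_tf_mul ψ _) (fun x => D.pairable) D.pairable
    have e4 := D.curl_primed (g := tf ψ * D.B l) hφ h.rot (timeSupported_tf_mul ψ _) (fun x => D.pairable) D.pairable
    have e5 := D.curl_unprimed (ψ := ψ) (g := D.B k) hφ h.rot.rot D.integrable (fun x => D.pairable)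
      (fun x y => D.pairable) D.pairable
    have e6 := D.curl_unprimed (ψ := ψ) (g := D.B l) hφ h.rot D.integrable (fun x => D.pairable)
      (fun x y => D.pairable) D.pairable
    -- `e1` and `e2` use div b = 0 on the fixed and on the translated factor, the other four use
    -- curl b = j in the two directions transverse to `i`; every term with a differentiated kernel
    -- cancels.
    linear_combination e1 - e2 + e3 - e4 - e5 + e6
  have R := @Rep.of_pairable
  have RR := ((((((((R (D.pairable (f := D.J l) (g := tf ψ * D.B k))).sub
    (R (D.pairable (f := D.J k) (g := tf ψ * D.B l)))).add
    (R (D.pairable (f := D.B k) (g := tf ψ * D.J l)))).add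
    (R (D.pairable (f := D.B k) (g := D.B k * dx i ψ)))).sub
    (R (D.pairable (f := D.B k) (g := D.B i * dx k ψ)))).sub
    (R (D.pairable (f := D.B l) (g := tf ψ * D.J k)))).sub
    (R (D.pairable (f := D.B l) (g := D.B i * dx l ψ)))).add
    (R (D.pairable (f := D.B l) (g := D.B l * dx i ψ)))).sub
    (((R (D.pairable (f := D.B i) (g := D.B i * dx i ψ))).add
    (R (D.pairable (f := D.B i) (g := D.B k * dx k ψ)))).add
    (R (D.pairable (f := D.B i) (g := D.B l * dx l ψ))))
  have key0 := RR.unique Rep.zero key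
  rw [h.sum_eq, stress_eq_self, stress_eq_of_ne D h.ne.1, stress_eq_of_ne D h.ne.2, D.E_eq h,
    D.V_eq h, D.corr_sub_left _ (by norm_num) (by norm_num), D.corr_sub_left _ (by norm_num) (by norm_num),
    corr_smul_left, D.corr_add_left _ (by norm_num) (by norm_num),
    D.corr_add_left _ (by norm_num) (by norm_num)]
  simp only [corr_apply_zero, Pi.mul_apply, mul_comm, mul_left_comm, mul_assoc] at key0 ⊢
  -- At displacement zero the force terms and the mixed products occur twice, once from each factor,
  -- while the squares times ∂ᵢψ occur once. Halving yields the coefficient ½ of |b|² in the stress.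
  linear_combination (-1 / 2) * key0

end Config

/-! ### Radial kernels -/

theorem fderiv_comp_normSq {F : ℝ → ℝ} (hF : Differentiable ℝ F) (l v : E3) :
    fderiv ℝ (fun y : E3 => F (‖y‖ ^ 2)) l v = 2 * deriv F (‖l‖ ^ 2) * ⟪l, v⟫ := by
  have h1 := (hF (‖l‖ ^ 2)).hasDerivAt.comp_hasFDerivAt l (hasStrictFDerivAt_norm_sq l).hasFDerivAt
  have h2 := h1.fderiv
  rw [show (F ∘ fun y : E3 => ‖y‖ ^ 2) = fun y => F (‖y‖ ^ 2) from rfl] at h2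
  rw [h2]
  simp
  ring

theorem inner_basisVec (l : E3) (k : Fin 3) : ⟪l, basisVec k⟫ = l k := by
  simp [basisVec, EuclideanSpace.inner_single_right]

/-- There is a nontrivial bump `φ` such that `ℓ ↦ ℓ φ(ℓ)` is the gradient of a bump. -/
theorem exists_radial_kernels : ∃ φ Θ : E3 → ℝ, IsKernel φ ∧ IsKernel Θ ∧
    (∀ l, 1 / 4 < ‖l‖ → φ l = 0) ∧ (∀ l, 1 / 4 < ‖l‖ → Θ l = 0) ∧
    (∀ k l, pd k Θ l = -(l k * φ l)) ∧ 0 < ∫ l, φ l := by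
  -- The variable is |ℓ|², so the outer radius 1/16 confines the kernels to |ℓ| ≤ 1/4, inside a
  -- single period cell.
  let b : ContDiffBump (0 : ℝ) := ⟨1 / 32, 1 / 16, by norm_num, by norm_num⟩
  have hb0 : ∀ s : ℝ, 1 / 16 ≤ s → b s = 0 := fun s hs => by
    refine b.zero_of_le_dist ?_
    rw [Real.dist_eq, sub_zero]
    exact hs.trans (le_abs_self s)
  -- The gradient of F(|ℓ|²) is 2F'(|ℓ|²)ℓ, hence the ½; the upper endpoint makes `F` vanish outside
  -- the support of the bump.
  let F : ℝ → ℝ := fun s => (1 / 2) * ∫ u in s..(1 / 16), b u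
  have hF : ∀ s, HasDerivAt F (-(1 / 2) * b s) s := fun s => by
    have h1 := (intervalIntegral.integral_hasDerivAt_left
      (b.continuous.intervalIntegrable s (1 / 16)) (b.continuous.stronglyMeasurableAtFilter _ _)
      b.continuous.continuousAt).const_mul (1 / 2 : ℝ)
    exact h1.congr_deriv (by ring)
  have hF0 : ∀ s : ℝ, 1 / 16 ≤ s → F s = 0 := fun s hs => by
    simp only [F]
    rw [intervalIntegral.integral_symm, intervalIntegral.integral_of_le hs,
      setIntegral_eq_zero_of_forall_eq_zero fun u hu => hb0 u hu.1.le]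
    simp
  have hFd : deriv F = fun s => -(1 / 2) * b s := funext fun s => (hF s).deriv
  have hFs : ContDiff ℝ ∞ F := by
    rw [contDiff_infty_iff_deriv]
    refine ⟨fun s => (hF s).differentiableAt, ?_⟩
    rw [hFd]
    exact contDiff_const.mul b.contDiff
  have hsq : ∀ l : E3, 1 / 4 < ‖l‖ → 1 / 16 ≤ ‖l‖ ^ 2 := fun l hl => by nlinarith
  have hcs : ∀ G : ℝ → ℝ, (∀ s : ℝ, 1 / 16 ≤ s → G s = 0) →
      HasCompactSupport fun l : E3 => G (‖l‖ ^ 2) := fun G hG =>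
    HasCompactSupport.intro (isCompact_closedBall (0 : E3) (1 / 4)) fun l hl => hG _ (hsq l (by
      simpa using hl))
  refine ⟨fun l => b (‖l‖ ^ 2), fun l => F (‖l‖ ^ 2),
    ⟨b.contDiff.comp (contDiff_norm_sq ℝ), hcs _ hb0⟩, ⟨hFs.comp (contDiff_norm_sq ℝ), hcs _ hF0⟩,
    fun l hl => hb0 _ (hsq l hl), fun l hl => hF0 _ (hsq l hl), fun k l => ?_, ?_⟩
  · rw [pd, fderiv_comp_normSq (fun s => (hF s).differentiableAt), hFd, inner_basisVec]
    ring
  · have hc : Continuous fun l : E3 => b (‖l‖ ^ 2) := b.continuous.comp (by fun_prop)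
    refine hc.integral_pos_of_hasCompactSupport_nonneg_nonzero (hcs _ hb0) (fun l => b.nonneg)
      (x := 0) ?_
    simp only [norm_zero]
    rw [b.one_of_mem_closedBall (by simp; norm_num)]
    exact one_ne_zero

theorem fderiv_rescale {φ : E3 → ℝ} (hφ : IsKernel φ) (r : ℝ) (l v : E3) :
    fderiv ℝ (rescale φ r) l v = (r ^ 3)⁻¹ * r⁻¹ * fderiv ℝ φ (r⁻¹ • l) v := by
  have h1 : HasFDerivAt (fun l : E3 => φ (r⁻¹ • l)) _ l :=
    (hφ.smooth.differentiable (by simp) (r⁻¹ • l)).hasFDerivAt.comp l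
      ((hasFDerivAt_id l).const_smul r⁻¹)
  have h2 := (h1.const_mul ((r ^ 3)⁻¹)).fderiv
  rw [show rescale φ r = fun l => (r ^ 3)⁻¹ * φ (r⁻¹ • l) from rfl, h2]
  simp
  ring

theorem pd_rescale {φ : E3 → ℝ} (hφ : IsKernel φ) (k : Fin 3) (r : ℝ) :
    pd k (rescale φ r) = fun l => r⁻¹ * rescale (pd k φ) r l := by
  ext l
  rw [pd, fderiv_rescale hφ, rescale, pd]
  ring

theorem pd_const_mul {φ : E3 → ℝ} (hφ : IsKernel φ) (k : Fin 3) (c : ℝ) :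
    pd k (fun l => c * φ l) = fun l => c * pd k φ l := by
  ext l
  rw [pd, fderiv_const_mul (hφ.smooth.differentiable (by simp) l)]
  rfl

theorem pd_comm {φ : E3 → ℝ} (hφ : IsKernel φ) (i k : Fin 3) : pd i (pd k φ) = pd k (pd i φ) := by
  have h1 : ∀ (i k : Fin 3) (l : E3), pd i (pd k φ) l
      = fderiv ℝ (fderiv ℝ φ) l (basisVec i) (basisVec k) := fun i k l => by
    have h2 : DifferentiableAt ℝ (fderiv ℝ φ) l :=
      (hφ.smooth.fderiv_right (m := ∞) (by simp)).differentiable (by simp) l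
    unfold pd
    rw [fderiv_clm_apply h2 (differentiableAt_const _)]
    simp
  ext l
  rw [h1, h1]
  exact (hφ.smooth.contDiffAt.isSymmSndFDerivAt (by simp; exact WithTop.coe_le_coe.2 (le_top : (2 : ℕ∞) ≤ ⊤))) _ _

/-- By scaling, ∂φ_r/∂r = −r⁻¹ div(ℓφ_r), and the hypothesis gives ℓφ_r = −r²∇Θ_r. The change of
scale of a mollification is thus a Laplacian, to which Δb = −curl j can be applied. -/
theorem hasDerivAt_rescale {φ Θ : E3 → ℝ} (hφ : IsKernel φ) (hΘ : IsKernel Θ)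
    (h : ∀ k l, pd k Θ l = -(l k * φ l)) {r : ℝ} (hr : 0 < r) (l : E3) :
    HasDerivAt (fun r => rescale φ r l) (r * ∑ k, pd k (pd k (rescale Θ r)) l) r := by
  have h1 : HasDerivAt (fun r : ℝ => r⁻¹ • l) ((-(r ^ 2)⁻¹) • l) r :=
    (hasDerivAt_inv hr.ne').smul_const l
  have h2 := (hφ.smooth.differentiable (by simp) (r⁻¹ • l)).hasFDerivAt.comp_hasDerivAt r h1
  have h3 := ((hasDerivAt_pow 3 r).inv (pow_ne_zero 3 hr.ne')).mul h2
  have h4 : ∀ k, pd k (pd k (rescale Θ r)) l = -((r ^ 5)⁻¹ * φ (r⁻¹ • l)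
      + (r ^ 5)⁻¹ * (r⁻¹ * l k) * pd k φ (r⁻¹ • l)) := fun k => by
    have e1 : pd k (rescale Θ r) = fun y => -((r⁻¹ ^ 5) * (y k * φ (r⁻¹ • y))) := by
      rw [pd_rescale hΘ]
      ext y
      simp only [rescale, h, PiLp.smul_apply, smul_eq_mul]
      field_simp
    rw [e1, pd]
    have e2 : HasFDerivAt (fun y : E3 => φ (r⁻¹ • y)) _ l :=
      (hφ.smooth.differentiable (by simp) (r⁻¹ • l)).hasFDerivAt.comp l
        ((hasFDerivAt_id l).const_smul r⁻¹)
    have e3 : HasFDerivAt (fun y : E3 => y k) (EuclideanSpace.proj k : E3 →L[ℝ] ℝ) l :=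
      (EuclideanSpace.proj k : E3 →L[ℝ] ℝ).hasFDerivAt
    have e4 := (((e3.mul e2).const_mul (r⁻¹ ^ 5)).neg).fderiv
    rw [show (-fun y : E3 => r⁻¹ ^ 5 * ((fun y : E3 => y k) * fun y => φ (r⁻¹ • y)) y)
      = fun y => -(r⁻¹ ^ 5 * (y k * φ (r⁻¹ • y))) from rfl] at e4
    rw [e4]
    simp [pd, basisVec]
    ring
  have h5 : fderiv ℝ φ (r⁻¹ • l) l = ∑ k, l k * pd k φ (r⁻¹ • l) := by
    have e1 : l = ∑ k, l k • basisVec k := by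
      ext i
      simp [basisVec, Fin.sum_univ_three]
      fin_cases i <;> simp
    calc _ = fderiv ℝ φ (r⁻¹ • l) (∑ k, l k • basisVec k) := by rw [← e1]
      _ = _ := by simp [pd]
  refine (h3.congr_deriv ?_ : HasDerivAt _ _ r)
  simp only [h4, map_smul, smul_eq_mul, h5, Fin.sum_univ_three, Function.comp, Pi.inv_apply]
  field_simp
  ring

namespace Config

variable {T : ℝ} (D : Config T) {i k l : Fin 3} {g : ST → ℝ}

/-- The identity `Δb = -curl j`, tested against a kernel. -/
theorem laplacian_primed {Θ : E3 → ℝ} (hΘ : IsKernel Θ) (h : Cyc i k l) (hg : TimeSupported T g)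
    (P : ∀ x, Pairable (D.B x) g) (Q : ∀ x, Pairable (D.J x) g) :
    ∑ x, pairing (pd x (pd x Θ)) (D.B i) g
      = pairing (pd k Θ) (D.J l) g - pairing (pd l Θ) (D.J k) g := by
  have e1 := D.curl_primed (hΘ.pd k) h.rot.rot hg P (Q l)
  have e2 := D.curl_primed (hΘ.pd l) h.rot hg P (Q k)
  have e3 := D.div_primed (hΘ.pd i) h hg P
  rw [pd_comm hΘ i k] at e1
  rw [pd_comm hΘ i l] at e2
  rw [h.sum_eq]
  linear_combination -e1 + e2 + e3
end Config

theorem abs_pairing_le {φ : E3 → ℝ} {f g : ST → ℝ} (hφ : IsKernel φ) {M : ℝ}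
    (hM : ∀ h, |corr f g h| ≤ M) : |pairing φ f g| ≤ (∫ l, |φ l|) * M := by
  rw [← integral_mul_const]
  refine (abs_integral_le_integral_abs).trans (integral_mono_of_nonneg
    (Eventually.of_forall fun _ => abs_nonneg _) ?_ (Eventually.of_forall fun l => ?_))
  · exact ((hφ.smooth.continuous.integrable_of_hasCompactSupport hφ.compact).abs).mul_const M
  · simp only [abs_mul]
    exact mul_le_mul_of_nonneg_left (hM _) (abs_nonneg _)

theorem integral_abs_rescale (φ : E3 → ℝ) {r : ℝ} (hr : 0 < r) :
    ∫ l, |rescale φ r l| = ∫ l, |φ l| := by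
  have h1 := integral_rescale_mul (fun l => |φ l|) 1 hr
  simp only [Pi.one_apply, mul_one] at h1
  rw [← h1]
  congr 1
  ext l
  rw [rescale, rescale, abs_mul, abs_of_pos (by positivity)]

/-- Differentiation under the integral sign: for scales in (r/2, 3r/2) the derivatives of the
kernels share a compact support and a bound. -/
theorem Rep.hasDerivAt_rescale {L : (E3 → ℝ) → ℝ} {H : ST → ℝ} (hL : Rep L H) {φ Θ : E3 → ℝ}
    (hφ : IsKernel φ) (hΘ : IsKernel Θ) (h : ∀ k l, pd k Θ l = -(l k * φ l)) {r : ℝ} (hr : 0 < r) :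
    HasDerivAt (fun r => L (rescale φ r)) (r * ∑ k, L (pd k (pd k (rescale Θ r)))) r := by
  set Λ : E3 → ℝ := fun l => ∑ k, pd k (pd k Θ) l with hΛ
  have hk : ∀ k, IsKernel (pd k (pd k Θ)) := fun k => (hΘ.pd k).pd k
  have hΛc : Continuous Λ := continuous_finsetSum _ fun k _ => (hk k).smooth.continuous
  have hHc : Continuous fun l => H (sp l) := hL.continuous.comp continuous_sp
  obtain ⟨M, hM⟩ : ∃ M, ∀ l, ‖Λ l‖ ≤ M := by
    choose M hM using fun k => (hk k).smooth.continuous.bounded_above_of_compact_support (hk k).compact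
    exact ⟨∑ k, M k, fun l => norm_sum_le_of_le _ fun k _ => hM k l⟩
  obtain ⟨R, hR0, hR⟩ : ∃ R : ℝ, 0 < R ∧ ∀ l, R < ‖l‖ → Λ l = 0 := by
    choose R hR using fun k => (hk k).compact.isCompact.isBounded.subset_closedBall (0 : E3)
    refine ⟨1 + ∑ k, |R k|, by positivity, fun l hl => Finset.sum_eq_zero fun k _ => ?_⟩
    refine image_eq_zero_of_notMem_tsupport fun hk' => ?_
    have h1 := mem_closedBall_zero_iff.1 (hR k hk')
    have h2 := Finset.single_le_sum (f := fun k => |R k|) (fun _ _ => abs_nonneg _) (Finset.mem_univ k)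
    have h3 := le_abs_self (R k)
    linarith
  have hpp : ∀ s k, pd k (pd k (rescale Θ s)) = fun l => s⁻¹ * (s⁻¹ * rescale (pd k (pd k Θ)) s l) := by
    intro s k
    -- At scale zero both sides vanish, because `rescale` involves the inverse of zero, which is
    -- zero.
    by_cases hs : s = 0
    · subst hs
      have h0 : rescale Θ 0 = fun _ => 0 := by ext; simp [rescale]
      have h1 : pd k (fun _ : E3 => (0 : ℝ)) = fun _ => 0 := by ext l; simp [pd]
      rw [h0, h1, h1]
      simp
    have hr' : IsKernel (rescale (pd k Θ) s) := ⟨contDiff_const.mul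
      ((hΘ.pd k).smooth.comp (contDiff_const_smul _)),
      ((hΘ.pd k).compact.comp_smul (inv_ne_zero hs)).mul_left⟩
    rw [pd_rescale hΘ, pd_const_mul hr', pd_rescale (hΘ.pd k)]
  have hΔ : ∀ s l, s * ∑ k, pd k (pd k (rescale Θ s)) l
      = s * (s⁻¹ * (s⁻¹ * ((s ^ 3)⁻¹ * Λ (s⁻¹ • l)))) := fun s l => by
    simp only [hpp, rescale, hΛ, Finset.mul_sum]
  have h1 := hasDerivAt_integral_of_dominated_loc_of_deriv_le (μ := (volume : Measure E3)) (𝕜 := ℝ)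
    (F := fun r l => rescale φ r l * H (sp l)) (x₀ := r) (s := Metric.ball r (r / 2))
    (F' := fun s l => (s * ∑ k, pd k (pd k (rescale Θ s)) l) * H (sp l))
    -- The derivative is s⁻⁴ Λ(l/s) with r/2 < s < 2r: it is supported in |l| ≤ 2rR and bounded by
    -- (r/2)⁻⁴ M.
    (bound := (Metric.closedBall (0 : E3) (R * (2 * r))).indicator fun l =>
      ((r / 2)⁻¹ ^ 4 * M) * ‖H (sp l)‖)
    (Metric.ball_mem_nhds r (by positivity)) ?_ ?_ ?_ ?_ ?_ ?_
  · have h2 := h1.2.congr_of_eventuallyEq (f₁ := fun r => L (rescale φ r)) (by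
      filter_upwards [eventually_gt_nhds hr] with s hs
      exact hL.eq _ (isKernel_rescale hφ hs))
    refine h2.congr_deriv ?_
    simp only [mul_assoc, integral_const_mul, Finset.sum_mul]
    rw [integral_finsetSum _ fun k _ => hL.integrable (((isKernel_rescale hΘ hr).pd k).pd k)]
    congr 1
    exact Finset.sum_congr rfl fun k _ => (hL.eq _ (((isKernel_rescale hΘ hr).pd k).pd k)).symm
  · filter_upwards [eventually_gt_nhds hr] with s hs
    exact (hL.integrable (isKernel_rescale hφ hs)).1
  · exact hL.integrable (isKernel_rescale hφ hr)
  · simp only [hΔ]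
    have h2 : Continuous fun l : E3 => Λ (r⁻¹ • l) := hΛc.comp (continuous_const_smul _)
    exact (Continuous.mul (by fun_prop) hHc).aestronglyMeasurable
  · refine Eventually.of_forall fun l s hs => ?_
    have hs' : r / 2 < s ∧ s < 2 * r := by
      rw [Metric.mem_ball, Real.dist_eq, abs_lt] at hs
      constructor <;> linarith
    have hs0 : 0 < s := by linarith
    simp only [hΔ]
    by_cases hl : l ∈ Metric.closedBall (0 : E3) (R * (2 * r))
    · rw [indicator_of_mem hl, norm_mul]
      gcongr
      have e1 : s * (s⁻¹ * (s⁻¹ * ((s ^ 3)⁻¹ * Λ (s⁻¹ • l)))) = s⁻¹ ^ 4 * Λ (s⁻¹ • l) := by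
        field_simp
      rw [e1, norm_mul, norm_pow, norm_inv, Real.norm_of_nonneg hs0.le]
      have e2 : s⁻¹ ≤ (r / 2)⁻¹ := inv_anti₀ (by positivity) hs'.1.le
      gcongr
      exact hM _
    · rw [indicator_of_notMem hl, hR (s⁻¹ • l)]
      · simp
      · rw [mem_closedBall_zero_iff, not_le] at hl
        rw [norm_smul, norm_inv, Real.norm_of_nonneg hs0.le, ← div_eq_inv_mul, lt_div_iff₀ hs0]
        exact lt_of_le_of_lt (mul_le_mul_of_nonneg_left hs'.2.le hR0.le) hl
  · refine IntegrableOn.integrable_indicator ?_ Metric.isClosed_closedBall.measurableSet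
    exact (continuous_const.mul hHc.norm).continuousOn.integrableOn_compact (isCompact_closedBall _ _)
  · refine Eventually.of_forall fun l s hs => ?_
    have hs0 : 0 < s := by
      rw [Metric.mem_ball, Real.dist_eq, abs_lt] at hs
      linarith
    exact (EMHD.hasDerivAt_rescale hφ hΘ h hs0 l).mul_const _

/-! ### A priori bound for the third moment of b -/

namespace Config

variable {T : ℝ} (D : Config T)

theorem β_aesm : AEStronglyMeasurable D.β volume := by
  have h1 : D.β = fun z => √(∑ i, D.B i z ^ 2) := by
    ext z
    rw [← D.β_eq, Real.sqrt_sq (D.β_nonneg z)]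
  rw [h1]
  refine Real.continuous_sqrt.comp_aestronglyMeasurable ?_
  exact Finset.aestronglyMeasurable_fun_sum _ fun i _ => (D.B_aesm i).pow 2

/-- The truncation set used to bound the third moment. -/
def lowSet (N : ℝ) (K : Set ℝ) : Set ST := {z | D.β z ≤ N ∧ z.1 ∈ K}

/-- A truncation of |b|b, chosen because its product with b is |b|³. It is bounded by N² and
supported in the times `K`, so the laws may be tested with it, yet dominated by |b|² independently
of the truncation. -/
def lowField (N : ℝ) (K : Set ℝ) (i : Fin 3) : ST → ℝ :=
  (D.lowSet N K).indicator fun z => D.β z * D.B i z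

theorem abs_lowField_le (N : ℝ) (K : Set ℝ) (i : Fin 3) (z : ST) :
    ‖D.lowField N K i z‖ ≤ D.β z ^ 2 := by
  unfold lowField
  refine (norm_indicator_le_norm_self _ _).trans ?_
  rw [norm_mul, sq, Real.norm_of_nonneg (D.β_nonneg z)]
  exact mul_le_mul_of_nonneg_left (D.norm_B_le i z) (D.β_nonneg z)

theorem lowField_aesm (N : ℝ) {K : Set ℝ} (hK : IsCompact K) (i : Fin 3) :
    AEStronglyMeasurable (D.lowField N K i) volume := by
  refine (D.β_aesm.mul (D.B_aesm i)).indicator₀ ?_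
  have h1 : NullMeasurableSet {z : ST | D.β z ≤ N} volume :=
    nullMeasurableSet_le D.β_aesm.aemeasurable aemeasurable_const
  exact h1.inter (hK.measurableSet.preimage measurable_fst).nullMeasurableSet

theorem abs_lowField_le_monom (N : ℝ) (K : Set ℝ) (i : Fin 3) (z : ST) :
    ‖D.lowField N K i z‖ ≤ 1 * ‖monom T D.β D.ι 2 0 z‖ := by
  refine (D.abs_lowField_le N K i z).trans ?_
  by_cases h : z.1 ∈ Ioo 0 T
  · simp [monom, slab_of_mem h]
  · simp [monom, slab_of_notMem h, D.β_supp z h]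

theorem abs_J_le_monom (i : Fin 3) (z : ST) : ‖D.J i z‖ ≤ 1 * ‖monom T D.β D.ι 0 1 z‖ := by
  by_cases h : z.1 ∈ Ioo 0 T
  · simpa [monom, slab_of_mem h, abs_of_nonneg (D.ι_nonneg z)] using D.norm_J_le i z
  · simpa [monom, slab_of_notMem h, D.ι_supp z h] using D.norm_J_le i z

theorem pairable_B_lowField (N : ℝ) {K : Set ℝ} (hK : IsCompact K) (i k : Fin 3) :
    Pairable (D.B k) (D.lowField N K i) := by
  refine .of_bounded_right D.integrable ?_ (c := N ^ 2) fun z => ?_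
  · exact ((D.pair 0 0 2 0 (by norm_num) (by norm_num)).mono aestronglyMeasurable_zero
      (f' := 0) (c := 1) (D.lowField_aesm N hK i) (by simp) (D.abs_lowField_le_monom N K i)).integrable
  · by_cases h : z ∈ D.lowSet N K
    · refine (D.abs_lowField_le N K i z).trans ?_
      exact pow_le_pow_left₀ (D.β_nonneg z) h.1 2
    · rw [lowField, indicator_of_notMem h]; simp; positivity

theorem pairable_J_lowField (N : ℝ) {K : Set ℝ} (hK : IsCompact K) (i k : Fin 3) :
    Pairable (D.J k) (D.lowField N K i) :=
  (D.pair 0 1 2 0 (by norm_num) (by norm_num)).mono (D.J_aesm k) (D.lowField_aesm N hK i)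
    (D.abs_J_le_monom k) (D.abs_lowField_le_monom N K i)

theorem timeSupported_lowField (N : ℝ) {K : Set ℝ} (hK : IsCompact K) (hKT : K ⊆ Ioo 0 T)
    (i : Fin 3) : TimeSupported T (D.lowField N K i) :=
  ⟨K, hK, hKT, fun _ hz => indicator_of_notMem (fun h => hz h.2) _⟩

/-- Since the truncated field is dominated by |b|², the correlation bound for |j| and |b|² serves
for all truncations and all displacements. -/
theorem exists_bound_corr_J_lowField : ∃ M : ℝ, 0 ≤ M ∧ ∀ N K, IsCompact K → ∀ (i k : Fin 3) h,
    |corr (D.J k) (D.lowField N K i) h| ≤ M := by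
  obtain ⟨M, hM, hb⟩ := (D.pair 0 1 2 0 (by norm_num) (by norm_num)).exists_corr_bound
  refine ⟨M, hM, fun N K _ i k h => le_trans ?_ (hb h)⟩
  refine (abs_integral_le_integral_abs).trans (integral_mono_of_nonneg
    (Eventually.of_forall fun _ => abs_nonneg _) ?_ (Eventually.of_forall fun z => ?_))
  · exact ((D.pair 0 1 2 0 (by norm_num) (by norm_num)).integrable_mul h).norm
  · simp only [abs_mul, norm_mul]
    have h1 := D.abs_J_le_monom k (z + h)
    have h2 := D.abs_lowField_le_monom N K i z
    rw [one_mul] at h1 h2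
    exact mul_le_mul h1 h2 (abs_nonneg _) (norm_nonneg _)

/-- At unit scale the energy suffices: φ * b(t) is bounded by sup |φ| times the L¹ norm of b(t) on
the torus, uniformly for almost every t, and the remaining factor |b|² is integrable on (0,T). -/
theorem exists_bound_pairing_B_lowField {φ : E3 → ℝ} (hφ : IsKernel φ)
    (h0 : ∀ l, 1 / 4 < ‖l‖ → φ l = 0) : ∃ M : ℝ, ∀ N K, IsCompact K → ∀ i : Fin 3,
    |pairing φ (D.B i) (D.lowField N K i)| ≤ M := by
  obtain ⟨Cφ, hCφ⟩ := hφ.smooth.continuous.bounded_above_of_compact_support hφ.compact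
  obtain ⟨C, hC, hE⟩ := D.energy
  set c := ENNReal.ofReal Cφ * (1 + C) with hc
  refine ⟨(c * C * ENNReal.ofReal T).toReal, fun N K hK i => ?_⟩
  have hslice : ∀ᵐ t : ℝ, AEStronglyMeasurable (fun x : T3 => D.β (t, x)) volume :=
    AEStronglyMeasurable.prodMk_left D.β_aesm
  have hinner : ∀ᵐ t : ℝ, ∀ x : T3, ∫⁻ l, ‖φ l‖ₑ * ‖D.β ((t, x) + sp l)‖ₑ ≤ c := by
    filter_upwards [hslice, hE] with t ht htE x
    -- The cube (−½, ½]³ contains the ball of radius 1/4 carrying `φ` and projects onto the torus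
    -- preserving measure.
    set a : E3 := WithLp.toLp 2 fun _ => -(1 / 2)
    calc ∫⁻ l, ‖φ l‖ₑ * ‖D.β ((t, x) + sp l)‖ₑ
        ≤ ∫⁻ l, (cube a).indicator (fun l => ENNReal.ofReal Cφ * ‖D.β (t, x + proj l)‖ₑ) l := by
          refine lintegral_mono fun l => ?_
          by_cases hl : l ∈ cube a
          · rw [indicator_of_mem hl, ← ofReal_norm]
            have : (t, x) + sp l = (t, x + proj l) := by simp [sp]
            rw [this]
            gcongr
            exact hCφ l
          · rw [indicator_of_notMem hl, h0 l, enorm_zero, zero_mul]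
            by_contra h1
            refine hl fun k => ?_
            have h2 := abs_le.1 ((PiLp.norm_apply_le l k).trans (not_lt.1 h1))
            simp only [a]
            constructor <;> linarith [h2.1, h2.2]
      _ ≤ ∫⁻ l in cube a, ENNReal.ofReal Cφ * ‖D.β (t, x + proj l)‖ₑ := lintegral_indicator_le _ _
      _ = ENNReal.ofReal Cφ * ∫⁻ l in cube a, ‖D.β (t, x + proj l)‖ₑ :=
          lintegral_const_mul' _ _ ENNReal.ofReal_ne_top
      _ = ENNReal.ofReal Cφ * ∫⁻ y, ‖D.β (t, x + y)‖ₑ := by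
          rw [← (measurePreserving_proj_cube a).map_eq, lintegral_map']
          · rw [(measurePreserving_proj_cube a).map_eq]
            exact (ht.comp_quasiMeasurePreserving
              (quasiMeasurePreserving_add_left volume x)).enorm
          · exact (measurePreserving_proj_cube a).aemeasurable
      _ = ENNReal.ofReal Cφ * ∫⁻ y, ‖D.β (t, y)‖ₑ := by
          rw [lintegral_add_left_eq_self (fun y => ‖D.β (t, y)‖ₑ) x]
      _ ≤ c := by
          rw [hc]
          gcongr
          -- The L¹ norm is controlled by the energy through s ≤ 1 + s², the torus having unit
          -- volume.
          calc ∫⁻ y, ‖D.β (t, y)‖ₑ ≤ ∫⁻ y : T3, (1 + ‖D.β (t, y)‖ₑ ^ 2) := by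
                refine lintegral_mono fun y => ?_
                rcases le_total ‖D.β (t, y)‖ₑ 1 with h1 | h1
                · exact h1.trans le_self_add
                · refine le_add_left ?_
                  rw [sq]
                  exact le_mul_of_one_le_left zero_le h1
            _ = 1 + ∫⁻ y : T3, ‖D.β (t, y)‖ₑ ^ 2 := by
                rw [lintegral_add_left measurable_const]
                simp
            _ ≤ 1 + C := by gcongr
  have hP := D.pairable_B_lowField N hK i i
  have hwφ : Integrable φ := hφ.smooth.continuous.integrable_of_hasCompactSupport hφ.compact
  have h1 : pairing φ (D.B i) (D.lowField N K i)
      = ∫ z, ∫ l, φ l * (D.B i (z + sp l) * D.lowField N K i z) :=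
    (hP.integral_swap continuous_sp.measurable hwφ).symm
  rw [h1, ← Real.norm_eq_abs, ← toReal_enorm]
  refine ENNReal.toReal_mono (by finiteness) ?_
  calc _ ≤ ∫⁻ z : ST, ‖∫ l, φ l * (D.B i (z + sp l) * D.lowField N K i z)‖ₑ :=
        enorm_integral_le_lintegral_enorm _
    _ ≤ ∫⁻ z : ST, c * ‖D.β z‖ₑ ^ 2 := by
        refine lintegral_mono_ae ?_
        have h2 : ∀ᵐ z : ST, ∀ x : T3, ∫⁻ l, ‖φ l‖ₑ * ‖D.β ((z.1, x) + sp l)‖ₑ ≤ c :=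
          Measure.quasiMeasurePreserving_fst.ae hinner
        filter_upwards [h2] with z hz
        refine (enorm_integral_le_lintegral_enorm _).trans ?_
        calc _ ≤ ∫⁻ l, (‖φ l‖ₑ * ‖D.β (z + sp l)‖ₑ) * ‖D.β z‖ₑ ^ 2 := by
              refine lintegral_mono fun l => ?_
              rw [enorm_mul, enorm_mul, ← mul_assoc, ← ofReal_norm (D.B i _),
                ← ofReal_norm (D.β (z + sp l)), Real.norm_of_nonneg (D.β_nonneg _), ← enorm_pow]
              gcongr
              · exact D.norm_B_le i _
              · rw [← ofReal_norm, ← ofReal_norm (D.β z ^ 2), Real.norm_of_nonneg (sq_nonneg (D.β z))]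
                exact ENNReal.ofReal_le_ofReal (D.abs_lowField_le N K i z)
          _ = (∫⁻ l, ‖φ l‖ₑ * ‖D.β (z + sp l)‖ₑ) * ‖D.β z‖ₑ ^ 2 :=
              lintegral_mul_const' _ _ (by finiteness)
          _ ≤ c * ‖D.β z‖ₑ ^ 2 := by
              gcongr
              exact hz z.2
    _ = c * ∫⁻ z : ST, ‖D.β z‖ₑ ^ 2 := lintegral_const_mul' _ _ (by finiteness)
    _ ≤ c * (C * ENNReal.ofReal T) := by
        gcongr
        calc ∫⁻ z : ST, ‖D.β z‖ₑ ^ 2 = ∫⁻ t : ℝ, ∫⁻ x : T3, ‖D.β (t, x)‖ₑ ^ 2 :=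
              lintegral_prod _ (D.β_aesm.enorm.pow_const 2)
          _ ≤ ∫⁻ t : ℝ, (Ioo 0 T).indicator (fun _ => C) t := by
              refine lintegral_mono_ae ?_
              filter_upwards [hE] with t ht
              by_cases h3 : t ∈ Ioo 0 T
              · rwa [indicator_of_mem h3]
              · simp [D.β_supp (t, _) h3]
          _ = C * ENNReal.ofReal T := by
              rw [lintegral_indicator measurableSet_Ioo]
              simp
    _ = _ := (mul_assoc _ _ _).symm

/-- Let m(r) be the pairing of φ_r * b with the truncation of |b|b. Then m′(r) is r times a pairing
with ΔΘ_r; Δb = −curl j replaces one derivative of b by j, and the derivative left on Θ_r costs r⁻¹,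
so m′ is bounded. With the bound on m(1) this controls the limit of m at r = 0, a multiple of the
truncated third moment, independently of the truncation. -/
theorem exists_third_moment_bound : ∃ M : ℝ, ∀ N K, IsCompact K → K ⊆ Ioo 0 T →
    ∑ i, ∫ z, D.B i z * D.lowField N K i z ≤ M := by
  obtain ⟨φ, Θ, hφ, hΘ, hφ0, hΘ0, hd, hpos⟩ := exists_radial_kernels
  obtain ⟨M₁, hM₁, hJ⟩ := D.exists_bound_corr_J_lowField
  obtain ⟨M₂, hM₂⟩ := D.exists_bound_pairing_B_lowField hφ hφ0
  set Q : ℝ := ∑ k, ∫ l, |pd k Θ l| with hQ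
  have hQk : ∀ k, ∫ l, |pd k Θ l| ≤ Q := fun k =>
    Finset.single_le_sum (f := fun k => ∫ l, |pd k Θ l|)
      (fun _ _ => integral_nonneg fun _ => abs_nonneg _) (Finset.mem_univ k)
  refine ⟨(∫ l, φ l)⁻¹ * (3 * M₂ + 6 * (Q * M₁)), fun N K hK hKT => ?_⟩
  set m : ℝ → ℝ := fun r => ∑ i, pairing (rescale φ r) (D.B i) (D.lowField N K i) with hm
  have hR : ∀ i, Rep (fun φ => pairing φ (D.B i) (D.lowField N K i)) _ := fun i =>
    .of_pairable (D.pairable_B_lowField N hK i i)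
  have hR' := Rep.sum Finset.univ hR
  have hder : ∀ r, 0 < r → HasDerivAt m
      (r * ∑ k, ∑ i, pairing (pd k (pd k (rescale Θ r))) (D.B i) (D.lowField N K i)) r :=
    fun r hr => hR'.hasDerivAt_rescale hφ hΘ hd hr
  have hb1 : ∀ r, 0 < r → ∀ i k l, |pairing (pd k (rescale Θ r)) (D.J l) (D.lowField N K i)|
      ≤ r⁻¹ * (Q * M₁) := fun r hr i k l => by
    refine (abs_pairing_le ((isKernel_rescale hΘ hr).pd k) (hJ N K hK i l)).trans ?_
    rw [pd_rescale hΘ]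
    simp only [abs_mul, integral_const_mul]
    rw [integral_abs_rescale _ hr, abs_of_pos (inv_pos.2 hr), mul_assoc]
    gcongr
    exact hQk k
  -- Three components with two terms of the curl each give the 6; the factor r cancels the r⁻¹ of
  -- `hb1`.
  have hb : ∀ r, 0 < r → ‖r * ∑ k, ∑ i, pairing (pd k (pd k (rescale Θ r))) (D.B i)
      (D.lowField N K i)‖ ≤ 6 * (Q * M₁) := fun r hr => by
    rw [Finset.sum_comm, norm_mul, Real.norm_of_nonneg hr.le]
    have h1 : ∀ i, ‖∑ k, pairing (pd k (pd k (rescale Θ r))) (D.B i) (D.lowField N K i)‖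
        ≤ 2 * (r⁻¹ * (Q * M₁)) := fun i => by
      obtain ⟨k, l, h⟩ := exists_cyc i
      rw [D.laplacian_primed (isKernel_rescale hΘ hr) h (D.timeSupported_lowField N hK hKT i)
        (D.pairable_B_lowField N hK i) (D.pairable_J_lowField N hK i), two_mul]
      exact (norm_sub_le _ _).trans (add_le_add (hb1 r hr _ _ _) (hb1 r hr _ _ _))
    calc _ ≤ r * ∑ i : Fin 3, 2 * (r⁻¹ * (Q * M₁)) := by
          gcongr
          exact norm_sum_le_of_le _ fun i _ => h1 i
      _ = _ := by
          simp
          field_simp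
          ring
  have hm1 : |m 1| ≤ 3 * M₂ := by
    have h1 : rescale φ 1 = φ := by ext l; simp [rescale]
    simp only [hm, h1]
    refine (Finset.abs_sum_le_sum_abs _ _).trans ?_
    calc _ ≤ ∑ i : Fin 3, M₂ := Finset.sum_le_sum fun i _ => hM₂ N K hK i
      _ = _ := by simp
  have hle : ∀ r, r ∈ Ioc (0 : ℝ) 1 → m r ≤ 3 * M₂ + 6 * (Q * M₁) := fun r hr => by
    have h1 := (convex_Ioc (0 : ℝ) 1).norm_image_sub_le_of_norm_hasDerivWithin_le
      (fun s hs => (hder s hs.1).hasDerivWithinAt) (fun s hs => hb s hs.1)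
      (right_mem_Ioc.2 one_pos) hr
    have h2 : ‖r - 1‖ ≤ 1 := by
      rw [Real.norm_eq_abs, abs_le]; constructor <;> linarith [hr.1, hr.2]
    have h3 : ‖m r - m 1‖ ≤ 6 * (Q * M₁) :=
      h1.trans (mul_le_of_le_one_right (by positivity) h2)
    have h4 := (abs_le.1 hm1).2
    have h5 := (abs_le.1 h3).2
    linarith
  have hlim := hR'.tendsto hφ
  have hfin := le_of_tendsto hlim (b := 3 * M₂ + 6 * (Q * M₁)) (by
    filter_upwards [Ioc_mem_nhdsGT one_pos] with r hr using hle r hr)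
  simp only [corr_apply_zero] at hfin
  rw [inv_mul_eq_div, le_div_iff₀ hpos, mul_comm]
  exact hfin

end Config

/-! ### Mixed Lebesgue norms -/

/-- The norm of `L^r(ℝ; L^s(𝕋³))`. -/
def mixedNorm (r s : ℝ) (u : ST → ℝ≥0∞) : ℝ≥0∞ :=
  (∫⁻ t, ((∫⁻ x, u (t, x) ^ s) ^ (1 / s)) ^ r) ^ (1 / r)

theorem ae_aemeasurable_slice {u : ST → ℝ≥0∞} (hu : AEMeasurable u) :
    ∀ᵐ t : ℝ, AEMeasurable (fun x : T3 => u (t, x)) volume := by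
  filter_upwards [Measure.ae_ae_of_ae_prod hu.ae_eq_mk] with t ht
  exact ⟨_, hu.measurable_mk.comp measurable_prodMk_left, ht⟩

/-- Hölder in x on almost every time slice and then in t. Both norms are translation invariant, so
the bound is uniform in `h`. -/
theorem lintegral_translate_mul_le {r r' s s' : ℝ} (hr : r.HolderConjugate r')
    (hs : s.HolderConjugate s') {u v : ST → ℝ≥0∞} (hu : AEMeasurable u) (hv : AEMeasurable v)
    (h : ST) : ∫⁻ z, u (z + h) * v z ≤ mixedNorm r s u * mixedNorm r' s' v := by
  have hqt : Measure.QuasiMeasurePreserving (fun t : ℝ => t + h.1) volume volume :=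
    quasiMeasurePreserving_add_right volume h.1
  have hqx : Measure.QuasiMeasurePreserving (fun x : T3 => x + h.2) volume volume :=
    quasiMeasurePreserving_add_right volume h.2
  have hut : ∀ᵐ t : ℝ, AEMeasurable (fun x : T3 => u (t + h.1, x)) volume :=
    hqt.ae (p := fun t => AEMeasurable (fun x : T3 => u (t, x)) volume)
      (ae_aemeasurable_slice hu)
  have hvt : ∀ᵐ t : ℝ, AEMeasurable (fun x : T3 => v (t, x)) volume :=
    ae_aemeasurable_slice hv
  set F : ℝ → ℝ≥0∞ := fun t => (∫⁻ x, u (t, x) ^ s) ^ (1 / s) with hF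
  set G : ℝ → ℝ≥0∞ := fun t => (∫⁻ x, v (t, x) ^ s') ^ (1 / s') with hG
  have hFm : AEMeasurable F := by
    have h1 : AEMeasurable (fun z : ℝ × T3 => u z ^ s) ((volume : Measure ℝ).prod volume) :=
      hu.pow_const s
    exact h1.lintegral_prod_right'.pow_const _
  have hGm : AEMeasurable G := by
    have h1 : AEMeasurable (fun z : ℝ × T3 => v z ^ s') ((volume : Measure ℝ).prod volume) :=
      hv.pow_const s'
    exact h1.lintegral_prod_right'.pow_const _
  calc ∫⁻ z, u (z + h) * v z = ∫⁻ t : ℝ, ∫⁻ x : T3, u (t + h.1, x + h.2) * v (t, x) :=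
        lintegral_prod _ ((aemeasurable_translate hu h).mul hv)
    _ ≤ ∫⁻ t : ℝ, F (t + h.1) * G t := by
        refine lintegral_mono_ae ?_
        filter_upwards [hut, hvt] with t h1 h2
        refine (ENNReal.lintegral_mul_le_Lp_mul_Lq volume hs
          (h1.comp_quasiMeasurePreserving hqx) h2).trans_eq ?_
        simp only [hF, hG, Function.comp]
        rw [lintegral_add_right_eq_self (fun x => u (t + h.1, x) ^ s) h.2]
    _ ≤ (∫⁻ t, F (t + h.1) ^ r) ^ (1 / r) * (∫⁻ t, G t ^ r') ^ (1 / r') :=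
        ENNReal.lintegral_mul_le_Lp_mul_Lq volume hr (hFm.comp_quasiMeasurePreserving hqt) hGm
    _ = mixedNorm r s u * mixedNorm r' s' v := by
        rw [lintegral_add_right_eq_self (fun t => F t ^ r) h.1]
        rfl

/-- Dominated convergence twice, in x on slices of finite norm and then in t; finiteness of both
exponents is what makes this work. -/
theorem tendsto_mixedNorm_tailPart {r s : ℝ} (hr : 0 < r) (hs : 0 < s) {f : ST → ℝ}
    (hf : AEStronglyMeasurable f volume) (hfin : mixedNorm r s (fun z => ‖f z‖ₑ) ≠ ⊤) :
    Tendsto (fun n : ℕ => mixedNorm r s (tailPart n f)) atTop (𝓝 0) := by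
  have hfin' : ∫⁻ t, ((∫⁻ x, ‖f (t, x)‖ₑ ^ s) ^ (1 / s)) ^ r ≠ ⊤ := fun h => hfin (by
    rw [mixedNorm, h, ENNReal.top_rpow_of_pos (one_div_pos.2 hr)])
  have hle : ∀ (n : ℕ) z, tailPart n f z ≤ ‖f z‖ₑ := fun n z =>
    indicator_le_self _ (fun w => ‖f w‖ₑ) z
  have htend : ∀ z, Tendsto (fun n : ℕ => tailPart n f z) atTop (𝓝 0) := fun z => by
    refine tendsto_const_nhds.congr' ?_
    obtain ⟨n₀, hn₀⟩ := exists_nat_ge ‖f z‖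
    filter_upwards [eventually_ge_atTop n₀] with n hn
    have : ¬ ((n : ℝ) < ‖f z‖) := not_lt.2 (hn₀.trans (by exact_mod_cast hn))
    simp [tailPart, indicator, this, -Real.norm_eq_abs]
  have hm : ∀ n : ℕ, AEMeasurable (fun z : ℝ × T3 => tailPart n f z ^ s)
      ((volume : Measure ℝ).prod volume) := fun n => (aemeasurable_tailPart hf).pow_const s
  have hpow : ∀ {e : ℝ} (_ : 0 < e) {u : ℕ → ℝ≥0∞}, Tendsto u atTop (𝓝 0) →
      Tendsto (fun n => u n ^ e) atTop (𝓝 0) := fun {e} he {u} hu => by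
    have := ((ENNReal.continuous_rpow_const (y := e)).tendsto 0).comp hu
    simpa [he, Function.comp_def] using this
  refine hpow (one_div_pos.2 hr) ?_
  rw [← lintegral_zero (μ := (volume : Measure ℝ))]
  have hmF : AEMeasurable (fun t => ((∫⁻ x, ‖f (t, x)‖ₑ ^ s) ^ (1 / s)) ^ r) volume := by
    have h1 : AEMeasurable (fun z : ℝ × T3 => ‖f z‖ₑ ^ s) ((volume : Measure ℝ).prod volume) :=
      hf.enorm.pow_const s
    exact (h1.lintegral_prod_right'.pow_const _).pow_const _
  refine tendsto_lintegral_of_dominated_convergence'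
    (fun t => ((∫⁻ x, ‖f (t, x)‖ₑ ^ s) ^ (1 / s)) ^ r)
    (fun n => ((hm n).lintegral_prod_right'.pow_const _).pow_const _)
    (fun n => Eventually.of_forall fun t => ?_) hfin' ?_
  · exact ENNReal.rpow_le_rpow (ENNReal.rpow_le_rpow (lintegral_mono fun x =>
      ENNReal.rpow_le_rpow (hle n (t, x)) hs.le) (one_div_pos.2 hs).le) hr.le
  · have h1 : ∀ᵐ t : ℝ, ∀ n : ℕ, AEMeasurable (fun x : T3 => tailPart n f (t, x)) volume :=
      ae_all_iff.2 fun n => ae_aemeasurable_slice (aemeasurable_tailPart hf)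
    filter_upwards [ae_lt_top' hmF hfin', h1] with t ht hmt
    refine hpow hr (hpow (one_div_pos.2 hs) ?_)
    have hin : ∫⁻ x, ‖f (t, x)‖ₑ ^ s ≠ ⊤ := fun h => by
      simp [h, hs, hr] at ht
    rw [← lintegral_zero (μ := (volume : Measure T3))]
    refine tendsto_lintegral_of_dominated_convergence' (fun x => ‖f (t, x)‖ₑ ^ s)
      (fun n => (hmt n).pow_const s)
      (fun n => Eventually.of_forall fun x => ?_) hin
      (Eventually.of_forall fun x => hpow hs (htend _))
    exact ENNReal.rpow_le_rpow (hle n (t, x)) hs.le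

theorem Pairable.of_mixedNorm {r r' s s' : ℝ} (hr : r.HolderConjugate r')
    (hs : s.HolderConjugate s') {f g : ST → ℝ} (hf : AEStronglyMeasurable f volume)
    (hg : Integrable g) (hfin : mixedNorm r s (fun z => ‖f z‖ₑ) ≠ ⊤)
    (hgfin : mixedNorm r' s' (fun z => ‖g z‖ₑ) ≠ ⊤) : Pairable f g := by
  refine ⟨hf, hg, fun ε hε => ?_⟩
  have h1 := ENNReal.Tendsto.mul_const (b := mixedNorm r' s' fun z => ‖g z‖ₑ)
    (tendsto_mixedNorm_tailPart hr.pos hs.pos hf hfin) (Or.inr hgfin)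
  rw [zero_mul] at h1
  obtain ⟨n, hn⟩ := (h1.eventually_le_const (pos_iff_ne_zero.2 hε)).exists
  exact ⟨n, n.cast_nonneg, fun h => (lintegral_translate_mul_le hr hs
    (aemeasurable_tailPart hf) hg.1.enorm h).trans hn⟩

theorem mixedNorm_self {s : ℝ} (hs : 0 < s) {u : ST → ℝ≥0∞} (hu : AEMeasurable u) :
    mixedNorm s s u = (∫⁻ z, u z ^ s) ^ (1 / s) := by
  unfold mixedNorm
  congr 1
  rw [show ∫⁻ z : ST, u z ^ s = ∫⁻ t : ℝ, ∫⁻ x : T3, u (t, x) ^ s from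
    lintegral_prod _ (hu.pow_const s)]
  congr 1
  ext t
  rw [← ENNReal.rpow_mul, one_div_mul_cancel hs.ne', ENNReal.rpow_one]

/-! ### Integrability of |b|³ and pairings cubic in b -/

namespace Config

variable {T : ℝ} (D : Config T)

theorem sum_B_mul_lowField (N : ℝ) (K : Set ℝ) (z : ST) :
    ∑ i, D.B i z * D.lowField N K i z = (D.lowSet N K).indicator (fun z => D.β z ^ 3) z := by
  by_cases h : z ∈ D.lowSet N K
  · simp only [lowField, indicator_of_mem h]
    have := D.β_eq z
    rw [pow_succ, this, Finset.sum_mul]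
    exact Finset.sum_congr rfl fun i _ => by ring
  · simp [lowField, indicator_of_notMem h]

/-- Fatou's lemma along the heights n and compact time intervals exhausting (0,T); the truncated
moments are bounded by one constant. -/
theorem lintegral_β_cube_ne_top : ∫⁻ z, ‖D.β z‖ₑ ^ (3 : ℝ) ≠ ⊤ := by
  obtain ⟨M, hM⟩ := D.exists_third_moment_bound
  set K : ℕ → Set ℝ := fun n => Icc (1 / (n + 1 : ℝ)) (T - 1 / (n + 1)) with hK
  have hKT : ∀ n, K n ⊆ Ioo 0 T := fun n t ht => by
    have h0 : (0 : ℝ) < 1 / (n + 1) := by positivity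
    exact ⟨by linarith [ht.1], by linarith [ht.2]⟩
  set f : ℕ → ST → ℝ := fun n z => ∑ i, D.B i z * D.lowField n (K n) i z with hf
  have hfi : ∀ n, Integrable (f n) := fun n => integrable_finsetSum _ fun i _ => by
    simpa using (D.pairable_B_lowField n isCompact_Icc i i).integrable_mul 0
  have hf0 : ∀ n z, 0 ≤ f n z := fun n z => by
    rw [hf]
    simp only [sum_B_mul_lowField]
    exact indicator_nonneg (fun z _ => pow_nonneg (D.β_nonneg z) 3) z
  have hfb : ∀ n, ∫⁻ z, ‖f n z‖ₑ ≤ ENNReal.ofReal M := fun n => by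
    have h1 : ∫⁻ z, ‖f n z‖ₑ = ENNReal.ofReal (∫ z, f n z) := by
      rw [ofReal_integral_eq_lintegral_ofReal (hfi n) (Eventually.of_forall (hf0 n))]
      exact lintegral_congr fun z => by rw [← ofReal_norm, Real.norm_of_nonneg (hf0 n z)]
    rw [h1]
    refine ENNReal.ofReal_le_ofReal ?_
    rw [integral_finsetSum _ fun i _ => by
      simpa using (D.pairable_B_lowField n isCompact_Icc i i).integrable_mul 0]
    exact hM n (K n) isCompact_Icc (hKT n)
  have hlim : ∀ z, liminf (fun n => ‖f n z‖ₑ) atTop = ‖D.β z‖ₑ ^ (3 : ℝ) := fun z => by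
    refine Tendsto.liminf_eq ((tendsto_const_nhds (x := ‖D.β z‖ₑ ^ (3 : ℝ))).congr' ?_)
    by_cases h : z.1 ∈ Ioo 0 T
    · obtain ⟨n₀, hn₀⟩ := exists_nat_ge (D.β z)
      have h1 : ∀ᶠ n : ℕ in atTop, 1 / (n + 1 : ℝ) < min z.1 (T - z.1) :=
        (tendsto_one_div_add_atTop_nhds_zero_nat (𝕜 := ℝ)).eventually_lt_const
          (lt_min h.1 (by linarith [h.2]))
      filter_upwards [eventually_ge_atTop n₀, h1] with n hn hn1
      have hz : z ∈ D.lowSet n (K n) := by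
        refine ⟨hn₀.trans (by exact_mod_cast hn), ?_, ?_⟩
        · exact (hn1.trans_le (min_le_left _ _)).le
        · linarith [hn1.trans_le (min_le_right _ _)]
      rw [hf]
      simp only [sum_B_mul_lowField, indicator_of_mem hz, enorm_pow]
      norm_cast
    · refine Eventually.of_forall fun n => ?_
      rw [hf]
      simp only [sum_B_mul_lowField, D.β_supp z h, indicator]
      simp
  have h1 := lintegral_liminf_le' (u := (atTop : Filter ℕ)) fun n => (hfi n).1.enorm
  simp only [hlim] at h1
  refine ne_top_of_le_ne_top (ENNReal.ofReal_ne_top (r := M)) (h1.trans ?_)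
  exact liminf_le_of_frequently_le' (Eventually.of_forall hfb).frequently

theorem mixedNorm_β_ne_top : mixedNorm 3 3 (fun z => ‖D.β z‖ₑ) ≠ ⊤ := by
  rw [mixedNorm_self (by norm_num) D.β_aesm.enorm]
  exact ENNReal.rpow_ne_top_of_nonneg (by norm_num) D.lintegral_β_cube_ne_top

theorem mixedNorm_β_sq_ne_top :
    mixedNorm (3 / 2) (3 / 2) (fun z => ‖D.β z ^ 2‖ₑ) ≠ ⊤ := by
  have hm : AEMeasurable fun z => ‖D.β z ^ 2‖ₑ := (D.β_aesm.pow 2).enorm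
  rw [mixedNorm_self (by norm_num) hm]
  refine ENNReal.rpow_ne_top_of_nonneg (by norm_num) ?_
  convert D.lintegral_β_cube_ne_top using 2
  ext z
  rw [enorm_pow, ← ENNReal.rpow_natCast, ← ENNReal.rpow_mul]
  norm_num

theorem monom_zero_right {a : ℕ} (ha : a ≠ 0) : monom T D.β D.ι a 0 = fun z => D.β z ^ a := by
  ext z
  by_cases h : z.1 ∈ Ioo 0 T
  · simp [monom, slab_of_mem h]
  · simp [monom, slab_of_notMem h, D.β_supp z h, ha]

theorem abs_slab_le (z : ST) : ‖slab T z‖ ≤ 1 := by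
  by_cases h : z.1 ∈ Ioo 0 T
  · simp [slab_of_mem h]
  · simp [slab_of_notMem h]

/-- Only total degree three is new: |b| against |b|² uses the conjugate exponents 3 and 3/2, and a
constant against |b|³ is the bounded case. -/
theorem pairable_monom_cubic (a a' : ℕ) (h : a + a' ≤ 3) :
    Pairable (monom T D.β D.ι a 0) (monom T D.β D.ι a' 0) := by
  by_cases h2 : a + a' ≤ 2
  · exact D.pair _ _ _ _ h2 (by norm_num)
  have h3 : a + a' = 3 := by omega
  have h23 : (3 / 2 : ℝ).HolderConjugate 3 := by
    rw [Real.holderConjugate_iff]; norm_num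
  have hint : ∀ c : ℕ, c ≤ 2 → Integrable (monom T D.β D.ι c 0) := fun c hc =>
    (D.pair 0 0 c 0 (by omega) (by norm_num)).integrable
  have hint3 : Integrable (monom T D.β D.ι 3 0) := by
    rw [D.monom_zero_right (by norm_num)]
    refine ⟨D.β_aesm.pow 3, ?_⟩
    rw [hasFiniteIntegral_iff_enorm]
    refine lt_of_eq_of_lt (lintegral_congr fun z => ?_) (lt_top_iff_ne_top.2 D.lintegral_β_cube_ne_top)
    rw [enorm_pow]
    norm_cast
  have hslab : ∀ z, ‖monom T D.β D.ι 0 0 z‖ ≤ 1 := fun z => by simpa [monom] using abs_slab_le z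
  have ha : a ≤ 3 := by omega
  interval_cases a
  · obtain rfl : a' = 3 := by omega
    exact .of_bounded (hint 0 (by norm_num)).1 hint3 hslab
  · obtain rfl : a' = 2 := by omega
    refine .of_mixedNorm h23.symm h23.symm (hint 1 (by norm_num)).1 (hint 2 le_rfl) ?_ ?_
    · rw [D.monom_zero_right (by norm_num)]
      simpa using D.mixedNorm_β_ne_top
    · rw [D.monom_zero_right (by norm_num)]
      exact D.mixedNorm_β_sq_ne_top
  · obtain rfl : a' = 1 := by omega
    refine .of_mixedNorm h23 h23 (hint 2 le_rfl).1 (hint 1 (by norm_num)) ?_ ?_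
    · rw [D.monom_zero_right (by norm_num)]
      exact D.mixedNorm_β_sq_ne_top
    · rw [D.monom_zero_right (by norm_num)]
      simpa using D.mixedNorm_β_ne_top
  · obtain rfl : a' = 0 := by omega
    exact .of_bounded_right hint3 (hint 0 (by norm_num)) hslab

theorem pairable_cubic {f g : ST → ℝ} {a c a' c' : ℕ} [hf : D.Dom f a c] [hg : D.Dom g a' c']
    (h : a + a' ≤ 3 := by norm_num) (hc : c + c' = 0 := by norm_num) : Pairable f g := by
  obtain ⟨rfl, rfl⟩ : c = 0 ∧ c' = 0 := by omega
  obtain ⟨C, hC⟩ := hf.bound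
  obtain ⟨C', hC'⟩ := hg.bound
  exact (D.pairable_monom_cubic a a' h).mono hf.aesm hg.aesm hC hC'

end Config

/-! ### Constant fields -/

theorem integral_pd_mul {φ G : E3 → ℝ} (hφ : IsKernel φ) (hG : ContDiff ℝ 1 G) (k : Fin 3) :
    ∫ l, pd k φ l * G l = -∫ l, φ l * fderiv ℝ G l (basisVec k) := by
  have hG' : Continuous fun l => fderiv ℝ G l (basisVec k) :=
    (hG.continuous_fderiv one_ne_zero).clm_apply continuous_const
  have hc : ∀ {f g : E3 → ℝ}, Continuous f → HasCompactSupport f → Continuous g →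
      Integrable fun l => g l * f l := fun hf hs hg =>
    (hg.mul hf).integrable_of_hasCompactSupport hs.mul_left
  have h1 := integral_mul_fderiv_eq_neg_fderiv_mul_of_integrable (μ := (volume : Measure E3))
    (f := G) (g := φ) (v := basisVec k) (𝕜 := ℝ) (hc hφ.smooth.continuous hφ.compact hG')
    (hc (hφ.pd k).smooth.continuous (hφ.pd k).compact hG.continuous)
    (hc hφ.smooth.continuous hφ.compact hG.continuous)
    (fun _ _ => hG.differentiable one_ne_zero _)
    (fun _ _ => hφ.smooth.differentiable (by simp) _)
  simp only [mul_comm (φ _)]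
  rw [← h1]
  exact integral_congr_ae (Eventually.of_forall fun l => mul_comm _ _)

theorem integral_pd_eq_zero {φ : E3 → ℝ} (hφ : IsKernel φ) (k : Fin 3) : ∫ l, pd k φ l = 0 := by
  simpa using integral_pd_mul hφ (contDiff_const (c := (1 : ℝ))) k

theorem pairing_pd_one {φ : E3 → ℝ} (hφ : IsKernel φ) (k : Fin 3) (g : ST → ℝ) :
    pairing (pd k φ) 1 g = 0 := by
  simp [pairing, corr, integral_mul_const, integral_pd_eq_zero hφ]

theorem integrable_slab (T : ℝ) : Integrable (slab T) := by
  have h1 : slab T = (Ioo 0 T ×ˢ univ : Set ST).indicator 1 := by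
    ext z
    by_cases h : z.1 ∈ Ioo 0 T
    · rw [Config.slab_of_mem h, indicator_of_mem (by exact ⟨h, mem_univ _⟩)]; rfl
    · rw [Config.slab_of_notMem h, indicator_of_notMem (fun h' => h h'.1)]
  rw [h1]
  refine IntegrableOn.integrable_indicator ?_ (measurableSet_Ioo.prod MeasurableSet.univ)
  refine integrableOn_const (C := (1 : ℝ)) ?_
  rw [show (volume : Measure ST) = (volume : Measure ℝ).prod volume from rfl, Measure.prod_prod]
  simp

theorem tf_add_sp_cov {T : ℝ} (ψ : testSpace T ℝ) (w : ℝ × E3) :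
    (fun l => tf ψ (cov w + sp l)) = fun l => lift (ψ : ℝ → T3 → ℝ) (w + (0, l)) := by
  ext l
  rw [← tf_cov, cov_add]
  rfl

theorem integral_pd_mul_tf {T : ℝ} {φ : E3 → ℝ} (hφ : IsKernel φ) (k : Fin 3) (ψ : testSpace T ℝ)
    (z : ST) : ∫ l, pd k φ l * tf ψ (z + sp l) = -∫ l, φ l * dx k ψ (z + sp l) := by
  obtain ⟨w, rfl⟩ := cov_surjective z
  have h1 : ContDiff ℝ 1 fun l => lift (ψ : ℝ → T3 → ℝ) (w + ((0 : ℝ), l)) :=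
    (ψ.2.1.of_le (by simp)).comp (contDiff_const.add (contDiff_const.prodMk contDiff_id))
  have h2 := integral_pd_mul hφ h1 k
  have h3 : ∀ l, fderiv ℝ (fun l => lift (ψ : ℝ → T3 → ℝ) (w + ((0 : ℝ), l))) l (basisVec k)
      = dx k ψ (cov w + sp l) := fun l => by
    have e1 : HasFDerivAt (fun l : E3 => w + ((0 : ℝ), l)) (ContinuousLinearMap.inr ℝ ℝ E3) l :=
      (ContinuousLinearMap.inr ℝ ℝ E3).hasFDerivAt.const_add w
    have e2 := ((ψ.2.1.differentiable (by simp)) (w + ((0 : ℝ), l))).hasFDerivAt.comp l e1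
    rw [show cov w + sp l = cov (w + (0, l)) by rw [cov_add]; rfl, dx_cov]
    rw [show (fun l => lift (ψ : ℝ → T3 → ℝ) (w + ((0 : ℝ), l)))
      = lift (ψ : ℝ → T3 → ℝ) ∘ fun l : E3 => w + ((0 : ℝ), l) from rfl, e2.fderiv]
    rfl
  simp only [h3] at h2
  rw [← h2]
  exact integral_congr_ae (Eventually.of_forall fun l => by
    simp only [congrFun (tf_add_sp_cov ψ w) l])

/-- The integral of a spatial translate does not depend on the displacement. Averaging it over a
mollifier and integrating by parts in the displacement leaves ∫ ∂ₖφ = 0 as a factor. -/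
theorem integral_dx {T : ℝ} (k : Fin 3) (ψ : testSpace T ℝ) : ∫ z, dx k ψ z = 0 := by
  obtain ⟨φ, hφ⟩ := exists_isMollifier
  obtain ⟨C, hC⟩ := exists_bound_tf ψ
  obtain ⟨C', hC'⟩ := exists_bound_dx k ψ
  obtain ⟨K, -, hKT, hK⟩ := exists_compact_support ψ
  -- The slab is the integrable stand-in for the constant 1: purely spatial translates of `ψ` stay
  -- supported in it.
  have P : Pairable (tf ψ) (slab T) :=
    .of_bounded (continuous_tf ψ).aestronglyMeasurable (integrable_slab T) hC
  have P' : Pairable (dx k ψ) (slab T) :=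
    .of_bounded (continuous_dx k ψ).aestronglyMeasurable (integrable_slab T) hC'
  have hcorr : ∀ f : ST → ℝ, (∀ z : ST, z.1 ∉ K → f z = 0) →
      ∀ l, corr f (slab T) (sp l) = ∫ z, f z := fun f hf l => by
    rw [← integral_add_right_eq_self f (sp l)]
    refine integral_congr_ae (Eventually.of_forall fun z => ?_)
    by_cases h : z.1 ∈ K
    · simp [Config.slab_of_mem (hKT h)]
    · simp [hf (z + sp l) (by simpa [sp] using h)]
  have hφi : Integrable φ := hφ.smooth.continuous.integrable_of_hasCompactSupport hφ.compact
  have hpi : Integrable (pd k φ) := (hφ.isKernel.pd k).smooth.continuous.integrable_of_hasCompactSupport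
    (hφ.isKernel.pd k).compact
  have h1 := P.integral_swap continuous_sp.measurable hpi
  have h2 := P'.integral_swap continuous_sp.measurable hφi
  simp only [hcorr _ fun z hz => (hK z hz).1, hcorr _ fun z hz => (hK z hz).2.2 k,
    integral_mul_const, integral_pd_eq_zero hφ.isKernel, ← mul_assoc, hφ.integral_eq_one, zero_mul,
    one_mul] at h1 h2
  rw [← h2, ← neg_eq_zero, ← integral_neg, ← h1]
  refine integral_congr_ae (Eventually.of_forall fun z => ?_)
  simp only [integral_pd_mul_tf hφ.isKernel]
  ring

/-- The constant field eₖ is divergence free, so this is an instance of the law for the fixed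
factor, in which only ψ is left to differentiate. -/
theorem pairing_pd_test {T : ℝ} {φ : E3 → ℝ} (hφ : IsKernel φ) (k : Fin 3) (ψ : testSpace T ℝ)
    {g : ST → ℝ} (hg : Integrable g) (P : Pairable g (tf ψ)) (P' : Pairable g (dx k ψ)) :
    pairing (pd k φ) g (tf ψ) = pairing φ g (dx k ψ) := by
  have hW : WeakDiv T 0 (fun x => if x = k then 1 else 0) 0 := by
    intro χ
    have h1 : ∀ z : ST, (0 : ST → ℝ) z * dt χ z
        + ∑ x, (if x = k then (1 : ST → ℝ) else 0) z * dx x χ z = dx k χ z := fun z => by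
      rw [Finset.sum_eq_single k (fun x _ hx => by simp [hx]) (by simp)]
      simp
    simp only [h1]
    simp [integral_dx k χ]
  have h0 : Pairable g 0 := .zero_right P.aesm
  have h1 := hW.unprimed hg ψ (fun x => by split_ifs <;> simpa) (by simpa)
    (fun x => by split_ifs with h <;> simp only [one_mul, zero_mul, h] <;> assumption) hφ.smooth hφ.compact
  simpa [mul_ite, ite_mul, apply_ite (pairing _ g), pairing_zero_right] using h1

/-! ### Functionals of kernels with a computable trace -/

/-- The functional `L` on kernels has a continuous density whose value at the origin is `∫ I`. -/
def HasTrace (L : (E3 → ℝ) → ℝ) (I : ST → ℝ) : Prop :=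
  ∃ H, Rep L H ∧ Integrable I ∧ H 0 = ∫ z, I z

namespace HasTrace

variable {L L' : (E3 → ℝ) → ℝ} {I I' : ST → ℝ}

theorem of_pairable {f g : ST → ℝ} (P : Pairable f g) :
    HasTrace (fun φ => pairing φ f g) (fun z => f z * g z) :=
  ⟨_, .of_pairable P, by simpa using P.integrable_mul 0, corr_apply_zero f g⟩

theorem add (h : HasTrace L I) (h' : HasTrace L' I') :
    HasTrace (fun φ => L φ + L' φ) (fun z => I z + I' z) := by
  obtain ⟨H, h1, h2, h3⟩ := h
  obtain ⟨H', h1', h2', h3'⟩ := h'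
  exact ⟨_, h1.add h1', h2.add h2', by rw [integral_add h2 h2', h3, h3']⟩

theorem sub (h : HasTrace L I) (h' : HasTrace L' I') :
    HasTrace (fun φ => L φ - L' φ) (fun z => I z - I' z) := by
  obtain ⟨H, h1, h2, h3⟩ := h
  obtain ⟨H', h1', h2', h3'⟩ := h'
  exact ⟨_, h1.sub h1', h2.sub h2', by rw [integral_sub h2 h2', h3, h3']⟩

theorem neg (h : HasTrace L I) : HasTrace (fun φ => -L φ) (fun z => -I z) := by
  obtain ⟨H, h1, h2, h3⟩ := h
  exact ⟨_, h1.neg, h2.neg, by rw [integral_neg, h3]⟩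

theorem const_mul (c : ℝ) (h : HasTrace L I) :
    HasTrace (fun φ => c * L φ) (fun z => c * I z) := by
  obtain ⟨H, h1, h2, h3⟩ := h
  exact ⟨_, h1.const_mul c, h2.const_mul c, by rw [integral_const_mul, h3]⟩

theorem sum {L : Fin 3 → (E3 → ℝ) → ℝ} {I : Fin 3 → ST → ℝ} (h : ∀ i, HasTrace (L i) (I i)) :
    HasTrace (fun φ => ∑ i, L i φ) (fun z => ∑ i, I i z) := by
  choose H h1 h2 h3 using h
  exact ⟨_, .sum _ h1, integrable_finsetSum _ fun i _ => h2 i, by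
    rw [integral_finsetSum _ fun i _ => h2 i]
    exact Finset.sum_congr rfl fun i _ => h3 i⟩

theorem congr (h : HasTrace L I) (hL : ∀ φ, IsKernel φ → L' φ = L φ) (hI : ∀ z, I' z = I z) :
    HasTrace L' I' := by
  obtain ⟨H, h1, h2, h3⟩ := h
  obtain rfl : I' = I := funext hI
  exact ⟨H, h1.congr hL, h2, h3⟩

theorem tendsto (h : HasTrace L I) {φ : E3 → ℝ} (hφ : IsMollifier φ) :
    Tendsto (fun ε => L (rescale φ ε)) (𝓝[>] 0) (𝓝 (∫ z, I z)) := by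
  obtain ⟨H, h1, h2, h3⟩ := h
  have := h1.tendsto hφ.isKernel
  rwa [hφ.integral_eq_one, one_mul, h3] at this

end HasTrace

/-! ### Two-point forms of the induction equation and of the stress law -/

namespace Config

variable {T : ℝ} (D : Config T) {i k l : Fin 3} {φ : E3 → ℝ} (ψ : testSpace T ℝ)

/-- The flux of bᵢ is row i of the antisymmetric tensor jᵢb − bᵢj, whose entries in the directions
i, k, l are 0, Vₗ and −Vₖ for the Lorentz force V. -/
theorem induction_exchange (hφ : IsKernel φ) (h : Cyc i k l) :
    pairing (pd k φ) (D.V l) (tf ψ * D.B i) - pairing (pd l φ) (D.V k) (tf ψ * D.B i)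
      - pairing (pd k φ) (D.B i) (tf ψ * D.V l) + pairing (pd l φ) (D.B i) (tf ψ * D.V k)
    = -pairing φ (D.B i) (D.B i * dt ψ) - pairing φ (D.B i) (D.V l * dx k ψ)
      + pairing φ (D.B i) (D.V k * dx l ψ) := by
  have e0 : D.J i * D.B i - D.J i * D.B i = 0 := sub_self _
  have e1 : D.J i * D.B k - D.J k * D.B i = D.V l := (D.V_eq h.rot.rot).symm
  have e2 : D.J i * D.B l - D.J l * D.B i = -D.V k := by rw [D.V_eq h.rot]; ring
  have h1 := (D.induction_eq i).exchange D.integrable ψ D.pairable (fun x => D.pairable)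
    (fun x => D.pairable) D.pairable (fun x => D.pairable) hφ.smooth hφ.compact
  simp only [h.sum_eq, e0, e1, e2, pairing_zero_left, pairing_zero_right, mul_zero, zero_mul, mul_neg,
    neg_mul, pairing_neg_left, pairing_neg_right] at h1
  linear_combination h1

theorem stress_primed (hφ : IsKernel φ) {g : ST → ℝ} (hg : TimeSupported T g)
    (P : ∀ x, Pairable (D.stress i x) g) (Q : Pairable (D.V i) g) :
    ∑ x, pairing (pd x φ) (D.stress i x) g = -pairing φ (D.V i) g :=
  primed (D.weakDiv_stress i) hφ hg P Q

theorem stress_unprimed (hφ : IsKernel φ) {g : ST → ℝ} (hg : Integrable g)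
    (P : ∀ x, Pairable g (tf ψ * D.stress i x)) (P' : ∀ x, Pairable g (D.stress i x * dx x ψ))
    (Q : Pairable g (tf ψ * D.V i)) :
    ∑ x, pairing (pd x φ) g (tf ψ * D.stress i x)
      = pairing φ g (tf ψ * D.V i) + ∑ x, pairing φ g (D.stress i x * dx x ψ) :=
  (D.weakDiv_stress i).unprimed hg ψ P Q P' hφ.smooth hφ.compact

theorem timeSupported_mul_dx (k : Fin 3) (g : ST → ℝ) : TimeSupported T (g * dx k ψ) := by
  obtain ⟨K, hK, hKT, h⟩ := exists_compact_support ψ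
  exact ⟨K, hK, hKT, fun z hz => by simp [(h z hz).2.2 k]⟩

/-- The fixed factor jᵢ is written as a curl of b, which puts a second derivative on the kernel. The
derivatives commute, so the divergence can then be spent on the translated stress, turning it into
j×b. The intermediate terms are cubic in b, which is where the L³ bound enters. -/
theorem stress_current (hφ : IsKernel φ) (h : Cyc i k l) :
    ∑ x, pairing (pd x φ) (D.stress i x) (tf ψ * D.J i)
      = -pairing (pd k φ) (D.V i) (tf ψ * D.B l) + pairing (pd l φ) (D.V i) (tf ψ * D.B k)
        + pairing φ (D.V i) (D.B l * dx k ψ) - pairing φ (D.V i) (D.B k * dx l ψ) := by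
  have e1 : ∀ x, pairing (pd x φ) (D.stress i x) (tf ψ * D.J i)
      = pairing (pd x (pd k φ)) (D.stress i x) (tf ψ * D.B l)
        - pairing (pd x (pd l φ)) (D.stress i x) (tf ψ * D.B k)
        - pairing (pd x φ) (D.stress i x) (D.B l * dx k ψ)
        + pairing (pd x φ) (D.stress i x) (D.B k * dx l ψ) := fun x => by
    have := D.curl_unprimed (ψ := ψ) (g := D.stress i x) (hφ.pd x) h D.integrable
      (fun y => D.pairable_cubic) (fun y y' => D.pairable_cubic) D.pairable
    rw [pd_comm hφ k x, pd_comm hφ l x] at this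
    linear_combination -this
  rw [Finset.sum_congr rfl fun x _ => e1 x, Finset.sum_add_distrib, Finset.sum_sub_distrib,
    Finset.sum_sub_distrib,
    D.stress_primed (hφ.pd k) (timeSupported_tf_mul ψ _) (fun x => D.pairable_cubic) D.pairable,
    D.stress_primed (hφ.pd l) (timeSupported_tf_mul ψ _) (fun x => D.pairable_cubic) D.pairable,
    D.stress_primed hφ (timeSupported_mul_dx ψ _ _) (fun x => D.pairable_cubic) D.pairable,
    D.stress_primed hφ (timeSupported_mul_dx ψ _ _) (fun x => D.pairable_cubic) D.pairable]
  ring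

/-- The mirror image, with jᵢ translated and the stress fixed. The stress law now leaves terms with
∇ψ and a differentiated kernel; `e2` folds these back into pairings with jᵢ. -/
theorem current_stress (hφ : IsKernel φ) (h : Cyc i k l) :
    ∑ x, pairing (pd x φ) (D.J i) (tf ψ * D.stress i x)
      = -pairing (pd k φ) (D.B l) (tf ψ * D.V i) + pairing (pd l φ) (D.B k) (tf ψ * D.V i)
        + ∑ x, pairing φ (D.J i) (D.stress i x * dx x ψ) := by
  have e1 : ∀ x, pairing (pd x φ) (D.J i) (tf ψ * D.stress i x)
      = -pairing (pd x (pd k φ)) (D.B l) (tf ψ * D.stress i x)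
        + pairing (pd x (pd l φ)) (D.B k) (tf ψ * D.stress i x) := fun x => by
    have := D.curl_primed (g := tf ψ * D.stress i x) (hφ.pd x) h (timeSupported_tf_mul ψ _)
      (fun y => D.pairable_cubic) D.pairable
    rw [pd_comm hφ k x, pd_comm hφ l x] at this
    linear_combination this
  have e2 : ∀ x, pairing φ (D.J i) (D.stress i x * dx x ψ)
      = -pairing (pd k φ) (D.B l) (D.stress i x * dx x ψ)
        + pairing (pd l φ) (D.B k) (D.stress i x * dx x ψ) := fun x => by
    have := D.curl_primed (g := D.stress i x * dx x ψ) hφ h (timeSupported_mul_dx ψ _ _)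
      (fun y => D.pairable_cubic) D.pairable
    linear_combination this
  rw [Finset.sum_congr rfl fun x _ => e1 x, Finset.sum_congr rfl fun x _ => e2 x,
    Finset.sum_add_distrib, Finset.sum_add_distrib, Finset.sum_neg_distrib, Finset.sum_neg_distrib,
    D.stress_unprimed ψ (hφ.pd k) D.integrable (fun x => D.pairable_cubic)
      (fun x => D.pairable_cubic) D.pairable,
    D.stress_unprimed ψ (hφ.pd l) D.integrable (fun x => D.pairable_cubic)
      (fun x => D.pairable_cubic) D.pairable]
  ring

end Config

/-! ### The flux identity -/

/-- The expansion of `∫ φ(ℓ) ∫ ψ(z) δu δv δw dz dℓ` into two-point correlations. -/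
def triPairing (φ : E3 → ℝ) (ψ u v w : ST → ℝ) : ℝ :=
  pairing φ (u * (v * w)) ψ - pairing φ (u * v) (ψ * w) - pairing φ (u * w) (ψ * v)
    - pairing φ (v * w) (ψ * u) + pairing φ u (ψ * (v * w)) + pairing φ v (ψ * (u * w))
    + pairing φ w (ψ * (u * v)) - pairing φ 1 (ψ * (u * (v * w)))

namespace Config

variable {T : ℝ} (D : Config T) {φ : E3 → ℝ} (ψ : testSpace T ℝ)

/-- `⅛ ∫ ∇φ · δj |δb|² - ¼ ∫ ∇φ · δb (δj · δb)`, tested against `ψ`. -/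
def flux (φ : E3 → ℝ) : ℝ :=
  (1 / 8) * ∑ k, ∑ i, triPairing (pd k φ) (tf ψ) (D.J k) (D.B i) (D.B i)
    - (1 / 4) * ∑ k, ∑ i, triPairing (pd k φ) (tf ψ) (D.B k) (D.J i) (D.B i)

/-- Terms where jₖ sits alone at its point are removed by div j = 0, up to a derivative of ψ. The
fully translated product gives its derivative to ψ, and the fully fixed product sees only ∫ ∂ₖφ = 0.
-/
theorem sum_triPairing_current (hφ : IsKernel φ) (i : Fin 3) :
    ∑ k, triPairing (pd k φ) (tf ψ) (D.J k) (D.B i) (D.B i)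
      = ∑ k, (pairing φ (D.J k * (D.B i * D.B i)) (dx k ψ)
        - pairing φ (D.B i * D.B i) (D.J k * dx k ψ)
        - 2 * pairing (pd k φ) (D.J k * D.B i) (tf ψ * D.B i)
        + 2 * pairing (pd k φ) (D.B i) (tf ψ * (D.J k * D.B i))) := by
  have e1 : ∀ k, pairing (pd k φ) (D.J k * (D.B i * D.B i)) (tf ψ)
      = pairing φ (D.J k * (D.B i * D.B i)) (dx k ψ) := fun k =>
    pairing_pd_test hφ k ψ D.integrable D.pairable D.pairable
  obtain ⟨a, b, h⟩ := exists_cyc i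
  have e2 := D.divJ_unprimed (ψ := ψ) (g := D.B i * D.B i) hφ h D.integrable (fun x => D.pairable)
    (fun x y => D.pairable)
  have e3 := D.divJ_primed (g := tf ψ * (D.B i * D.B i)) hφ h (timeSupported_tf_mul ψ _)
    (fun x => D.pairable)
  simp only [triPairing, e1, pairing_pd_one hφ, h.sum_eq]
  linear_combination -e2 + e3

/-- The same reduction, with div b = 0 removing the terms where bₖ stands alone. -/
theorem sum_triPairing_field (hφ : IsKernel φ) (i : Fin 3) :
    ∑ k, triPairing (pd k φ) (tf ψ) (D.B k) (D.J i) (D.B i)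
      = ∑ k, (pairing φ (D.B k * (D.J i * D.B i)) (dx k ψ)
        - pairing φ (D.J i * D.B i) (D.B k * dx k ψ)
        - pairing (pd k φ) (D.B k * D.J i) (tf ψ * D.B i)
        - pairing (pd k φ) (D.B k * D.B i) (tf ψ * D.J i)
        + pairing (pd k φ) (D.J i) (tf ψ * (D.B k * D.B i))
        + pairing (pd k φ) (D.B i) (tf ψ * (D.B k * D.J i))) := by
  have e1 : ∀ k, pairing (pd k φ) (D.B k * (D.J i * D.B i)) (tf ψ)
      = pairing φ (D.B k * (D.J i * D.B i)) (dx k ψ) := fun k =>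
    pairing_pd_test hφ k ψ D.integrable D.pairable D.pairable
  obtain ⟨a, b, h⟩ := exists_cyc i
  have e2 := D.div_unprimed (ψ := ψ) (g := D.J i * D.B i) hφ h D.integrable (fun x => D.pairable)
    (fun x y => D.pairable)
  have e3 := D.div_primed (g := tf ψ * (D.J i * D.B i)) hφ h (timeSupported_tf_mul ψ _)
    (fun x => D.pairable)
  simp only [triPairing, e1, pairing_pd_one hφ, h.sum_eq]
  linear_combination -e2 + e3

theorem pairing_V_left {i k l : Fin 3} (h : Cyc i k l) {x : Fin 3} (hφ : IsKernel φ) :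
    pairing φ (D.V i) (tf ψ * D.B x)
      = pairing φ (D.J k * D.B l) (tf ψ * D.B x) - pairing φ (D.J l * D.B k) (tf ψ * D.B x) := by
  rw [D.V_eq h, D.pairing_sub_left hφ (by norm_num) (by norm_num)]

theorem pairing_V_right {i k l : Fin 3} (h : Cyc i k l) {x : Fin 3} (hφ : IsKernel φ) :
    pairing φ (D.B x) (tf ψ * D.V i)
      = pairing φ (D.B x) (tf ψ * (D.J k * D.B l)) - pairing φ (D.B x) (tf ψ * (D.J l * D.B k)) := by
  rw [D.V_eq h, mul_sub, D.pairing_sub_right hφ (by norm_num) (by norm_num)]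

theorem pairing_stress_left {i x : Fin 3} (hφ : IsKernel φ) :
    pairing φ (D.B x * D.B i) (tf ψ * D.J i)
      = pairing φ (D.stress i x) (tf ψ * D.J i)
        + if x = i then (1 / 2) * pairing φ D.E (tf ψ * D.J i) else 0 := by
  split_ifs with h
  · subst h
    rw [stress_eq_self, D.pairing_sub_left hφ (by norm_num) (by norm_num), pairing_smul_left]
    ring
  · rw [stress_eq_of_ne D h, add_zero]

theorem pairing_stress_right {i x : Fin 3} (hφ : IsKernel φ) :
    pairing φ (D.J i) (tf ψ * (D.B x * D.B i))
      = pairing φ (D.J i) (tf ψ * D.stress i x)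
        + if x = i then (1 / 2) * pairing φ (D.J i) (tf ψ * D.E) else 0 := by
  split_ifs with h
  · subst h
    rw [stress_eq_self, mul_sub, D.pairing_sub_right hφ (by norm_num) (by norm_num),
      mul_smul_comm, pairing_smul_right]
    ring
  · rw [stress_eq_of_ne D h, add_zero]

/-- The lower-order functional representing the flux. -/
def lowerFlux (φ : E3 → ℝ) : ℝ :=
  (1 / 8) * ∑ i, ∑ k, (pairing φ (D.J k * (D.B i * D.B i)) (dx k ψ)
      - pairing φ (D.B i * D.B i) (D.J k * dx k ψ))
    - (1 / 4) * ∑ i, ∑ k, (pairing φ (D.B k * (D.J i * D.B i)) (dx k ψ)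
      - pairing φ (D.J i * D.B i) (D.B k * dx k ψ))
    + (1 / 2) * ∑ i, (-pairing φ (D.B i) (D.B i * dt ψ)
      - pairing φ (D.B i) (D.V (i + 2) * dx (i + 1) ψ)
      + pairing φ (D.B i) (D.V (i + 1) * dx (i + 2) ψ))
    + (1 / 4) * ∑ i, (pairing φ (D.V i) (D.B (i + 2) * dx (i + 1) ψ)
      - pairing φ (D.V i) (D.B (i + 1) * dx (i + 2) ψ))
    + (1 / 8) * ∑ i, pairing φ D.E (D.J i * dx i ψ)
    - (1 / 4) * ∑ i, ∑ k, pairing φ (D.J i) (D.stress i k * dx k ψ)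

/-- The surviving quadratic-against-linear terms are of two kinds. The combination jₖbᵢ − bₖjᵢ
against bᵢ is the Lorentz force against b, which the induction equation handles. The tensor b⊗b
against j splits into the stress, which the stress law turns into the Lorentz force against b, and
½|b|² against j, which div j = 0 removes. -/
theorem flux_eq_lowerFlux (hφ : IsKernel φ) : D.flux ψ φ = D.lowerFlux ψ φ := by
  have c0 : Cyc 0 1 2 := ⟨rfl, rfl⟩
  have c1 := c0.rot
  have c2 := c1.rot
  have x0 := D.induction_exchange ψ hφ c0
  have x1 := D.induction_exchange ψ hφ c1
  have x2 := D.induction_exchange ψ hφ c2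
  have s0 := D.stress_current ψ hφ c0
  have s1 := D.stress_current ψ hφ c1
  have s2 := D.stress_current ψ hφ c2
  have r0 := D.current_stress ψ hφ c0
  have r1 := D.current_stress ψ hφ c1
  have r2 := D.current_stress ψ hφ c2
  have t1 := D.divJ_unprimed (ψ := ψ) (g := D.E) hφ c0 D.integrable (fun x => D.pairable)
    (fun x y => D.pairable)
  have t2 := D.divJ_primed (g := tf ψ * D.E) hφ c0 (timeSupported_tf_mul ψ _) (fun x => D.pairable)
  simp only [D.pairing_V_left ψ c0 (hφ.pd _), D.pairing_V_left ψ c1 (hφ.pd _),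
    D.pairing_V_left ψ c2 (hφ.pd _), D.pairing_V_right ψ c0 (hφ.pd _),
    D.pairing_V_right ψ c1 (hφ.pd _), D.pairing_V_right ψ c2 (hφ.pd _), Fin.sum_univ_three] at *
  unfold flux lowerFlux
  rw [Finset.sum_comm (f := fun k i => triPairing (pd k φ) (tf ψ) (D.J k) (D.B i) (D.B i)),
    Finset.sum_comm (f := fun k i => triPairing (pd k φ) (tf ψ) (D.B k) (D.J i) (D.B i))]
  simp only [D.sum_triPairing_current ψ hφ, D.sum_triPairing_field ψ hφ,
    D.pairing_stress_left ψ (hφ.pd _), D.pairing_stress_right ψ (hφ.pd _), mul_comm (D.B _) (D.J _)]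
  simp only [Fin.sum_univ_three, Fin.reduceAdd, Fin.reduceEq, if_true, if_false, zero_add]
  -- The increments and the stress law each supply the Lorentz-force terms with weight 1/4, hence
  -- 1/2 for the induction equation. The weight 1/8 is half of 1/4, from the ½ in the stress.
  linear_combination (1 / 2) * (x0 + x1 + x2) + (1 / 4) * (s0 + s1 + s2) - (1 / 4) * (r0 + r1 + r2)
    + (1 / 8) * t1 - (1 / 8) * t2

/-- The density of the anomalous dissipation tested against `ψ`. -/
def dissipationDensity (z : ST) : ℝ :=
  -(1 / 2) * (D.E z * dt ψ z)
    + ∑ k, (D.E z * D.J k z - (∑ i, D.J i z * D.B i z) * D.B k z) * dx k ψ z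

theorem hasTrace_pairing {f g : ST → ℝ} {a c a' c' : ℕ} [D.Dom f a c] [D.Dom g a' c']
    (h : a + a' ≤ 2 := by norm_num) (h' : c + c' ≤ 1 := by norm_num) :
    HasTrace (fun φ => pairing φ f g) (fun z => f z * g z) :=
  .of_pairable (D.pairable h h')

theorem hasTrace_pairing_cubic {f g : ST → ℝ} {a c a' c' : ℕ} [D.Dom f a c] [D.Dom g a' c']
    (h : a + a' ≤ 3 := by norm_num) (h' : c + c' = 0 := by norm_num) :
    HasTrace (fun φ => pairing φ f g) (fun z => f z * g z) :=
  .of_pairable (D.pairable_cubic h h')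

/-- Every term of the lower-order form has an undifferentiated kernel and a continuous correlation.
At displacement zero the correlations become integrals of products, and these add up pointwise to
the stated density. -/
theorem hasTrace_flux : HasTrace (D.flux ψ) (D.dissipationDensity ψ) := by
  have h1 := ((((((HasTrace.sum fun i : Fin 3 => HasTrace.sum fun k : Fin 3 =>
      (D.hasTrace_pairing (f := D.J k * (D.B i * D.B i)) (g := dx k ψ)).sub
        (D.hasTrace_pairing (f := D.B i * D.B i) (g := D.J k * dx k ψ))).const_mul (1 / 8)).sub
    ((HasTrace.sum fun i : Fin 3 => HasTrace.sum fun k : Fin 3 =>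
      (D.hasTrace_pairing (f := D.B k * (D.J i * D.B i)) (g := dx k ψ)).sub
        (D.hasTrace_pairing (f := D.J i * D.B i) (g := D.B k * dx k ψ))).const_mul (1 / 4))).add
    ((HasTrace.sum fun i : Fin 3 =>
      ((D.hasTrace_pairing (f := D.B i) (g := D.B i * dt ψ)).neg.sub
        (D.hasTrace_pairing (f := D.B i) (g := D.V (i + 2) * dx (i + 1) ψ))).add
        (D.hasTrace_pairing (f := D.B i) (g := D.V (i + 1) * dx (i + 2) ψ))).const_mul (1 / 2))).add
    ((HasTrace.sum fun i : Fin 3 =>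
      (D.hasTrace_pairing (f := D.V i) (g := D.B (i + 2) * dx (i + 1) ψ)).sub
        (D.hasTrace_pairing (f := D.V i) (g := D.B (i + 1) * dx (i + 2) ψ))).const_mul (1 / 4))).add
    ((HasTrace.sum fun i : Fin 3 =>
      D.hasTrace_pairing (f := D.E) (g := D.J i * dx i ψ)).const_mul (1 / 8))).sub
    ((HasTrace.sum fun i : Fin 3 => HasTrace.sum fun k : Fin 3 =>
      D.hasTrace_pairing (f := D.J i) (g := D.stress i k * dx k ψ)).const_mul (1 / 4))
  refine h1.congr (fun φ hφ => D.flux_eq_lowerFlux ψ hφ) fun z => ?_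
  simp only [dissipationDensity, Fin.sum_univ_three, Fin.reduceAdd, zero_add, stress, V, E, Pi.mul_apply,
    Pi.sub_apply, Pi.add_apply, Pi.smul_apply, smul_eq_mul, Fin.reduceEq, if_true, if_false,
    Pi.zero_apply, Matrix.cons_val]
  ring

end Config

/-! ### Spherical averages -/

instance : IsFiniteMeasure sphereMeasure :=
  inferInstanceAs (IsFiniteMeasure (volume : Measure E3).toSphere)

theorem integral_polar {F : E3 → ℝ} (hF : Integrable F) :
    ∫ l, F l = ∫ r in Ioi (0 : ℝ), r ^ 2 * ∫ θ : Metric.sphere (0 : E3) 1, F (r • (θ : E3)) ∂sphereMeasure := by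
  have hd : Module.finrank ℝ E3 - 1 = 2 := by simp
  have hmp := (volume : Measure E3).measurePreserving_homeomorphUnitSphereProd
  rw [hd] at hmp
  have hemb := (homeomorphUnitSphereProd E3).measurableEmbedding
  set F' : Metric.sphere (0 : E3) 1 × Ioi (0 : ℝ) → ℝ := fun p => F ((p.2 : ℝ) • (p.1 : E3)) with hF'
  have hcomp : ∀ x : ({0}ᶜ : Set E3), F' (homeomorphUnitSphereProd E3 x) = F x := fun x => by
    have := congrArg Subtype.val ((homeomorphUnitSphereProd E3).symm_apply_apply x)
    simp only [hF']
    conv_rhs => rw [← this]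
    rfl
  have hint : Integrable F' (sphereMeasure.prod (Measure.volumeIoiPow 2)) := by
    have h1 : Integrable (F' ∘ homeomorphUnitSphereProd E3)
        ((volume : Measure E3).comap (Subtype.val : ({0}ᶜ : Set E3) → E3)) := by
      rw [show F' ∘ homeomorphUnitSphereProd E3 = F ∘ Subtype.val from funext hcomp]
      exact (integrableOn_iff_comap_subtypeVal (measurableSet_singleton _).compl).1 hF.integrableOn
    exact (hmp.integrable_comp_emb hemb).1 h1
  calc ∫ l, F l = ∫ l in ({0}ᶜ : Set E3), F l := by
        rw [restrict_compl_singleton]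
    _ = ∫ x : ({0}ᶜ : Set E3), F x ∂(volume : Measure E3).comap Subtype.val :=
        (integral_subtype_comap (measurableSet_singleton _).compl F).symm
    _ = ∫ x : ({0}ᶜ : Set E3), F' (homeomorphUnitSphereProd E3 x)
          ∂(volume : Measure E3).comap Subtype.val := by simp only [hcomp]
    _ = ∫ p, F' p ∂sphereMeasure.prod (Measure.volumeIoiPow 2) := hmp.integral_comp hemb F'
    _ = ∫ r, ∫ θ, F' (θ, r) ∂sphereMeasure ∂Measure.volumeIoiPow 2 := integral_prod_symm _ hint
    _ = ∫ r : Ioi (0 : ℝ), (r : ℝ) ^ 2 * ∫ θ, F' (θ, r) ∂sphereMeasure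
          ∂(volume : Measure ℝ).comap Subtype.val := by
        rw [Measure.volumeIoiPow, integral_withDensity_eq_integral_toReal_smul (by fun_prop)
          (by simp)]
        refine integral_congr_ae (Eventually.of_forall fun r => ?_)
        simp only [smul_eq_mul]
        rw [ENNReal.toReal_ofReal (sq_nonneg _)]
    _ = _ := integral_subtype_comap measurableSet_Ioi fun r : ℝ =>
        r ^ 2 * ∫ θ : Metric.sphere (0 : E3) 1, F (r • (θ : E3)) ∂sphereMeasure

theorem sphereMeasure_univ : sphereMeasure.real univ = 4 * Real.pi := by
  rw [sphereMeasure, Measure.toSphere_real_apply_univ, Measure.real,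
    EuclideanSpace.volume_ball_fin_three]
  simp
  rw [ENNReal.toReal_ofReal (by positivity)]
  ring

/-- The primitive is normalised to vanish at large arguments, not at zero, so that its composition
with |ℓ|² is an admissible kernel. -/
theorem exists_primitive {g : ℝ → ℝ} (hg : ContDiff ℝ ∞ g) {R : ℝ} (hR : ∀ x, R ≤ x → g x = 0) :
    ∃ G : ℝ → ℝ, ContDiff ℝ ∞ G ∧ (∀ x, HasDerivAt G (g x) x) ∧ ∀ x, R ≤ x → G x = 0 := by
  have hd : ∀ x, HasDerivAt (fun x => -∫ u in x..R, g u) (g x) x := fun x => by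
    have h1 := (intervalIntegral.integral_hasDerivAt_left
      (hg.continuous.intervalIntegrable x R) (hg.continuous.stronglyMeasurableAtFilter _ _)
      hg.continuous.continuousAt).neg
    exact h1.congr_deriv (by ring)
  refine ⟨_, ?_, hd, fun x hx => ?_⟩
  · rw [contDiff_infty_iff_deriv]
    refine ⟨fun x => (hd x).differentiableAt, ?_⟩
    rw [show deriv (fun x => -∫ u in x..R, g u) = g from funext fun x => (hd x).deriv]
    exact hg
  · rw [intervalIntegral.integral_symm, intervalIntegral.integral_of_le hx,
      setIntegral_eq_zero_of_forall_eq_zero fun u hu => hR u hu.1.le]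
    simp

theorem isKernel_comp_normSq {G : ℝ → ℝ} (hG : ContDiff ℝ ∞ G) {R : ℝ}
    (hR : ∀ x, R ≤ x → G x = 0) : IsKernel fun l : E3 => G (‖l‖ ^ 2) := by
  refine ⟨hG.comp (contDiff_norm_sq ℝ), HasCompactSupport.intro
    (isCompact_closedBall (0 : E3) (|R| + 1)) fun l hl => hR _ ?_⟩
  rw [mem_closedBall_zero_iff, not_le] at hl
  nlinarith [le_abs_self R, abs_nonneg R]

theorem integrableOn_Ioi_of_eventually_zero {f : ℝ → ℝ} (hf : Continuous f) {R : ℝ}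
    (hR : ∀ x, R < x → f x = 0) : IntegrableOn f (Ioi 0) := by
  rw [← Ioc_union_Ioi_eq_Ioi (le_max_right R 0)]
  refine (hf.integrableOn_Ioc).union ?_
  refine integrableOn_zero.congr_fun (fun x hx => ?_) measurableSet_Ioi
  rw [hR x ((le_max_left _ _).trans_lt hx)]

section Sphere

variable {A : Fin 3 → E3 → ℝ} {h : E3 → ℝ}

theorem continuous_sphere_integral {F : ℝ × E3 → ℝ} (hF : Continuous F) :
    Continuous fun r : ℝ => ∫ θ : Metric.sphere (0 : E3) 1, F (r, θ) ∂sphereMeasure := by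
  have h1 := continuous_parametric_integral_of_continuous (μ := sphereMeasure)
    (f := fun (r : ℝ) (θ : Metric.sphere (0 : E3) 1) => F (r, θ)) (s := univ) (by fun_prop)
    isCompact_univ
  simpa using h1

/-- The outward flux of `A` through the sphere of radius `r`, normalized by the unit sphere. -/
def sphereFlux (A : Fin 3 → E3 → ℝ) (r : ℝ) : ℝ :=
  ∫ θ : Metric.sphere (0 : E3) 1, ∑ k, (θ : E3) k * A k (r • (θ : E3)) ∂sphereMeasure

def sphereSum (h : E3 → ℝ) (r : ℝ) : ℝ :=
  ∫ θ : Metric.sphere (0 : E3) 1, h (r • (θ : E3)) ∂sphereMeasure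

theorem continuous_sphereFlux (hA : ∀ k, Continuous (A k)) : Continuous (sphereFlux A) :=
  continuous_sphere_integral (F := fun p => ∑ k, p.2 k * A k (p.1 • p.2)) (by fun_prop)

theorem continuous_sphereSum (hh : Continuous h) : Continuous (sphereSum h) :=
  continuous_sphere_integral (F := fun p => h (p.1 • p.2)) (by fun_prop)

/-- The divergence theorem on a ball for a merely continuous field with −div A = h weakly. Radial
kernels G(|ℓ|²) in polar coordinates give a one-dimensional weak identity, and continuity makes it
pointwise. -/
theorem sphereFlux_identity (hA : ∀ k, Continuous (A k)) (hh : Continuous h)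
    (hAh : ∀ φ, IsKernel φ → ∑ k, ∫ l, pd k φ l * A k l = ∫ l, φ l * h l) {r : ℝ} (hr : 0 < r) :
    r ^ 2 * sphereFlux A r = -∫ ρ in 0..r, ρ ^ 2 * sphereSum h ρ := by
  set U : ℝ → ℝ := fun r => ∫ ρ in 0..r, ρ ^ 2 * sphereSum h ρ with hU
  have hs := continuous_sphereFlux hA
  have hu := continuous_sphereSum hh
  have hU' : ∀ r, HasDerivAt U (r ^ 2 * sphereSum h r) r := fun r => by
    have hc : Continuous fun ρ : ℝ => ρ ^ 2 * sphereSum h ρ := by fun_prop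
    exact intervalIntegral.integral_hasDerivAt_right (hc.intervalIntegrable _ _)
      (hc.stronglyMeasurableAtFilter _ _) hc.continuousAt
  have hUc : Continuous U := continuous_iff_continuousAt.2 fun r => (hU' r).continuousAt
  set W : ℝ → ℝ := fun x => x * sphereFlux A (√x) + U (√x) with hW
  have hWc : Continuous W := by fun_prop
  have key : ∀ g : ℝ → ℝ, ContDiff ℝ ∞ g → HasCompactSupport g → tsupport g ⊆ Ioi 0 →
      ∫ x, g x • W x = 0 := by
    intro g hg hgc hgs
    obtain ⟨R, hR⟩ := hgc.isCompact.isBounded.subset_closedBall (0 : ℝ)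
    have hgR : ∀ x, |R| + 1 ≤ x → g x = 0 := fun x hx => by
      refine image_eq_zero_of_notMem_tsupport fun h => ?_
      have h1 := mem_closedBall_zero_iff.1 (hR h)
      have h2 := le_abs_self x
      have h3 := le_abs_self R
      rw [Real.norm_eq_abs] at h1
      linarith
    obtain ⟨G, hG, hGd, hGR⟩ := exists_primitive hg hgR
    have hφ := isKernel_comp_normSq hG hGR
    have h1 := hAh _ hφ
    have hpd : ∀ k (l : E3), pd k (fun l : E3 => G (‖l‖ ^ 2)) l = 2 * g (‖l‖ ^ 2) * l k :=
      fun k l => by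
        rw [pd, fderiv_comp_normSq (fun x => (hGd x).differentiableAt), (hGd _).deriv, inner_basisVec]
    have hnorm : ∀ (r : ℝ) (θ : Metric.sphere (0 : E3) 1), ‖r • (θ : E3)‖ ^ 2 = r ^ 2 := fun r θ => by
      rw [norm_smul, mul_pow, mem_sphere_zero_iff_norm.1 θ.2]
      simp
    have hL : ∑ k, ∫ l, pd k (fun l : E3 => G (‖l‖ ^ 2)) l * A k l
        = ∫ r in Ioi (0 : ℝ), 2 * r * g (r ^ 2) * (r ^ 2 * sphereFlux A r) := by
      have hi : ∀ k, Integrable fun l => pd k (fun l : E3 => G (‖l‖ ^ 2)) l * A k l := fun k =>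
        ((hφ.pd k).smooth.continuous.mul (hA k)).integrable_of_hasCompactSupport
          (hφ.pd k).compact.mul_right
      rw [← integral_finsetSum _ fun k _ => hi k, integral_polar (integrable_finsetSum _ fun k _ => hi k)]
      congr 1
      ext r
      rw [sphereFlux, ← integral_const_mul, ← integral_const_mul, ← integral_const_mul]
      congr 1
      ext θ
      simp only [hpd, hnorm, Finset.mul_sum, PiLp.smul_apply, smul_eq_mul]
      exact Finset.sum_congr rfl fun k _ => by ring
    have hRt : ∫ l, (fun l : E3 => G (‖l‖ ^ 2)) l * h l
        = ∫ r in Ioi (0 : ℝ), r ^ 2 * sphereSum h r * G (r ^ 2) := by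
      have hi : Integrable fun l => (fun l : E3 => G (‖l‖ ^ 2)) l * h l :=
        (hφ.smooth.continuous.mul hh).integrable_of_hasCompactSupport hφ.compact.mul_right
      rw [integral_polar hi]
      congr 1
      ext r
      simp only [sphereSum, hnorm, integral_const_mul]
      ring
    have hbig : ∀ x, |R| + 1 < x → |R| + 1 ≤ x ^ 2 := fun x hx => by nlinarith [abs_nonneg R]
    -- Integration by parts moves the derivative from U to G(r²), so both sides of the weak identity
    -- contain the arbitrary function g = G'. The boundary terms vanish as U(0) = 0 and G vanishes
    -- far out.
    have hibp := integral_Ioi_mul_deriv_eq_deriv_mul (a := (0 : ℝ)) (a' := 0) (b' := 0) (u := U)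
      (v := fun r => G (r ^ 2)) (u' := fun r => r ^ 2 * sphereSum h r)
      (v' := fun r => 2 * r * g (r ^ 2)) (fun r _ => hU' r)
      (fun r _ => ((hGd (r ^ 2)).comp r (hasDerivAt_pow 2 r)).congr_deriv (by simp; ring))
      (integrableOn_Ioi_of_eventually_zero (R := |R| + 1)
        (hUc.mul (by have := hg.continuous; fun_prop)) fun x hx => by
          simp [hgR _ (hbig x hx)])
      (integrableOn_Ioi_of_eventually_zero (R := |R| + 1)
        (Continuous.mul (by fun_prop) (by have := hG.continuous; fun_prop)) fun x hx => by
          simp [hGR _ (hbig x hx)])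
      (by
        have hc : Continuous (U * fun r => G (r ^ 2)) :=
          hUc.mul (by have := hG.continuous; fun_prop)
        have h2 := hc.tendsto 0
        simp only [Pi.mul_apply, hU, intervalIntegral.integral_same, zero_mul] at h2
        exact h2.mono_left nhdsWithin_le_nhds)
      (by
        refine tendsto_const_nhds.congr' ?_
        filter_upwards [eventually_gt_atTop (|R| + 1)] with x hx
        simp [hGR _ (hbig x hx)])
    rw [hL, hRt] at h1
    have hsub := integral_comp_rpow_Ioi_of_pos (g := fun x => g x * W x) (p := 2) two_pos
    have hset : ∫ x in Ioi (0 : ℝ), g x * W x = ∫ x, g x * W x :=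
      setIntegral_eq_integral_of_forall_compl_eq_zero fun x hx => by
        rw [image_eq_zero_of_notMem_tsupport fun h => hx (hgs h), zero_mul]
    simp only [smul_eq_mul]
    rw [← hset, ← hsub]
    have hcalc : ∫ x in Ioi (0 : ℝ), (2 * x ^ ((2 : ℝ) - 1)) • (g (x ^ (2 : ℝ)) * W (x ^ (2 : ℝ)))
        = ∫ r in Ioi (0 : ℝ), (2 * r * g (r ^ 2) * (r ^ 2 * sphereFlux A r)
          + U r * (2 * r * g (r ^ 2))) := by
      refine setIntegral_congr_fun measurableSet_Ioi fun r hr => ?_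
      have e1 : r ^ ((2 : ℝ) - 1) = r := by norm_num
      have e2 : r ^ (2 : ℝ) = r ^ 2 := by norm_cast
      simp only [e1, e2, hW, Real.sqrt_sq (le_of_lt hr), smul_eq_mul]
      ring
    rw [hcalc, integral_add, h1, hibp]
    · ring
    · refine integrableOn_Ioi_of_eventually_zero (R := |R| + 1)
        (by have := hg.continuous; fun_prop) fun x hx => by simp [hgR _ (hbig x hx)]
    · refine integrableOn_Ioi_of_eventually_zero (R := |R| + 1)
        (by have := hg.continuous; fun_prop) fun x hx => by simp [hgR _ (hbig x hx)]
  have h0 := isOpen_Ioi.ae_eq_zero_of_integral_contDiff_smul_eq_zero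
    (hWc.locallyIntegrable.locallyIntegrableOn (Ioi 0)) key
  have h1 : EqOn W (fun _ => 0) (Ioi 0) :=
    Measure.eqOn_open_of_ae_eq ((ae_restrict_iff' measurableSet_Ioi).2 h0) isOpen_Ioi
      hWc.continuousOn continuousOn_const
  have h2 := h1 (show r ^ 2 ∈ Ioi (0 : ℝ) from by simp; positivity)
  simp only [hW, Real.sqrt_sq hr.le] at h2
  linarith

/-- Rescaling the ball to unit radius gives −∫₀¹ x² (∫ h(rxθ) dσ) dx, which tends to −(4π/3) h(0);
the 1/3 in ∫₀¹ x² dx is the origin of the 4/3. -/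
theorem tendsto_sphereFlux_div (hA : ∀ k, Continuous (A k)) (hh : Continuous h)
    (hAh : ∀ φ, IsKernel φ → ∑ k, ∫ l, pd k φ l * A k l = ∫ l, φ l * h l) :
    Tendsto (fun r => 1 / r * sphereFlux A r) (𝓝[>] 0) (𝓝 (-(4 * Real.pi / 3) * h 0)) := by
  have hu := continuous_sphereSum hh
  have h1 : Continuous fun r : ℝ => ∫ x in (0 : ℝ)..1, x ^ 2 * sphereSum h (r * x) :=
    intervalIntegral.continuous_parametric_intervalIntegral_of_continuous' (by fun_prop) 0 1
  have h2 := (h1.tendsto 0).neg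
  have h3 : sphereSum h 0 = 4 * Real.pi * h 0 := by
    simp [sphereSum, sphereMeasure_univ]
  simp only [zero_mul, intervalIntegral.integral_mul_const, integral_pow, h3] at h2
  have h4 : -((1 ^ (2 + 1) - 0 ^ (2 + 1) : ℝ) / ((2 : ℕ) + 1) * (4 * Real.pi * h 0))
      = -(4 * Real.pi / 3) * h 0 := by norm_num; ring
  rw [h4] at h2
  refine (h2.mono_left nhdsWithin_le_nhds).congr' ?_
  filter_upwards [self_mem_nhdsWithin] with r hr
  have hr' : 0 < r := hr
  have h5 := sphereFlux_identity hA hh hAh hr'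
  have h6 := intervalIntegral.integral_comp_mul_left (a := 0) (b := 1)
    (fun ρ => ρ ^ 2 * sphereSum h ρ) hr'.ne'
  simp only [mul_zero, mul_one, mul_pow, mul_assoc, intervalIntegral.integral_const_mul,
    smul_eq_mul] at h6
  have h7 : ∫ ρ in 0..r, ρ ^ 2 * sphereSum h ρ
      = r ^ 3 * ∫ x in (0 : ℝ)..1, x ^ 2 * sphereSum h (r * x) := by
    rw [eq_inv_mul_iff_mul_eq₀ hr'.ne'] at h6
    rw [← h6]; ring
  rw [h7] at h5
  have h8 : sphereFlux A r = -(r * ∫ x in (0 : ℝ)..1, x ^ 2 * sphereSum h (r * x)) := by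
    have : r ^ 2 ≠ 0 := by positivity
    apply mul_left_cancel₀ this
    rw [h5]; ring
  rw [h8, one_div, mul_neg, inv_mul_cancel_left₀ hr'.ne']

end Sphere

/-! ### Third-order increments -/

theorem spaceTime_eq (T : ℝ) :
    spaceTime T = (volume : Measure ST).restrict (Ioo 0 T ×ˢ univ) := by
  rw [spaceTime, show (volume : Measure ST) = (volume : Measure ℝ).prod volume from rfl,
    ← Measure.prod_restrict, Measure.restrict_univ]

theorem measurableSet_slab (T : ℝ) : MeasurableSet (Ioo 0 T ×ˢ univ : Set ST) :=
  measurableSet_Ioo.prod MeasurableSet.univ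

/-- The product of increments `δu δv δw` at the point `z` for the displacement `h`. -/
def triInc (u v w : ST → ℝ) (h z : ST) : ℝ :=
  (u (z + h) - u z) * ((v (z + h) - v z) * (w (z + h) - w z))

/-- `∫ ψ δu δv δw`, expanded into two-point correlations. -/
def triCorr (ψ u v w : ST → ℝ) (h : ST) : ℝ :=
  corr (u * (v * w)) ψ h - corr (u * v) (ψ * w) h - corr (u * w) (ψ * v) h
    - corr (v * w) (ψ * u) h + corr u (ψ * (v * w)) h + corr v (ψ * (u * w)) h
    + corr w (ψ * (u * v)) h - corr 1 (ψ * (u * (v * w))) h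

/-- All the pairs of factors occurring in `∫ ψ δu δv δw` are pairable. -/
structure TriPairable (ψ u v w : ST → ℝ) : Prop where
  left_uvw : Pairable (u * (v * w)) ψ
  left_uv : Pairable (u * v) (ψ * w)
  left_uw : Pairable (u * w) (ψ * v)
  left_vw : Pairable (v * w) (ψ * u)
  left_u : Pairable u (ψ * (v * w))
  left_v : Pairable v (ψ * (u * w))
  left_w : Pairable w (ψ * (u * v))
  left_one : Pairable 1 (ψ * (u * (v * w)))

namespace TriPairable

variable {ψ u v w : ST → ℝ}

theorem continuous_triCorr (P : TriPairable ψ u v w) : Continuous (triCorr ψ u v w) :=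
  ((((((P.left_uvw.continuous_corr.sub P.left_uv.continuous_corr).sub P.left_uw.continuous_corr).sub
    P.left_vw.continuous_corr).add P.left_u.continuous_corr).add P.left_v.continuous_corr).add
    P.left_w.continuous_corr).sub P.left_one.continuous_corr

theorem triPairing_eq (P : TriPairable ψ u v w) {φ : E3 → ℝ} (hφ : IsKernel φ) :
    triPairing φ ψ u v w = ∫ l, φ l * triCorr ψ u v w (sp l) := by
  have i1 := hφ.integrable_mul_corr P.left_uvw
  have i2 := hφ.integrable_mul_corr P.left_uv
  have i3 := hφ.integrable_mul_corr P.left_uw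
  have i4 := hφ.integrable_mul_corr P.left_vw
  have i5 := hφ.integrable_mul_corr P.left_u
  have i6 := hφ.integrable_mul_corr P.left_v
  have i7 := hφ.integrable_mul_corr P.left_w
  have i8 := hφ.integrable_mul_corr P.left_one
  simp only [triPairing, pairing, triCorr, mul_sub, mul_add]
  rw [integral_sub (by fun_prop) i8, integral_add (by fun_prop) i7, integral_add (by fun_prop) i6,
    integral_add (by fun_prop) i5, integral_sub (by fun_prop) i4, integral_sub (by fun_prop) i3,
    integral_sub i1 i2]

theorem integral_triInc (P : TriPairable ψ u v w) (h : ST) : ∫ z, triInc u v w h z * ψ z = triCorr ψ u v w h := by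
  have i1 := P.left_uvw.integrable_mul h
  have i2 := P.left_uv.integrable_mul h
  have i3 := P.left_uw.integrable_mul h
  have i4 := P.left_vw.integrable_mul h
  have i5 := P.left_u.integrable_mul h
  have i6 := P.left_v.integrable_mul h
  have i7 := P.left_w.integrable_mul h
  have i8 := P.left_one.integrable_mul h
  simp only [triCorr, corr]
  rw [← integral_sub i1 i2, ← integral_sub (by fun_prop) i3, ← integral_sub (by fun_prop) i4,
    ← integral_add (by fun_prop) i5, ← integral_add (by fun_prop) i6, ← integral_add (by fun_prop) i7,
    ← integral_sub (by fun_prop) i8]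
  refine integral_congr_ae (Eventually.of_forall fun z => ?_)
  simp only [triInc, Pi.mul_apply, Pi.one_apply]
  ring

theorem integrable_triInc (P : TriPairable ψ u v w) {H : Type*} [MeasurableSpace H] {ν : Measure H} [SFinite ν] {π : H → ST}
    (hπ : Measurable π) {ρ : H → ℝ} (hρ : Integrable ρ ν) :
    Integrable (fun y : ST × H => ρ y.2 * (triInc u v w (π y.2) y.1 * ψ y.1))
      ((volume : Measure ST).prod ν) := by
  have i1 := P.left_uvw.integrable_prod hπ hρ
  have i2 := P.left_uv.integrable_prod hπ hρ
  have i3 := P.left_uw.integrable_prod hπ hρ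
  have i4 := P.left_vw.integrable_prod hπ hρ
  have i5 := P.left_u.integrable_prod hπ hρ
  have i6 := P.left_v.integrable_prod hπ hρ
  have i7 := P.left_w.integrable_prod hπ hρ
  have i8 := P.left_one.integrable_prod hπ hρ
  refine (((((((i1.sub i2).sub i3).sub i4).add i5).add i6).add i7).sub i8).congr
    (Eventually.of_forall fun y => ?_)
  simp only [triInc, Pi.mul_apply, Pi.one_apply, Pi.sub_apply, Pi.add_apply]
  ring

end TriPairable

theorem inner_eq_sum (v w : E3) : ⟪v, w⟫ = ∑ k, v k * w k := by
  simp [PiLp.inner_apply, mul_comm]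

theorem gradient_apply (f : E3 → ℝ) (l : E3) (k : Fin 3) : gradient f l k = pd k f l := by
  rw [← inner_basisVec, gradient, InnerProductSpace.toDual_symm_apply, pd]

/-- The fields `F` on space-time agree with the components of `f` on `(0,T) × 𝕋³`. -/
def Agrees (T : ℝ) (f : ℝ → T3 → E3) (F : Fin 3 → ST → ℝ) : Prop :=
  ∀ t ∈ Ioo 0 T, ∀ x k, f t x k = F k (t, x)

section Cubic

variable {T : ℝ} {f g h : ℝ → T3 → E3} {F G H : Fin 3 → ST → ℝ}

theorem cubic_eq (hf : Agrees T f F) (hg : Agrees T g G) (hh : Agrees T h H) {z : ST}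
    (hz : z.1 ∈ Ioo 0 T) (v l : E3) : cubic (f z.1) (g z.1) (h z.1) v l z.2
      = ∑ k, ∑ i, v k * triInc (F k) (G i) (H i) (sp l) z := by
  obtain ⟨t, x⟩ := z
  have hs : ∀ l : E3, (t, x) + sp l = (t, x + proj l) := fun l => by simp [sp]
  simp only [cubic, inner_eq_sum, incr, PiLp.sub_apply, hf t hz, hg t hz, hh t hz, triInc,
    hs, Finset.sum_mul, Finset.mul_sum]
  rw [Finset.sum_comm]
  exact Finset.sum_congr rfl fun k _ => Finset.sum_congr rfl fun i _ => by ring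

variable {K : Type*} [MeasurableSpace K] {ν : Measure K} [SFinite ν] {p V : K → E3}

/-- The indicator of the slab serves as weight in place of a test function, which gives absolute
integrability over all of (0,T). -/
theorem integrable_cubic (hf : Agrees T f F) (hg : Agrees T g G) (hh : Agrees T h H)
    (P : ∀ k i, TriPairable (slab T) (F k) (G i) (H i)) (hp : Measurable p)
    (hV : ∀ k, Integrable (fun y => V y k) ν) :
    Integrable (fun z : ST × K => cubic (f z.1.1) (g z.1.1) (h z.1.1) (V z.2) (p z.2) z.1.2)
      ((spaceTime T).prod ν) := by
  have h1 : Integrable (fun z : ST × K => ∑ k, ∑ i,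
      V z.2 k * (triInc (F k) (G i) (H i) (sp (p z.2)) z.1 * slab T z.1))
      ((volume : Measure ST).prod ν) :=
    integrable_finsetSum _ fun k _ => integrable_finsetSum _ fun i _ =>
      (P k i).integrable_triInc (continuous_sp.measurable.comp hp) (hV k)
  have h2 : (spaceTime T).prod ν = ((volume : Measure ST).prod ν).restrict
      ((Ioo 0 T ×ˢ univ) ×ˢ univ) := by
    rw [spaceTime_eq, ← Measure.prod_restrict, Measure.restrict_univ]
  rw [h2]
  refine (h1.restrict (s := (Ioo 0 T ×ˢ univ) ×ˢ univ)).congr ?_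
  rw [Filter.EventuallyEq, ae_restrict_iff' ((measurableSet_slab T).prod MeasurableSet.univ)]
  refine Eventually.of_forall fun z hz => ?_
  rw [cubic_eq hf hg hh hz.1.1]
  simp [Config.slab_of_mem hz.1.1]

theorem integral_cubic (hf : Agrees T f F) (hg : Agrees T g G) (hh : Agrees T h H)
    (ψ : testSpace T ℝ) (P : ∀ k i, TriPairable (tf ψ) (F k) (G i) (H i)) (hp : Measurable p)
    (hV : ∀ k, Integrable (fun y => V y k) ν) :
    ∫ z : ST, (∫ y, cubic (f z.1) (g z.1) (h z.1) (V y) (p y) z.2 ∂ν) * tf ψ z ∂spaceTime T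
      = ∑ k, ∑ i, ∫ y, V y k * triCorr (tf ψ) (F k) (G i) (H i) (sp (p y)) ∂ν := by
  have hm : Measurable fun y => sp (p y) := continuous_sp.measurable.comp hp
  have hi : ∀ k i, Integrable (fun z : ST × K =>
      V z.2 k * (triInc (F k) (G i) (H i) (sp (p z.2)) z.1 * tf ψ z.1))
      ((volume : Measure ST).prod ν) := fun k i => (P k i).integrable_triInc hm (hV k)
  obtain ⟨K, -, hKT, hK⟩ := exists_compact_support ψ
  have e1 : ∀ z : ST, z ∈ Ioo 0 T ×ˢ (univ : Set T3) →
      (∫ y, cubic (f z.1) (g z.1) (h z.1) (V y) (p y) z.2 ∂ν) * tf ψ z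
        = ∫ y, ∑ k, ∑ i, V y k * (triInc (F k) (G i) (H i) (sp (p y)) z * tf ψ z) ∂ν := by
    intro z hz
    rw [← integral_mul_const]
    refine integral_congr_ae (Eventually.of_forall fun y => ?_)
    simp only [cubic_eq hf hg hh hz.1, Finset.sum_mul, mul_assoc]
  rw [spaceTime_eq, setIntegral_congr_fun (measurableSet_slab T) e1,
    setIntegral_eq_integral_of_forall_compl_eq_zero fun z hz => by
      have : tf ψ z = 0 := (hK z fun h => hz ⟨hKT h, mem_univ _⟩).1
      simp [this],
    integral_integral_swap (f := fun z y => ∑ k, ∑ i,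
      V y k * (triInc (F k) (G i) (H i) (sp (p y)) z * tf ψ z))
      (integrable_finsetSum _ fun k _ => integrable_finsetSum _ fun i _ => hi k i)]
  have e2 : ∀ k i, Integrable (fun y => V y k * triCorr (tf ψ) (F k) (G i) (H i) (sp (p y))) ν := by
    intro k i
    refine (hi k i).integral_prod_right.congr (Eventually.of_forall fun y => ?_)
    simp only [integral_const_mul, (P k i).integral_triInc]
  rw [← Finset.sum_congr rfl fun k _ => integral_finsetSum _ fun i _ => e2 k i,
    ← integral_finsetSum _ fun k _ => integrable_finsetSum _ fun i _ => e2 k i]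
  have e3 : ∀ᵐ y ∂ν, ∀ k i, Integrable fun z =>
      V y k * (triInc (F k) (G i) (H i) (sp (p y)) z * tf ψ z) :=
    ae_all_iff.2 fun k => ae_all_iff.2 fun i => (hi k i).prod_left_ae
  refine integral_congr_ae ?_
  filter_upwards [e3] with y hy
  rw [integral_finsetSum _ fun k _ => integrable_finsetSum _ fun i _ => hy k i]
  refine Finset.sum_congr rfl fun k _ => ?_
  rw [integral_finsetSum _ fun i _ => hy k i]
  exact Finset.sum_congr rfl fun i _ => by rw [integral_const_mul, (P k i).integral_triInc]

theorem integrable_integral_cubic_mul (hf : Agrees T f F) (hg : Agrees T g G) (hh : Agrees T h H)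
    (ψ : testSpace T ℝ) (P : ∀ k i, TriPairable (slab T) (F k) (G i) (H i)) (hp : Measurable p)
    (hV : ∀ k, Integrable (fun y => V y k) ν) :
    Integrable (fun z : ST => (∫ y, cubic (f z.1) (g z.1) (h z.1) (V y) (p y) z.2 ∂ν) * tf ψ z)
      (spaceTime T) := by
  obtain ⟨C, hC⟩ := exists_bound_tf ψ
  exact (integrable_cubic hf hg hh P hp hV).integral_prod_left.mul_bdd (c := C)
    (continuous_tf ψ).aestronglyMeasurable (Eventually.of_forall hC)

end Cubic

/-! ### The dissipation term and the structure functions as functionals of one flux -/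

namespace Config

variable {T : ℝ} (D : Config T)

instance : D.Dom (slab T) 0 0 := ⟨(integrable_slab T).1, 1, fun z => by simp [monom]⟩

theorem triPairable_current (ψ : ST → ℝ) [D.Dom ψ 0 0] (k i : Fin 3) :
    TriPairable ψ (D.J k) (D.B i) (D.B i) :=
  ⟨D.pairable, D.pairable, D.pairable, D.pairable, D.pairable, D.pairable, D.pairable,
    D.pairable_one⟩

theorem triPairable_field (ψ : ST → ℝ) [D.Dom ψ 0 0] (k i : Fin 3) :
    TriPairable ψ (D.B k) (D.J i) (D.B i) :=
  ⟨D.pairable, D.pairable, D.pairable, D.pairable, D.pairable, D.pairable, D.pairable,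
    D.pairable_one⟩

/-- The density of the flux as a function of the displacement. -/
def fluxCorr (ψ : testSpace T ℝ) (k : Fin 3) (h : ST) : ℝ :=
  (1 / 8) * ∑ i, triCorr (tf ψ) (D.J k) (D.B i) (D.B i) h
    - (1 / 4) * ∑ i, triCorr (tf ψ) (D.B k) (D.J i) (D.B i) h

theorem continuous_fluxCorr (ψ : testSpace T ℝ) (k : Fin 3) : Continuous (D.fluxCorr ψ k) :=
  (continuous_const.mul (continuous_finsetSum _ fun i _ =>
    (D.triPairable_current (tf ψ) k i).continuous_triCorr)).sub
  (continuous_const.mul (continuous_finsetSum _ fun i _ =>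
    (D.triPairable_field (tf ψ) k i).continuous_triCorr))

theorem flux_eq_integral (ψ : testSpace T ℝ) {φ : E3 → ℝ} (hφ : IsKernel φ) :
    D.flux ψ φ = ∑ k, ∫ l, pd k φ l * D.fluxCorr ψ k (sp l) := by
  have i1 : ∀ k i, Integrable fun l => pd k φ l * triCorr (tf ψ) (D.J k) (D.B i) (D.B i) (sp l) :=
    fun k i => ((hφ.pd k).smooth.continuous.mul
      ((D.triPairable_current (tf ψ) k i).continuous_triCorr.comp continuous_sp)).integrable_of_hasCompactSupport
        (hφ.pd k).compact.mul_right
  have i2 : ∀ k i, Integrable fun l => pd k φ l * triCorr (tf ψ) (D.B k) (D.J i) (D.B i) (sp l) :=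
    fun k i => ((hφ.pd k).smooth.continuous.mul
      ((D.triPairable_field (tf ψ) k i).continuous_triCorr.comp continuous_sp)).integrable_of_hasCompactSupport
        (hφ.pd k).compact.mul_right
  have e1 := fun k i => (D.triPairable_current (tf ψ) k i).triPairing_eq (hφ.pd k)
  have e2 := fun k i => (D.triPairable_field (tf ψ) k i).triPairing_eq (hφ.pd k)
  simp only [flux, e1, e2, Finset.mul_sum, ← Finset.sum_sub_distrib]
  refine Finset.sum_congr rfl fun k _ => ?_
  simp only [fluxCorr, mul_sub, Finset.mul_sum, mul_left_comm (pd k φ _)]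
  rw [integral_sub (integrable_finsetSum _ fun i _ => (i1 k i).const_mul _)
    (integrable_finsetSum _ fun i _ => (i2 k i).const_mul _),
    integral_finsetSum _ fun i _ => (i1 k i).const_mul _,
    integral_finsetSum _ fun i _ => (i2 k i).const_mul _, ← Finset.sum_sub_distrib]
  simp only [integral_const_mul]

section Fields

variable {b j : ℝ → T3 → E3}

theorem pair_dissipation (hb : Agrees T b D.B) (hj : Agrees T j D.J) (ψ : testSpace T ℝ)
    {φ : E3 → ℝ} (hφ : IsKernel φ) {ε : ℝ} (hε : 0 < ε) :
    EMHD.pair (dissipation φ b j ε) ψ = D.flux ψ (rescale φ ε) := by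
  have hk := isKernel_rescale hφ hε
  have hV : ∀ k, Integrable fun l => gradient (rescale φ ε) l k := fun k => by
    simp only [gradient_apply]
    exact (hk.pd k).smooth.continuous.integrable_of_hasCompactSupport (hk.pd k).compact
  have i1 := integrable_integral_cubic_mul (p := fun l : E3 => l) hj hb hb ψ
    (D.triPairable_current (slab T)) measurable_id hV
  have i2 := integrable_integral_cubic_mul (p := fun l : E3 => l) hb hj hb ψ
    (D.triPairable_field (slab T)) measurable_id hV
  have e1 := integral_cubic (p := fun l : E3 => l) hj hb hb ψ
    (D.triPairable_current (tf ψ)) measurable_id hV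
  have e2 := integral_cubic (p := fun l : E3 => l) hb hj hb ψ
    (D.triPairable_field (tf ψ)) measurable_id hV
  have e3 : EMHD.pair (dissipation φ b j ε) ψ = ∫ z : ST,
      ((1 / 8) * ((∫ l, cubic (j z.1) (b z.1) (b z.1) (gradient (rescale φ ε) l) l z.2) * tf ψ z)
        - (1 / 4) * ((∫ l, cubic (b z.1) (j z.1) (b z.1) (gradient (rescale φ ε) l) l z.2) * tf ψ z))
      ∂spaceTime T := by
    refine integral_congr_ae (Eventually.of_forall fun z => ?_)
    simp only [dissipation, transfer, tf]
    ring
  have f1 := fun k i => (D.triPairable_current (tf ψ) k i).triPairing_eq (hk.pd k)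
  have f2 := fun k i => (D.triPairable_field (tf ψ) k i).triPairing_eq (hk.pd k)
  rw [e3, integral_sub (i1.const_mul _) (i2.const_mul _), integral_const_mul, integral_const_mul,
    e1, e2]
  simp only [flux, f1, f2, gradient_apply]

theorem integrable_sphere_coord (k : Fin 3) :
    Integrable (fun θ : Metric.sphere (0 : E3) 1 => (θ : E3) k) sphereMeasure := by
  have hc : Continuous fun θ : Metric.sphere (0 : E3) 1 => (θ : E3) k := by fun_prop
  exact (integrable_const (1 : ℝ)).mono' hc.aestronglyMeasurable
    (Eventually.of_forall fun θ =>
      (PiLp.norm_apply_le (θ : E3) k).trans (mem_sphere_zero_iff_norm.1 θ.2).le)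

/-- The coefficients (−½, 1) are −4 times the coefficients (1/8, −1/4) of the dissipation term, so
the same vector field governs both, up to the normalisation by the sphere's area. -/
theorem pair_structureFn (hb : Agrees T b D.B) (hj : Agrees T j D.J) (ψ : testSpace T ℝ)
    (lam : ℝ) :
    EMHD.pair (fun t x => -(1 / 2) * structureFn j b b lam t x + structureFn b j b lam t x) ψ
      = -(4 / (4 * Real.pi)) * (1 / lam * sphereFlux (fun k l => D.fluxCorr ψ k (sp l)) lam) := by
  set p : Metric.sphere (0 : E3) 1 → E3 := fun θ => lam • (θ : E3) with hp
  have hpm : Measurable p := by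
    have : Continuous p := by fun_prop
    exact this.measurable
  have i1 := integrable_integral_cubic_mul (p := p) hj hb hb ψ
    (D.triPairable_current (slab T)) hpm integrable_sphere_coord
  have i2 := integrable_integral_cubic_mul (p := p) hb hj hb ψ
    (D.triPairable_field (slab T)) hpm integrable_sphere_coord
  have e1 := integral_cubic (p := p) hj hb hb ψ
    (D.triPairable_current (tf ψ)) hpm integrable_sphere_coord
  have e2 := integral_cubic (p := p) hb hj hb ψ
    (D.triPairable_field (tf ψ)) hpm integrable_sphere_coord
  set c : ℝ := 1 / lam * (4 * Real.pi)⁻¹ with hc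
  have e3 : EMHD.pair (fun t x => -(1 / 2) * structureFn j b b lam t x
      + structureFn b j b lam t x) ψ = ∫ z : ST, (-(1 / 2) * c *
        ((∫ θ : Metric.sphere (0 : E3) 1, cubic (j z.1) (b z.1) (b z.1) (θ : E3) (p θ) z.2
          ∂sphereMeasure) * tf ψ z) + c * ((∫ θ : Metric.sphere (0 : E3) 1,
          cubic (b z.1) (j z.1) (b z.1) (θ : E3) (p θ) z.2 ∂sphereMeasure) * tf ψ z))
      ∂spaceTime T := by
    refine integral_congr_ae (Eventually.of_forall fun z => ?_)
    simp only [structureFn, tf, integral_div, hp, hc]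
    ring
  rw [e3, integral_add (i1.const_mul _) (i2.const_mul _), integral_const_mul, integral_const_mul,
    e1, e2]
  have j1 : ∀ k i, Integrable (fun θ : Metric.sphere (0 : E3) 1 =>
      (θ : E3) k * triCorr (tf ψ) (D.J k) (D.B i) (D.B i) (sp (p θ))) sphereMeasure := fun k i => by
    have h1 : Continuous fun θ : Metric.sphere (0 : E3) 1 =>
        (θ : E3) k * triCorr (tf ψ) (D.J k) (D.B i) (D.B i) (sp (p θ)) :=
      Continuous.mul (by fun_prop) ((D.triPairable_current (tf ψ) k i).continuous_triCorr.comp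
        (continuous_sp.comp (by fun_prop)))
    exact h1.integrable_of_hasCompactSupport (HasCompactSupport.of_compactSpace _)
  have j2 : ∀ k i, Integrable (fun θ : Metric.sphere (0 : E3) 1 =>
      (θ : E3) k * triCorr (tf ψ) (D.B k) (D.J i) (D.B i) (sp (p θ))) sphereMeasure := fun k i => by
    have h1 : Continuous fun θ : Metric.sphere (0 : E3) 1 =>
        (θ : E3) k * triCorr (tf ψ) (D.B k) (D.J i) (D.B i) (sp (p θ)) :=
      Continuous.mul (by fun_prop) ((D.triPairable_field (tf ψ) k i).continuous_triCorr.comp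
        (continuous_sp.comp (by fun_prop)))
    exact h1.integrable_of_hasCompactSupport (HasCompactSupport.of_compactSpace _)
  have e4 : sphereFlux (fun k l => D.fluxCorr ψ k (sp l)) lam
      = (1 / 8) * ∑ k, ∑ i, ∫ θ : Metric.sphere (0 : E3) 1,
          (θ : E3) k * triCorr (tf ψ) (D.J k) (D.B i) (D.B i) (sp (p θ)) ∂sphereMeasure
        - (1 / 4) * ∑ k, ∑ i, ∫ θ : Metric.sphere (0 : E3) 1,
          (θ : E3) k * triCorr (tf ψ) (D.B k) (D.J i) (D.B i) (sp (p θ)) ∂sphereMeasure := by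
    simp only [sphereFlux, fluxCorr, mul_sub, Finset.mul_sum, ← Finset.sum_sub_distrib]
    rw [integral_finsetSum _ fun k _ => integrable_finsetSum _ fun i _ => by
      simp only [mul_left_comm]
      exact ((j1 k i).const_mul _).sub ((j2 k i).const_mul _)]
    refine Finset.sum_congr rfl fun k _ => ?_
    rw [integral_finsetSum _ fun i _ => by
      simp only [mul_left_comm]
      exact ((j1 k i).const_mul _).sub ((j2 k i).const_mul _)]
    refine Finset.sum_congr rfl fun i _ => ?_
    simp only [mul_left_comm _ (1 / 8 : ℝ), mul_left_comm _ (1 / 4 : ℝ)]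
    rw [integral_sub ((j1 k i).const_mul _) ((j2 k i).const_mul _), integral_const_mul,
      integral_const_mul]
  rw [e4]
  simp only [hc]
  have := Real.pi_pos
  field_simp
  ring

theorem tendsto_pair_dissipation (hb : Agrees T b D.B) (hj : Agrees T j D.J) (ψ : testSpace T ℝ)
    {φ : E3 → ℝ} (hφ : IsMollifier φ) :
    Tendsto (fun ε => EMHD.pair (dissipation φ b j ε) ψ) (𝓝[>] 0)
      (𝓝 (∫ z, D.dissipationDensity ψ z)) := by
  refine ((D.hasTrace_flux ψ).tendsto hφ).congr' ?_
  filter_upwards [self_mem_nhdsWithin] with ε hε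
  exact (D.pair_dissipation hb hj ψ hφ.isKernel hε).symm

theorem tendsto_pair_structureFn (hb : Agrees T b D.B) (hj : Agrees T j D.J) (ψ : testSpace T ℝ) :
    Tendsto (fun lam => EMHD.pair (fun t x =>
      -(1 / 2) * structureFn j b b lam t x + structureFn b j b lam t x) ψ) (𝓝[>] 0)
      (𝓝 (4 / 3 * ∫ z, D.dissipationDensity ψ z)) := by
  obtain ⟨H, h1, -, h3⟩ := D.hasTrace_flux ψ
  have h4 := tendsto_sphereFlux_div (A := fun k l => D.fluxCorr ψ k (sp l)) (h := fun l => H (sp l))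
    (fun k => (D.continuous_fluxCorr ψ k).comp continuous_sp) (h1.continuous.comp continuous_sp)
    (fun φ hφ => by rw [← D.flux_eq_integral ψ hφ, h1.eq φ hφ])
  have h5 := h4.const_mul (-(4 / (4 * Real.pi)))
  rw [sp_zero, h3] at h5
  simp only [D.pair_structureFn hb hj ψ]
  -- The constants combine as −(4/4π)·(−4π/3) = 4/3.
  convert h5 using 2
  have := Real.pi_pos
  field_simp

end Fields

end Config

/-! ### The product of `div (b ⊗ b)` with `b` -/

theorem pderiv_mollify {φ : E3 → ℝ} {f : T3 → ℝ} (hφ : IsKernel φ) {ε : ℝ} (hε : 0 < ε)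
    (hf : Integrable f) (k : Fin 3) (x : T3) :
    pderiv k (mollify φ ε f) x = ∫ l, pd k (rescale φ ε) l * f (x - proj l) := by
  obtain ⟨y, rfl⟩ := proj_surjective x
  have hk := isKernel_rescale hφ hε
  have hs : ∀ y l : E3, proj y - proj l = proj (y - l) := fun y l => by
    simp only [sub_eq_add_neg, proj_add, proj_neg]
  have hG := locallyIntegrable_comp_proj hf
  have h1 := (contDiff_integral_mul_sub hk.smooth hk.compact hG).differentiable (by simp) y
  have h2 : HasDerivAt (fun s : ℝ => y + s • basisVec k) (basisVec k) 0 := by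
    simpa using ((hasDerivAt_id (0 : ℝ)).smul_const (basisVec k)).const_add y
  have h3 : HasFDerivAt (fun w => ∫ l, rescale φ ε l * f (proj (w - l)))
      (fderiv ℝ (fun w => ∫ l, rescale φ ε l * f (proj (w - l))) y)
      (y + (0 : ℝ) • basisVec k) := by simpa using h1.hasFDerivAt
  have h4 := (h3.comp_hasDerivAt (0 : ℝ) h2).deriv
  rw [fderiv_integral_mul_sub hk.smooth hk.compact hG] at h4
  simp only [hs]
  rw [pderiv, ← show _ = ∫ l, pd k (rescale φ ε) l * f (proj (y - l)) from h4]
  congr 1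

theorem isMollifier_comp_neg {φ : E3 → ℝ} (hφ : IsMollifier φ) : IsMollifier fun l => φ (-l) :=
  ⟨hφ.smooth.comp contDiff_neg, hφ.compact.comp_homeomorph (Homeomorph.neg E3),
    fun x => hφ.nonneg _, by rw [integral_neg_eq_self fun x => φ x, hφ.integral_eq_one]⟩

theorem pd_comp_neg {φ : E3 → ℝ} (k : Fin 3) (l : E3) :
    pd k (fun l => φ (-l)) l = -pd k φ (-l) := by
  have h := (ContinuousLinearEquiv.neg ℝ (M := E3)).comp_right_fderiv (f := φ) (x := l)
  have h' : fderiv ℝ (fun l => φ (-l)) l = _ := h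
  rw [pd, h']
  simp [pd]

theorem rescale_comp_neg (φ : E3 → ℝ) (ε : ℝ) :
    rescale (fun l => φ (-l)) ε = fun l => rescale φ ε (-l) := by
  ext l
  simp [rescale]

/-- Mollification evaluates at x − ℓ while correlations use x + ℓ; passing between them reflects the
kernel and flips the sign of its derivative. -/
theorem integral_pd_mul_corr_neg (φ : E3 → ℝ) (k : Fin 3) (f g : ST → ℝ) :
    ∫ l, pd k φ l * corr f g (sp (-l)) = -pairing (pd k fun l => φ (-l)) f g := by
  rw [pairing, ← integral_neg, ← integral_neg_eq_self]
  simp [pd_comp_neg]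

/-- The components of a vector-valued test function. -/
def component {T : ℝ} (i : Fin 3) (χ : testSpace T E3) : testSpace T ℝ :=
  ⟨fun t x => (χ : ℝ → T3 → E3) t x i, by
    obtain ⟨h, K, hK, hKT, h0⟩ := χ.2
    exact ⟨contDiff_euclidean.1 h i, K, hK, hKT, fun t ht x => by simp [h0 t ht x]⟩⟩

theorem inner_cross (u v w : E3) :
    ⟪cross u v, w⟫ = ∑ i, u i * (v (i + 1) * w (i + 2) - v (i + 2) * w (i + 1)) := by
  simp [inner_eq_sum, cross, crossProduct, Fin.sum_univ_three]
  ring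

namespace Config

variable {T : ℝ} (D : Config T) (χ : testSpace T E3)

/-- The cross product `b × χ` of the field with a test function. -/
def testCross (i : Fin 3) : ST → ℝ :=
  D.B (i + 1) * tf (component (i + 2) χ) - D.B (i + 2) * tf (component (i + 1) χ)

instance (i : Fin 3) : D.Dom (D.testCross χ i) 1 0 :=
  inferInstanceAs (D.Dom (D.B (i + 1) * tf (component (i + 2) χ)
    - D.B (i + 2) * tf (component (i + 1) χ)) _ _)

theorem timeSupported_testCross (i : Fin 3) : TimeSupported T (D.testCross χ i) := by
  obtain ⟨K, hK, hKT, h0⟩ := χ.2.2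
  refine ⟨K, hK, hKT, fun z hz => ?_⟩
  simp [testCross, tf, component, h0 z.1 hz z.2]

variable {b : ℝ → T3 → E3}

theorem vpair_mollifiedDiv (hb : Agrees T b D.B) {φ : E3 → ℝ} (hφ : IsKernel φ) {ε : ℝ}
    (hε : 0 < ε) :
    vpair (fun t x => cross (mollifiedDiv φ ε (b t) x) (b t x)) χ
      = -∑ i, ∑ k, pairing (pd k (rescale (fun l => φ (-l)) ε)) (D.B k * D.B i)
          (D.testCross χ i) := by
  have hk := isKernel_rescale hφ hε
  have P : ∀ k i, Pairable (D.B k * D.B i) (D.testCross χ i) := fun k i => D.pairable_cubic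
  have hm : Measurable fun l : E3 => sp (-l) := (continuous_sp.comp continuous_neg).measurable
  have hw : ∀ k, Integrable (pd k (rescale φ ε)) := fun k =>
    (hk.pd k).smooth.continuous.integrable_of_hasCompactSupport (hk.pd k).compact
  have ii := fun k i => ((P k i).integrable_prod hm (hw k)).integral_prod_left
  -- The mollified divergence is formed at fixed time, so b⊗b must be integrable on almost every
  -- slice.
  have h0 : ∀ᵐ t : ℝ, ∀ k i, Integrable fun x => (D.B k * D.B i) (t, x) :=
    ae_all_iff.2 fun k => ae_all_iff.2 fun i =>
      Integrable.prod_right_ae (D.integrable (f := D.B k * D.B i))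
  have h0' : ∀ᵐ z : ST, ∀ k i, Integrable fun x => (D.B k * D.B i) (z.1, x) :=
    Measure.quasiMeasurePreserving_fst.ae h0
  have h1 : vpair (fun t x => cross (mollifiedDiv φ ε (b t) x) (b t x)) χ
      = ∫ z : ST, ∑ i, ∑ k, ∫ l, pd k (rescale φ ε) l *
        ((D.B k * D.B i) (z + sp (-l)) * D.testCross χ i z) := by
    have hs : ∀ z : ST, z ∉ Ioo 0 T ×ˢ (univ : Set T3) → ∑ i, ∑ k, ∫ l, pd k (rescale φ ε) l *
        ((D.B k * D.B i) (z + sp (-l)) * D.testCross χ i z) = 0 := fun z hz =>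
      Finset.sum_eq_zero fun i _ => Finset.sum_eq_zero fun k _ => by
        obtain ⟨K, hK, hKT, h⟩ := D.timeSupported_testCross χ i
        simp [h z fun h' => hz ⟨hKT h', mem_univ _⟩]
    rw [← setIntegral_eq_integral_of_forall_compl_eq_zero hs, vpair, spaceTime_eq]
    refine integral_congr_ae ?_
    rw [Filter.EventuallyEq, ae_restrict_iff' (measurableSet_slab T)]
    filter_upwards [h0'] with z hz hzT
    have e1 : ∀ k i, (fun y => b z.1 y k * b z.1 y i) = fun x => (D.B k * D.B i) (z.1, x) :=
      fun k i => funext fun y => by simp [hb z.1 hzT.1]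
    have e2 : ∀ l, z + sp (-l) = (z.1, z.2 - proj l) := fun l => by
      ext1 <;> simp [sp, proj_neg, sub_eq_add_neg]
    rw [inner_cross]
    refine Finset.sum_congr rfl fun i _ => ?_
    simp only [mollifiedDiv, e1, pderiv_mollify hφ hε (hz _ _), ← mul_assoc, integral_mul_const,
      e2, Finset.sum_mul]
    refine Finset.sum_congr rfl fun k _ => ?_
    rw [hb z.1 hzT.1, hb z.1 hzT.1]
    rfl
  rw [h1, integral_finsetSum _ fun i _ => integrable_finsetSum _ fun k _ => ii k i,
    ← Finset.sum_neg_distrib]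
  refine Finset.sum_congr rfl fun i _ => ?_
  rw [integral_finsetSum _ fun k _ => ii k i, ← Finset.sum_neg_distrib]
  refine Finset.sum_congr rfl fun k _ => ?_
  rw [(P k i).integral_swap hm (hw k), integral_pd_mul_corr_neg, rescale_comp_neg]

/-- The density of the product `[div (b ⊗ b)] × b`. -/
def emfDensity (z : ST) : ℝ :=
  ∑ i, (D.V i z * D.testCross χ i z - (1 / 2) * (D.E z * (tf (component i χ) z * D.J i z)
    + D.E z * (D.B (i + 2) z * dx (i + 1) (component i χ) z)
    - D.E z * (D.B (i + 1) z * dx (i + 2) (component i χ) z)))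

variable {φ : E3 → ℝ}

/-- This is div(b×χ) = χ·curl b − b·curl χ in two-point form: curl b = j is applied to the fixed
factor, with the components of χ as weights. -/
theorem sum_pairing_energy (hφ : IsKernel φ) :
    ∑ i, pairing (pd i φ) D.E (D.testCross χ i)
      = ∑ i, (pairing φ D.E (tf (component i χ) * D.J i)
        + pairing φ D.E (D.B (i + 2) * dx (i + 1) (component i χ))
        - pairing φ D.E (D.B (i + 1) * dx (i + 2) (component i χ))) := by
  have h1 : ∀ i : Fin 3, pairing (pd i φ) D.E (D.testCross χ i)
      = pairing (pd i φ) D.E (tf (component (i + 2) χ) * D.B (i + 1))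
        - pairing (pd i φ) D.E (tf (component (i + 1) χ) * D.B (i + 2)) := fun i => by
    rw [testCross, mul_comm (D.B _), mul_comm (D.B _)]
    exact (hφ.pd i).pairing_sub_right D.pairable_cubic D.pairable_cubic
  have h2 : ∀ i : Fin 3, pairing φ D.E (tf (component i χ) * D.J i)
        + pairing φ D.E (D.B (i + 2) * dx (i + 1) (component i χ))
        - pairing φ D.E (D.B (i + 1) * dx (i + 2) (component i χ))
      = pairing (pd (i + 1) φ) D.E (tf (component i χ) * D.B (i + 2))
        - pairing (pd (i + 2) φ) D.E (tf (component i χ) * D.B (i + 1)) := fun i =>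
    (D.curl_unprimed hφ (⟨rfl, rfl⟩ : Cyc i (i + 1) (i + 2)) D.integrable
      (fun x => D.pairable_cubic) (fun x y => D.pairable_cubic) D.pairable).symm
  simp only [h1, h2, Fin.sum_univ_three, Fin.reduceAdd, zero_add]
  ring

/-- Splitting b⊗b into the stress and ½|b|² I, the first part contributes (j×b)·(b×χ) by the stress
law and the second is a gradient, treated by the preceding identity. -/
theorem sum_pairing_tensor (hφ : IsKernel φ) :
    -∑ i, ∑ k, pairing (pd k φ) (D.B k * D.B i) (D.testCross χ i)
      = ∑ i, (pairing φ (D.V i) (D.testCross χ i)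
        - (1 / 2) * (pairing φ D.E (tf (component i χ) * D.J i)
        + pairing φ D.E (D.B (i + 2) * dx (i + 1) (component i χ))
        - pairing φ D.E (D.B (i + 1) * dx (i + 2) (component i χ)))) := by
  have h1 : ∀ i k : Fin 3, pairing (pd k φ) (D.stress i k) (D.testCross χ i)
      = pairing (pd k φ) (D.B k * D.B i) (D.testCross χ i)
        - if k = i then (1 / 2) * pairing (pd i φ) D.E (D.testCross χ i) else 0 := fun i k => by
    by_cases h : k = i
    · subst h
      rw [if_pos rfl, stress_eq_self, (hφ.pd k).pairing_sub_left D.pairable_cubic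
        D.pairable_cubic, pairing_smul_left]
    · rw [if_neg h, D.stress_eq_of_ne h, sub_zero]
  have h2 : ∀ i, ∑ k, pairing (pd k φ) (D.B k * D.B i) (D.testCross χ i)
      = -pairing φ (D.V i) (D.testCross χ i)
        + (1 / 2) * pairing (pd i φ) D.E (D.testCross χ i) := fun i => by
    have h3 := D.stress_primed (i := i) hφ (D.timeSupported_testCross χ i)
      (fun x => D.pairable_cubic) D.pairable
    simp only [h1, Finset.sum_sub_distrib, Finset.sum_ite_eq', Finset.mem_univ, if_true] at h3
    linarith
  simp only [h2, Finset.sum_add_distrib, Finset.sum_sub_distrib, ← Finset.mul_sum,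
    D.sum_pairing_energy χ hφ, Finset.sum_neg_distrib]
  ring

theorem hasTrace_tensor :
    HasTrace (fun φ => -∑ i, ∑ k, pairing (pd k φ) (D.B k * D.B i) (D.testCross χ i))
      (D.emfDensity χ) := by
  refine HasTrace.congr (HasTrace.sum fun i : Fin 3 =>
    (D.hasTrace_pairing (f := D.V i) (g := D.testCross χ i)).sub
    ((((D.hasTrace_pairing (f := D.E) (g := tf (component i χ) * D.J i)).add
      (D.hasTrace_pairing_cubic (f := D.E) (g := D.B (i + 2) * dx (i + 1) (component i χ)))).sub
      (D.hasTrace_pairing_cubic (f := D.E)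
        (g := D.B (i + 1) * dx (i + 2) (component i χ)))).const_mul (1 / 2)))
    (fun φ hφ => D.sum_pairing_tensor χ hφ) fun z => rfl

theorem tendsto_vpair_mollifiedDiv (hb : Agrees T b D.B) (hφ : IsMollifier φ) :
    Tendsto (fun ε => vpair (fun t x => cross (mollifiedDiv φ ε (b t) x) (b t x)) χ) (𝓝[>] 0)
      (𝓝 (∫ z, D.emfDensity χ z)) := by
  refine ((D.hasTrace_tensor χ).tendsto (isMollifier_comp_neg hφ)).congr' ?_
  filter_upwards [self_mem_nhdsWithin] with ε hε
  exact (D.vpair_mollifiedDiv χ hb hφ.isKernel hε).symm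

/-- If div(b⊗b) is a function, the same functional of kernels has a second continuous density, and
the two must agree at displacement zero. -/
theorem integral_emfDensity_of_weakDiv {G : Fin 3 → ST → ℝ}
    (hG : ∀ i, WeakDiv T 0 (fun k => D.B k * D.B i) (G i))
    (P : ∀ i, Pairable (G i) (D.testCross χ i)) :
    ∫ z, D.emfDensity χ z = ∫ z, ∑ i, G i z * D.testCross χ i z := by
  obtain ⟨φ, hφ⟩ := exists_isMollifier
  have h1 : HasTrace (fun φ => -∑ i, ∑ k, pairing (pd k φ) (D.B k * D.B i) (D.testCross χ i))
      (fun z => ∑ i, G i z * D.testCross χ i z) :=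
    (HasTrace.sum fun i => .of_pairable (P i)).congr (fun φ hφ => by
      rw [← Finset.sum_neg_distrib]
      refine Finset.sum_congr rfl fun i _ => ?_
      rw [primed (hG i) hφ (D.timeSupported_testCross χ i) (fun k => D.pairable_cubic) (P i),
        neg_neg]) fun z => rfl
  exact tendsto_nhds_unique ((D.hasTrace_tensor χ).tendsto hφ) (h1.tendsto hφ)

end Config

/-! ### Integrability of monomials from mixed Lebesgue norms -/

theorem mixedNorm_mul_le {r r₁ r₂ s s₁ s₂ : ℝ} (hr : 0 < r) (hr₁ : r < r₁)
    (hrr : 1 / r = 1 / r₁ + 1 / r₂) (hs : 0 < s) (hs₁ : s < s₁) (hss : 1 / s = 1 / s₁ + 1 / s₂)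
    {u v : ST → ℝ≥0∞} (hu : AEMeasurable u) (hv : AEMeasurable v) :
    mixedNorm r s (fun z => u z * v z) ≤ mixedNorm r₁ s₁ u * mixedNorm r₂ s₂ v := by
  have hm : ∀ {w : ST → ℝ≥0∞} {e : ℝ}, AEMeasurable w →
      AEMeasurable fun t : ℝ => (∫⁻ x : T3, w (t, x) ^ e) ^ (1 / e) := fun {w e} hw => by
    have h1 : AEMeasurable (fun z : ℝ × T3 => w z ^ e) ((volume : Measure ℝ).prod volume) :=
      hw.pow_const e
    exact h1.lintegral_prod_right'.pow_const _
  refine le_trans ?_ (ENNReal.lintegral_Lp_mul_le_Lq_mul_Lr hr hr₁ hrr volume (hm hu) (hm hv))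
  refine ENNReal.rpow_le_rpow (lintegral_mono_ae ?_) (one_div_pos.2 hr).le
  filter_upwards [ae_aemeasurable_slice hu, ae_aemeasurable_slice hv] with t h1 h2
  exact ENNReal.rpow_le_rpow
    (ENNReal.lintegral_Lp_mul_le_Lq_mul_Lr hs hs₁ hss volume h1 h2) hr.le

theorem mixedNorm_add_le {r s : ℝ} (hr : 1 ≤ r) (hs : 1 ≤ s) {u v : ST → ℝ≥0∞}
    (hu : AEMeasurable u) (hv : AEMeasurable v) :
    mixedNorm r s (fun z => u z + v z) ≤ mixedNorm r s u + mixedNorm r s v := by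
  have hm : ∀ {w : ST → ℝ≥0∞}, AEMeasurable w →
      AEMeasurable fun t : ℝ => (∫⁻ x : T3, w (t, x) ^ s) ^ (1 / s) := fun {w} hw => by
    have h1 : AEMeasurable (fun z : ℝ × T3 => w z ^ s) ((volume : Measure ℝ).prod volume) :=
      hw.pow_const s
    exact h1.lintegral_prod_right'.pow_const _
  refine le_trans ?_ (ENNReal.lintegral_Lp_add_le (hm hu) (hm hv) hr)
  refine ENNReal.rpow_le_rpow (lintegral_mono_ae ?_) (by positivity)
  filter_upwards [ae_aemeasurable_slice hu, ae_aemeasurable_slice hv] with t h1 h2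
  exact ENNReal.rpow_le_rpow (ENNReal.lintegral_Lp_add_le h1 h2 hs) (by positivity)

theorem mixedNorm_mono {r s : ℝ} (hr : 0 ≤ r) (hs : 0 ≤ s) {u v : ST → ℝ≥0∞}
    (h : ∀ z, u z ≤ v z) : mixedNorm r s u ≤ mixedNorm r s v :=
  ENNReal.rpow_le_rpow (lintegral_mono fun t => ENNReal.rpow_le_rpow
    (ENNReal.rpow_le_rpow (lintegral_mono fun x => ENNReal.rpow_le_rpow (h (t, x)) hs)
      (by positivity)) hr) (by positivity)

theorem mixedNorm_slab_ne_top (T : ℝ) {r s : ℝ} (hr : 0 < r) (hs : 0 < s) :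
    mixedNorm r s (fun z => ‖slab T z‖ₑ) ≠ ⊤ := by
  have h1 : ∀ t : ℝ, ((∫⁻ x : T3, ‖slab T (t, x)‖ₑ ^ s) ^ (1 / s)) ^ r
      = (Ioo 0 T).indicator 1 t := fun t => by
    by_cases h : t ∈ Ioo 0 T
    · simp [slab, indicator_of_mem h]
    · simp [slab, indicator_of_notMem h, hr, hs]
  rw [mixedNorm]
  simp only [h1]
  rw [lintegral_indicator_one measurableSet_Ioo]
  exact ENNReal.rpow_ne_top_of_nonneg (by positivity) (by simp)

section Exponents

variable {p m : ℝ}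

theorem two_lt_of_exponents (hp : 1 < p) (hm : 1 < m) (h : 2 / p + 1 / m = 1) : 2 < p := by
  have h1 : 0 < 1 / m := by positivity
  have h2 : 2 / p < 1 := by linarith
  rwa [div_lt_one (by linarith)] at h2

theorem holderConjugate_half (hp : 1 < p) (hm : 1 < m) (h : 2 / p + 1 / m = 1) :
    (p / 2).HolderConjugate m := by
  rw [Real.holderConjugate_iff]
  refine ⟨by linarith [two_lt_of_exponents hp hm h], ?_⟩
  rw [← h]
  field_simp

end Exponents

section Monomials

variable {T p q m n : ℝ} {β ι : ST → ℝ}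

/-- Products of a square-type factor in `L^p L^q` and a factor in `L^m L^n` with `2/p + 1/m = 1`
and `2/q + 1/n = 1`. -/
theorem pairable_monom_of_mixedNorm (hp : 1 < p) (hq : 1 < q) (hm : 1 < m) (hn : 1 < n)
    (hpm : 2 / p + 1 / m = 1) (hqn : 2 / q + 1 / n = 1)
    (hβ : AEStronglyMeasurable β volume) (hι : AEStronglyMeasurable ι volume)
    (hβ1 : ∀ z, slab T z ≤ β z) (hι1 : ∀ z, slab T z ≤ ι z)
    (hβn : mixedNorm p q (fun z => ‖β z‖ₑ) ≠ ⊤) (hιn : mixedNorm m n (fun z => ‖ι z‖ₑ) ≠ ⊤)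
    {a c : ℕ} (ha : a ≤ 2) (hc : c ≤ 1) :
    Pairable (monom T β ι a c) (monom T β ι (2 - a) (1 - c)) := by
  have hp2 := two_lt_of_exponents hp hm hpm
  have hq2 := two_lt_of_exponents hq hn hqn
  have cp := holderConjugate_half hp hm hpm
  have cq := holderConjugate_half hq hn hqn
  have dp : p.HolderConjugate (p / (p - 1)) := Real.HolderConjugate.conjExponent hp
  have dq : q.HolderConjugate (q / (q - 1)) := Real.HolderConjugate.conjExponent hq
  have hslab : AEStronglyMeasurable (slab T) volume := (integrable_slab T).1
  have hmm : ∀ a c, AEStronglyMeasurable (monom T β ι a c) volume := fun a c =>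
    hslab.mul ((hβ.pow a).mul (hι.pow c))
  -- Both sizes are at least 1 on the slab, so raising the degree only increases a monomial.
  have hle : ∀ {a c a' c' : ℕ}, a ≤ a' → c ≤ c' → ∀ z,
      ‖monom T β ι a c z‖ ≤ ‖monom T β ι a' c' z‖ := fun {a c a' c'} h h' z => by
    by_cases hz : z.1 ∈ Ioo 0 T
    · have h1 := hβ1 z
      have h2 := hι1 z
      rw [Config.slab_of_mem hz] at h1 h2
      simp only [monom, Config.slab_of_mem hz, one_mul, norm_mul, norm_pow, Real.norm_eq_abs]
      gcongr
      · exact h1.trans (le_abs_self _)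
      · exact h2.trans (le_abs_self _)
    · simp [monom, Config.slab_of_notMem hz]
  have hmono : ∀ {a c : ℕ} {r s : ℝ} {u : ST → ℝ≥0∞}, 0 ≤ r → 0 ≤ s →
      (∀ z, ‖β z ^ a * ι z ^ c‖ₑ = u z) → mixedNorm r s u ≠ ⊤ →
      mixedNorm r s (fun z => ‖monom T β ι a c z‖ₑ) ≠ ⊤ := fun hr hs hu h =>
    ne_top_of_le_ne_top h (mixedNorm_mono hr hs fun z => by
      rw [← hu, monom, enorm_mul]
      refine mul_le_of_le_one_left' ?_
      rw [← ofReal_norm]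
      simpa using ENNReal.ofReal_le_ofReal (Config.abs_slab_le (T := T) z))
  have n1 : mixedNorm p q (fun z => ‖monom T β ι 1 0 z‖ₑ) ≠ ⊤ :=
    hmono (by linarith) (by linarith) (fun z => by simp) hβn
  have n2 : mixedNorm m n (fun z => ‖monom T β ι 0 1 z‖ₑ) ≠ ⊤ :=
    hmono (by linarith) (by linarith) (fun z => by simp) hιn
  have n3 : mixedNorm (p / 2) (q / 2) (fun z => ‖monom T β ι 2 0 z‖ₑ) ≠ ⊤ :=
    hmono (by linarith) (by linarith) (fun z => by simp [sq, enorm_mul])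
      (ne_top_of_le_ne_top (ENNReal.mul_ne_top hβn hβn)
        (mixedNorm_mul_le (by linarith) (by linarith) (by field_simp; norm_num)
          (by linarith) (by linarith) (by field_simp; norm_num) hβ.enorm hβ.enorm))
  have ep : ∀ {p m : ℝ}, 1 < p → 1 < m → 2 / p + 1 / m = 1 →
      1 / (p / (p - 1)) = 1 / p + 1 / m := fun {p m} h1 h2 h => by
    have : (1 : ℝ) / (p / (p - 1)) = 1 - 1 / p := by
      have : p - 1 ≠ 0 := by linarith
      field_simp
    have h3 : 2 / p = 1 / p + 1 / p := by ring
    linarith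
  have lp : ∀ {p : ℝ}, 2 < p → p / (p - 1) < p := fun {p} h => by
    rw [div_lt_iff₀ (by linarith)]
    nlinarith
  have n4 : mixedNorm (p / (p - 1)) (q / (q - 1)) (fun z => ‖monom T β ι 1 1 z‖ₑ) ≠ ⊤ :=
    hmono dp.symm.nonneg dq.symm.nonneg (fun z => by simp [enorm_mul])
      (ne_top_of_le_ne_top (ENNReal.mul_ne_top hβn hιn)
        (mixedNorm_mul_le dp.symm.pos (lp hp2) (ep hp hm hpm) dq.symm.pos (lp hq2)
          (ep hq hn hqn) hβ.enorm hι.enorm))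
  have hint : Integrable (monom T β ι 2 1) := by
    refine ⟨hmm 2 1, ?_⟩
    rw [hasFiniteIntegral_iff_enorm]
    refine lt_of_le_of_lt ?_ (lt_top_iff_ne_top.2 (ENNReal.mul_ne_top n3 n2))
    refine le_trans (lintegral_mono fun z => ?_)
      (lintegral_translate_mul_le cp cq (hmm 2 0).enorm (hmm 0 1).enorm 0)
    rw [add_zero, ← enorm_mul]
    refine le_of_eq (congrArg _ ?_)
    simp only [monom]
    rw [mul_mul_mul_comm, Config.slab_mul_self]
    ring
  have hint' : ∀ {a c : ℕ}, a ≤ 2 → c ≤ 1 → Integrable (monom T β ι a c) := fun h h' =>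
    hint.norm.mono' (hmm _ _) (Eventually.of_forall (hle h h'))
  have hb : ∀ z, ‖monom T β ι 0 0 z‖ ≤ 1 := fun z => by
    simpa [monom] using Config.abs_slab_le (T := T) z
  -- The six splittings of |b|²|j| use three mechanisms: the exponents (p/2, q/2) against (m, n),
  -- the pair (p, q) against its dual for |b||j|, and boundedness of the trivial monomial.
  interval_cases a <;> interval_cases c
  · exact .of_bounded (hmm 0 0) hint hb
  · exact .of_mixedNorm cp.symm cq.symm (hmm 0 1) (hint' le_rfl (by norm_num)) n2 n3
  · exact .of_mixedNorm dp dq (hmm 1 0) (hint' (by norm_num) le_rfl) n1 n4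
  · exact .of_mixedNorm dp.symm dq.symm (hmm 1 1) (hint' (by norm_num) (by norm_num)) n4 n1
  · exact .of_mixedNorm cp cq (hmm 2 0) (hint' (by norm_num) (by norm_num)) n3 n2
  · exact .of_bounded_right hint (hint' (by norm_num) (by norm_num)) hb

/-- Adding the slab indicator to both sizes makes them at least 1 there at finite cost in norm;
every admissible pair of monomials is then dominated by one of complementary degrees. -/
theorem pairable_monom (hp : 1 < p) (hq : 1 < q) (hm : 1 < m) (hn : 1 < n)
    (hpm : 2 / p + 1 / m = 1) (hqn : 2 / q + 1 / n = 1)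
    (hβ : AEStronglyMeasurable β volume) (hι : AEStronglyMeasurable ι volume)
    (hβp : ∀ z, 0 ≤ β z) (hιp : ∀ z, 0 ≤ ι z)
    (hβn : mixedNorm p q (fun z => ‖β z‖ₑ) ≠ ⊤) (hιn : mixedNorm m n (fun z => ‖ι z‖ₑ) ≠ ⊤)
    {a c a' c' : ℕ} (ha : a + a' ≤ 2) (hc : c + c' ≤ 1) :
    Pairable (monom T β ι a c) (monom T β ι a' c') := by
  have hslab : AEStronglyMeasurable (slab T) volume := (integrable_slab T).1
  have hs0 : ∀ z, 0 ≤ slab T z := fun z => indicator_nonneg (by simp) _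
  have hadd : ∀ {r s : ℝ} {f : ST → ℝ}, 1 < r → 1 < s → AEStronglyMeasurable f volume →
      mixedNorm r s (fun z => ‖f z‖ₑ) ≠ ⊤ →
      mixedNorm r s (fun z => ‖(f + slab T) z‖ₑ) ≠ ⊤ := fun {r s f} hr hs hf h =>
    ne_top_of_le_ne_top (ENNReal.add_ne_top.2 ⟨h, mixedNorm_slab_ne_top T (by linarith)
      (by linarith)⟩) ((mixedNorm_mono (by linarith) (by linarith) fun z => enorm_add_le _ _).trans
        (mixedNorm_add_le hr.le hs.le hf.enorm hslab.enorm))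
  have h1 := pairable_monom_of_mixedNorm (T := T) (β := β + slab T) (ι := ι + slab T)
    hp hq hm hn hpm hqn (hβ.add hslab) (hι.add hslab)
    (fun z => by simpa using hβp z) (fun z => by simpa using hιp z)
    (hadd hp hq hβ hβn) (hadd hm hn hι hιn) (a := a) (c := c) (by omega) (by omega)
  have hmm : ∀ a c, AEStronglyMeasurable (monom T β ι a c) volume := fun a c =>
    hslab.mul ((hβ.pow a).mul (hι.pow c))
  have hle : ∀ {a c a' c' : ℕ}, a ≤ a' → c ≤ c' → ∀ z,
      ‖monom T β ι a c z‖ ≤ 1 * ‖monom T (β + slab T) (ι + slab T) a' c' z‖ :=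
    fun {a c a' c'} h h' z => by
    have key : ∀ {x : ℝ} {k k' : ℕ}, 0 ≤ x → k ≤ k' → x ^ k ≤ (x + 1) ^ k' := fun h1 h2 =>
      (pow_le_pow_left₀ h1 (by linarith) _).trans (pow_le_pow_right₀ (by linarith) h2)
    by_cases hz : z.1 ∈ Ioo 0 T
    · have h1 := hβp z
      have h2 := hιp z
      simp only [monom, Config.slab_of_mem hz, one_mul, Pi.add_apply]
      rw [Real.norm_of_nonneg (by positivity), Real.norm_of_nonneg (by positivity)]
      exact mul_le_mul (key h1 h) (key h2 h') (by positivity) (by positivity)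
    · simp [monom, Config.slab_of_notMem hz]
  exact h1.mono (hmm _ _) (hmm _ _) (hle le_rfl le_rfl) (hle (by omega) (by omega))

end Monomials

/-! ### The configuration of a weak solution -/

section Extension

variable (T : ℝ) (f : ℝ → T3 → E3)

/-- The components of a vector field, extended by zero outside `(0,T)`. -/
def extend (i : Fin 3) : ST → ℝ := (Ioo 0 T ×ˢ univ).indicator fun z => f z.1 z.2 i

/-- The pointwise size of a vector field, extended by zero outside `(0,T)`. -/
def size : ST → ℝ := (Ioo 0 T ×ˢ univ).indicator fun z => ‖f z.1 z.2‖

theorem agrees_extend : Agrees T f (extend T f) := fun t ht x k =>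
  (indicator_of_mem (show (t, x) ∈ Ioo 0 T ×ˢ (univ : Set T3) from ⟨ht, mem_univ _⟩)
    fun z : ST => f z.1 z.2 k).symm

variable {T f}

theorem extend_of_notMem {z : ST} (h : z.1 ∉ Ioo 0 T) (i : Fin 3) : extend T f i z = 0 :=
  indicator_of_notMem (fun h' => h h'.1) _

theorem size_of_notMem {z : ST} (h : z.1 ∉ Ioo 0 T) : size T f z = 0 :=
  indicator_of_notMem (fun h' => h h'.1) _

theorem extend_of_mem {z : ST} (h : z.1 ∈ Ioo 0 T) (i : Fin 3) :
    extend T f i z = f z.1 z.2 i := indicator_of_mem (by exact ⟨h, mem_univ _⟩) _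

theorem size_of_mem {z : ST} (h : z.1 ∈ Ioo 0 T) : size T f z = ‖f z.1 z.2‖ :=
  indicator_of_mem (by exact ⟨h, mem_univ _⟩) _

theorem size_nonneg (z : ST) : 0 ≤ size T f z := indicator_nonneg (fun _ _ => norm_nonneg _) z

theorem size_sq (z : ST) : size T f z ^ 2 = ∑ i, extend T f i z ^ 2 := by
  by_cases h : z.1 ∈ Ioo 0 T
  · simp [size_of_mem h, extend_of_mem h, EuclideanSpace.norm_sq_eq]
  · simp [size_of_notMem h, extend_of_notMem h]

theorem abs_extend_le (i : Fin 3) (z : ST) : ‖extend T f i z‖ ≤ size T f z := by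
  by_cases h : z.1 ∈ Ioo 0 T
  · rw [size_of_mem h, extend_of_mem h]
    exact PiLp.norm_apply_le _ _
  · simp [size_of_notMem h, extend_of_notMem h]

theorem aesm_extend (hf : AEStronglyMeasurable (fun z : ℝ × T3 => f z.1 z.2) (spaceTime T))
    (i : Fin 3) : AEStronglyMeasurable (extend T f i) volume := by
  rw [extend, aestronglyMeasurable_indicator_iff (measurableSet_slab T), ← spaceTime_eq]
  exact (EuclideanSpace.proj (𝕜 := ℝ) i).continuous.comp_aestronglyMeasurable hf

theorem aesm_size (hf : AEStronglyMeasurable (fun z : ℝ × T3 => f z.1 z.2) (spaceTime T)) :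
    AEStronglyMeasurable (size T f) volume := by
  rw [size, aestronglyMeasurable_indicator_iff (measurableSet_slab T), ← spaceTime_eq]
  exact hf.norm

theorem mixedNorm_size_ne_top {r s : ℝ} (hr : 0 < r) (hs : 0 < s)
    (hf : MemLpLq T (ENNReal.ofReal r) (ENNReal.ofReal s) f) :
    mixedNorm r s (fun z => ‖size T f z‖ₑ) ≠ ⊤ := by
  have h1 := hf.2
  rw [eLpNorm_eq_lintegral_rpow_enorm_toReal (by simpa using hr) ENNReal.ofReal_ne_top,
    ENNReal.toReal_ofReal hr.le] at h1
  simp only [eLpNorm_eq_lintegral_rpow_enorm_toReal (show ENNReal.ofReal s ≠ 0 by simpa using hs)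
    ENNReal.ofReal_ne_top, ENNReal.toReal_ofReal hs.le, enorm_eq_self] at h1
  rw [← lintegral_indicator measurableSet_Ioo] at h1
  convert h1.ne using 1
  rw [mixedNorm]
  congr 1
  refine lintegral_congr fun t => ?_
  by_cases h : t ∈ Ioo 0 T
  · simp [indicator_of_mem h, size_of_mem (z := (t, _)) h]
  · simp [indicator_of_notMem h, size_of_notMem (z := (t, _)) h, hr, hs]

theorem exists_energy_bound (hf : MemLpLq T ⊤ 2 f) :
    ∃ C : ℝ≥0∞, C ≠ ⊤ ∧ ∀ᵐ t : ℝ, ∫⁻ x : T3, ‖size T f (t, x)‖ₑ ^ 2 ≤ C := by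
  have h1 := hf.2
  rw [eLpNorm_exponent_top] at h1
  refine ⟨_, ENNReal.pow_ne_top (n := 2) h1.ne, ?_⟩
  have h2 := (ae_restrict_iff' measurableSet_Ioo).1 (ae_le_eLpNormEssSup
    (f := fun t => eLpNorm (f t) 2 volume) (μ := volume.restrict (Ioo 0 T)))
  filter_upwards [h2] with t ht
  by_cases h : t ∈ Ioo 0 T
  · refine le_trans (le_of_eq ?_) (pow_le_pow_left' (ht h) 2)
    rw [enorm_eq_self, eLpNorm_eq_lintegral_rpow_enorm_toReal (by norm_num) (by norm_num),
      ← ENNReal.rpow_natCast, ← ENNReal.rpow_mul]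
    simp [size_of_mem (z := (t, _)) h]
  · simp [size_of_notMem (z := (t, _)) h]

end Extension

theorem integral_spaceTime_eq {T : ℝ} {F F' : ST → ℝ} (h : ∀ z : ST, z.1 ∈ Ioo 0 T → F z = F' z)
    (h0 : ∀ z : ST, z.1 ∉ Ioo 0 T → F' z = 0) : ∫ z, F z ∂spaceTime T = ∫ z, F' z := by
  rw [spaceTime_eq, setIntegral_congr_fun (g := F') (measurableSet_slab T) fun z hz => h z hz.1]
  exact setIntegral_eq_integral_of_forall_compl_eq_zero fun z hz =>
    h0 z fun h' => hz ⟨h', mem_univ _⟩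

section TestFields

variable {T : ℝ}

/-- The vector-valued test function `ψ eᵢ`. -/
def axisField (i : Fin 3) (ψ : testSpace T ℝ) : testSpace T E3 :=
  ⟨fun t x => (ψ : ℝ → T3 → ℝ) t x • basisVec i, by
    obtain ⟨h, K, hK, hKT, h0⟩ := ψ.2
    exact ⟨h.smul contDiff_const, K, hK, hKT, fun t ht x => by simp [h0 t ht x]⟩⟩

theorem axisField_apply (i k : Fin 3) (ψ : testSpace T ℝ) (t : ℝ) (x : T3) :
    (axisField i ψ : ℝ → T3 → E3) t x k = if k = i then (ψ : ℝ → T3 → ℝ) t x else 0 := by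
  simp [axisField, basisVec, eq_comm]

theorem pderiv_axisField (i k l : Fin 3) (ψ : testSpace T ℝ) (z : ST) :
    pderiv l (fun y => (axisField i ψ : ℝ → T3 → E3) z.1 y k) z.2
      = if k = i then dx l ψ z else 0 := by
  simp only [axisField_apply]
  split_ifs
  · rfl
  · simp [pderiv]

theorem tderiv_axisField (i k : Fin 3) (ψ : testSpace T ℝ) (z : ST) :
    tderiv (axisField i ψ : ℝ → T3 → E3) z.1 z.2 k = if k = i then dt ψ z else 0 := by
  obtain ⟨w, rfl⟩ := cov_surjective z
  have h1 : tderiv (axisField i ψ : ℝ → T3 → E3) w.1 (proj w.2) = dt ψ (cov w) • basisVec i := by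
    have h2 : DifferentiableAt ℝ (lift (ψ : ℝ → T3 → ℝ)) w := ψ.2.1.differentiable (by simp) w
    rw [tderiv_proj (axisField i ψ).2.1, dt_cov]
    have h3 : lift (axisField i ψ : ℝ → T3 → E3) = fun w => lift (ψ : ℝ → T3 → ℝ) w • basisVec i :=
      rfl
    rw [h3, fderiv_smul_const h2]
    simp
  change tderiv (axisField i ψ : ℝ → T3 → E3) w.1 (proj w.2) k = _
  rw [h1]
  simp [basisVec, eq_comm]

/-- Curl-freeness of ∇ψ, needed twice: for div j = 0, and to drop the curl from the energy flux
tested against ∇ψ. -/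
theorem dx_component_testGrad_comm (i k : Fin 3) (ψ : testSpace T ℝ) (z : ST) :
    dx i (component k (testGrad ψ)) z = dx k (component i (testGrad ψ)) z := by
  obtain ⟨w, rfl⟩ := cov_surjective z
  have h1 : ∀ i k : Fin 3, dx i (component k (testGrad ψ)) (cov w)
      = fderiv ℝ (fderiv ℝ (lift (ψ : ℝ → T3 → ℝ))) w (0, basisVec i) (0, basisVec k) :=
    fun i k => by
    have h2 : DifferentiableAt ℝ (fderiv ℝ (lift (ψ : ℝ → T3 → ℝ))) w :=
      (ψ.2.1.fderiv_right (m := ∞) (by simp)).differentiable (by simp) w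
    have h3 : lift (component k (testGrad ψ) : ℝ → T3 → ℝ)
        = fun w => fderiv ℝ (lift (ψ : ℝ → T3 → ℝ)) w (0, basisVec k) :=
      funext fun w => pderiv_proj ψ.2.1 k w.1 w.2
    rw [dx_cov, h3, fderiv_clm_apply h2 (differentiableAt_const _)]
    simp
  rw [h1, h1]
  exact (ψ.2.1.contDiffAt.isSymmSndFDerivAt
    (by simp; exact WithTop.coe_le_coe.2 (le_top : (2 : ℕ∞) ≤ ⊤))) _ _

theorem tf_component_testGrad (i : Fin 3) (ψ : testSpace T ℝ) :
    tf (component i (testGrad ψ)) = dx i ψ := rfl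

end TestFields

section Laws

variable {T : ℝ} {b j : ℝ → T3 → E3}

theorem dx_of_notMem {z : ST} (h : z.1 ∉ Ioo 0 T) (k : Fin 3) (ψ : testSpace T ℝ) :
    dx k ψ z = 0 := by
  obtain ⟨K, -, hKT, h0⟩ := exists_compact_support ψ
  exact (h0 z fun h' => h (hKT h')).2.2 k

theorem dt_of_notMem {z : ST} (h : z.1 ∉ Ioo 0 T) (ψ : testSpace T ℝ) : dt ψ z = 0 := by
  obtain ⟨K, -, hKT, h0⟩ := exists_compact_support ψ
  exact (h0 z fun h' => h (hKT h')).2.1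

theorem vpair_testGrad (f : ℝ → T3 → E3) (ψ : testSpace T ℝ) :
    vpair f (testGrad ψ) = ∫ z, ∑ k, extend T f k z * dx k ψ z :=
  integral_spaceTime_eq (fun z hz => by
    simp only [inner_eq_sum, extend_of_mem hz]
    rfl) fun z hz => by simp [extend_of_notMem hz]

theorem vpair_axisField (f : ℝ → T3 → E3) (i : Fin 3) (ψ : testSpace T ℝ) :
    vpair f (axisField i ψ) = ∫ z, extend T f i z * tf ψ z :=
  integral_spaceTime_eq (fun z hz => by
    simp only [inner_eq_sum, extend_of_mem hz, axisField_apply]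
    simp [tf]) fun z hz => by simp [extend_of_notMem hz]

theorem weakDiv_field (hsol : IsWeakSolution T b j) : WeakDiv T 0 (extend T b) 0 := fun ψ => by
  have := hsol.div_free ψ
  rw [vpair_testGrad] at this
  simpa using this

/-- A curl is divergence free: the relation curl b = j is tested with ∇ψ. -/
theorem weakDiv_current (hsol : IsWeakSolution T b j) : WeakDiv T 0 (extend T j) 0 := fun ψ => by
  have h1 := hsol.current (testGrad ψ)
  have h2 : ∀ z : ST, curl ((testGrad ψ : ℝ → T3 → E3) z.1) z.2 = 0 := fun z => by
    have h := fun i k => dx_component_testGrad_comm i k ψ z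
    have e : ∀ i k : Fin 3, pderiv i (fun y => (testGrad ψ : ℝ → T3 → E3) z.1 y k) z.2
        = dx i (component k (testGrad ψ)) z := fun i k => rfl
    simp only [curl, e, h 2 1, h 2 0, h 1 0, sub_self]
    ext i
    fin_cases i <;> rfl
  simp only [h2, inner_zero_right, integral_zero] at h1
  rw [vpair_testGrad] at h1
  simpa using h1.symm

theorem weakDiv_curl (hsol : IsWeakSolution T b j) {R : Fin 3 → ST → ℝ} (i : Fin 3)
    (h : ∀ (ψ : testSpace T ℝ) (z : ST), z.1 ∈ Ioo 0 T →
      ⟪b z.1 z.2, curl ((axisField i ψ : ℝ → T3 → E3) z.1) z.2⟫ = -∑ k, R k z * dx k ψ z) :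
    WeakDiv T 0 R (extend T j i) := fun ψ => by
  have h1 := hsol.current (axisField i ψ)
  rw [vpair_axisField, integral_spaceTime_eq (F' := fun z => -∑ k, R k z * dx k ψ z) (h ψ)
    (fun z hz => by simp [dx_of_notMem hz]), integral_neg] at h1
  simp only [Pi.zero_apply, zero_mul, zero_add]
  linarith

theorem inner_curl_axisField (v : E3) (i : Fin 3) (ψ : testSpace T ℝ) (z : ST) :
    ⟪v, curl ((axisField i ψ : ℝ → T3 → E3) z.1) z.2⟫
      = v (i + 1) * dx (i + 2) ψ z - v (i + 2) * dx (i + 1) ψ z := by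
  simp only [curl, pderiv_axisField]
  rw [inner_eq_sum]
  fin_cases i <;> simp [Fin.sum_univ_three] <;> ring

theorem weakDiv_induction (hsol : IsWeakSolution T b j) (i : Fin 3) :
    WeakDiv T (extend T b i)
      (fun k => extend T j i * extend T b k - extend T j k * extend T b i) 0 := fun ψ => by
  have h1 := hsol.momentum (axisField i ψ)
  rw [integral_spaceTime_eq (F' := fun z => extend T b i z * dt ψ z
    + ∑ k, (extend T j i * extend T b k - extend T j k * extend T b i) z * dx k ψ z)] at h1
  · simpa using h1
  · intro z hz
    rw [inner_curl_axisField, inner_eq_sum]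
    simp only [tderiv_axisField, mul_ite, mul_zero, Finset.sum_ite_eq', Finset.mem_univ, if_true,
      Pi.sub_apply, Pi.mul_apply, extend_of_mem hz, Fin.sum_univ_three]
    fin_cases i <;> simp [cross, crossProduct] <;> ring
  · intro z hz
    simp [extend_of_notMem hz]

/-- The configuration of a weak solution. -/
def configOfSolution {p q m n : ℝ} (hp : 1 < p) (hq : 1 < q) (hm : 1 < m) (hn : 1 < n)
    (hpm : 2 / p + 1 / m = 1) (hqn : 2 / q + 1 / n = 1) (hb_energy : MemLpLq T ⊤ 2 b)
    (hb : MemLpLq T (ENNReal.ofReal p) (ENNReal.ofReal q) b)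
    (hj : MemLpLq T (ENNReal.ofReal m) (ENNReal.ofReal n) j) (hsol : IsWeakSolution T b j) :
    Config T where
  B := extend T b
  J := extend T j
  β := size T b
  ι := size T j
  B_aesm := aesm_extend hb.1
  J_aesm := aesm_extend hj.1
  β_eq := size_sq
  ι_eq := size_sq
  β_nonneg := size_nonneg
  ι_nonneg := size_nonneg
  β_supp _ := size_of_notMem
  ι_supp _ := size_of_notMem
  energy := exists_energy_bound hb_energy
  pair _ _ _ _ ha hc := pairable_monom hp hq hm hn hpm hqn (aesm_size hb.1) (aesm_size hj.1)
    size_nonneg size_nonneg (mixedNorm_size_ne_top (by linarith) (by linarith) hb)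
    (mixedNorm_size_ne_top (by linarith) (by linarith) hj) ha hc
  div_B := weakDiv_field hsol
  div_J := weakDiv_current hsol
  curl_zero := weakDiv_curl hsol 0 fun ψ z hz => by
    rw [inner_curl_axisField]
    simp [Fin.sum_univ_three, extend_of_mem hz]
    ring
  curl_one := weakDiv_curl hsol 1 fun ψ z hz => by
    rw [inner_curl_axisField]
    simp [Fin.sum_univ_three, extend_of_mem hz]
    ring
  curl_two := weakDiv_curl hsol 2 fun ψ z hz => by
    rw [inner_curl_axisField]
    simp [Fin.sum_univ_three, extend_of_mem hz]
    ring
  induction_eq := weakDiv_induction hsol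

end Laws

/-! ### Distributions given by first-order densities -/

section Densities

variable {T : ℝ}

theorem tf_add (ψ χ : testSpace T ℝ) (z : ST) : tf (ψ + χ) z = tf ψ z + tf χ z := rfl

theorem tf_smul (c : ℝ) (ψ : testSpace T ℝ) (z : ST) : tf (c • ψ) z = c * tf ψ z := rfl

theorem lift_add (ψ χ : testSpace T ℝ) : lift ((ψ + χ : testSpace T ℝ) : ℝ → T3 → ℝ)
    = lift (ψ : ℝ → T3 → ℝ) + lift (χ : ℝ → T3 → ℝ) := rfl

theorem lift_smul (c : ℝ) (ψ : testSpace T ℝ) : lift ((c • ψ : testSpace T ℝ) : ℝ → T3 → ℝ)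
    = c • lift (ψ : ℝ → T3 → ℝ) := rfl

theorem differentiableAt_lift (ψ : testSpace T ℝ) (w : ℝ × E3) :
    DifferentiableAt ℝ (lift (ψ : ℝ → T3 → ℝ)) w := ψ.2.1.differentiable (by simp) w

theorem dt_add (ψ χ : testSpace T ℝ) (z : ST) : dt (ψ + χ) z = dt ψ z + dt χ z := by
  obtain ⟨w, rfl⟩ := cov_surjective z
  simp only [dt_cov, lift_add]
  rw [fderiv_add (differentiableAt_lift ψ w) (differentiableAt_lift χ w)]
  rfl

theorem dx_add (k : Fin 3) (ψ χ : testSpace T ℝ) (z : ST) :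
    dx k (ψ + χ) z = dx k ψ z + dx k χ z := by
  obtain ⟨w, rfl⟩ := cov_surjective z
  simp only [dx_cov, lift_add]
  rw [fderiv_add (differentiableAt_lift ψ w) (differentiableAt_lift χ w)]
  rfl

theorem dt_smul (c : ℝ) (ψ : testSpace T ℝ) (z : ST) : dt (c • ψ) z = c * dt ψ z := by
  obtain ⟨w, rfl⟩ := cov_surjective z
  simp only [dt_cov, lift_smul]
  rw [fderiv_const_smul (differentiableAt_lift ψ w)]
  rfl

theorem dx_smul (c : ℝ) (k : Fin 3) (ψ : testSpace T ℝ) (z : ST) :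
    dx k (c • ψ) z = c * dx k ψ z := by
  obtain ⟨w, rfl⟩ := cov_surjective z
  simp only [dx_cov, lift_smul]
  rw [fderiv_const_smul (differentiableAt_lift ψ w)]
  rfl

section Bounds

variable {ψ : testSpace T ℝ} {M : ℝ}

theorem abs_tf_le (hM : ∀ k ≤ 1, ∀ w, ‖iteratedFDeriv ℝ k (lift (ψ : ℝ → T3 → ℝ)) w‖ ≤ M)
    (z : ST) : ‖tf ψ z‖ ≤ M := by
  obtain ⟨w, rfl⟩ := cov_surjective z
  have := hM 0 (by norm_num) w
  rwa [norm_iteratedFDeriv_zero] at this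

theorem abs_fderiv_lift_le
    (hM : ∀ k ≤ 1, ∀ w, ‖iteratedFDeriv ℝ k (lift (ψ : ℝ → T3 → ℝ)) w‖ ≤ M)
    (w v : ℝ × E3) (hv : ‖v‖ ≤ 1) : ‖fderiv ℝ (lift (ψ : ℝ → T3 → ℝ)) w v‖ ≤ M := by
  have := hM 1 le_rfl w
  rw [norm_iteratedFDeriv_one] at this
  exact (ContinuousLinearMap.le_opNorm_of_le _ hv).trans (by simpa using this)

theorem abs_dt_le (hM : ∀ k ≤ 1, ∀ w, ‖iteratedFDeriv ℝ k (lift (ψ : ℝ → T3 → ℝ)) w‖ ≤ M)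
    (z : ST) : ‖dt ψ z‖ ≤ M := by
  obtain ⟨w, rfl⟩ := cov_surjective z
  rw [dt_cov]
  exact abs_fderiv_lift_le hM w _ (by simp)

theorem abs_dx_le (hM : ∀ k ≤ 1, ∀ w, ‖iteratedFDeriv ℝ k (lift (ψ : ℝ → T3 → ℝ)) w‖ ≤ M)
    (k : Fin 3) (z : ST) : ‖dx k ψ z‖ ≤ M := by
  obtain ⟨w, rfl⟩ := cov_surjective z
  rw [dx_cov]
  exact abs_fderiv_lift_le hM w _ (by simp [basisVec])

end Bounds

variable {A E : ST → ℝ} {C : Fin 3 → ST → ℝ}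

theorem integrable_firstOrder (hE : Integrable E) (hA : Integrable A) (hC : ∀ k, Integrable (C k))
    (ψ : testSpace T ℝ) :
    Integrable fun z => E z * tf ψ z + A z * dt ψ z + ∑ k, C k z * dx k ψ z := by
  obtain ⟨c₀, h₀⟩ := exists_bound_tf ψ
  obtain ⟨c₁, h₁⟩ := exists_bound_dt ψ
  refine ((hE.mul_bdd (c := c₀) (continuous_tf ψ).aestronglyMeasurable (Eventually.of_forall h₀)).add
    (hA.mul_bdd (c := c₁) (continuous_dt ψ).aestronglyMeasurable (Eventually.of_forall h₁))).add
    (integrable_finsetSum _ fun k _ => ?_)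
  obtain ⟨c₂, h₂⟩ := exists_bound_dx k ψ
  exact (hC k).mul_bdd (c := c₂) (continuous_dx k ψ).aestronglyMeasurable (Eventually.of_forall h₂)

/-- The distribution `ψ ↦ ∫ (E ψ + A ∂ₜψ + C · ∇ψ)`. -/
def firstOrderDistrib (E A : ST → ℝ) (C : Fin 3 → ST → ℝ) (hE : Integrable E) (hA : Integrable A)
    (hC : ∀ k, Integrable (C k)) : Distrib T ℝ where
  toFun :=
    { toFun := fun ψ => ∫ z, (E z * tf ψ z + A z * dt ψ z + ∑ k, C k z * dx k ψ z)
      map_add' := fun ψ χ => by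
        rw [← integral_add (integrable_firstOrder hE hA hC ψ) (integrable_firstOrder hE hA hC χ)]
        refine integral_congr_ae (Eventually.of_forall fun z => ?_)
        simp only [tf_add, dt_add, dx_add, mul_add, Finset.sum_add_distrib]
        ring
      map_smul' := fun c ψ => by
        rw [RingHom.id_apply, smul_eq_mul, ← integral_const_mul]
        refine integral_congr_ae (Eventually.of_forall fun z => ?_)
        simp only [tf_smul, dt_smul, dx_smul, mul_add, Finset.mul_sum, mul_left_comm c] }
  bounded := fun _ _ _ => ⟨1, ∫ z, (‖E z‖ + ‖A z‖ + ∑ k, ‖C k z‖), fun ψ _ M hM => by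
    have h1 : Integrable fun z => ‖E z‖ + ‖A z‖ + ∑ k, ‖C k z‖ :=
      (hE.norm.add hA.norm).add (integrable_finsetSum _ fun k _ => (hC k).norm)
    rw [← integral_mul_const]
    refine norm_integral_le_of_norm_le (f := fun z => E z * tf ψ z + A z * dt ψ z
      + ∑ k, C k z * dx k ψ z) (h1.mul_const M) (Eventually.of_forall fun z => ?_)
    rw [add_mul, add_mul, Finset.sum_mul]
    refine (norm_add₃_le).trans (add_le_add_three ?_ ?_
      ((norm_sum_le _ _).trans (Finset.sum_le_sum fun k _ => ?_))) <;> rw [norm_mul]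
    · gcongr
      exact abs_tf_le hM z
    · gcongr
      exact abs_dt_le hM z
    · gcongr
      exact abs_dx_le hM k z⟩

theorem norm_iteratedFDeriv_component_le (χ : testSpace T E3) (i : Fin 3) (k : ℕ) (w : ℝ × E3) :
    ‖iteratedFDeriv ℝ k (lift (component i χ : ℝ → T3 → ℝ)) w‖
      ≤ ‖iteratedFDeriv ℝ k (lift (χ : ℝ → T3 → E3)) w‖ := by
  have h1 := (EuclideanSpace.proj (𝕜 := ℝ) i : E3 →L[ℝ] ℝ).norm_iteratedFDeriv_comp_left
    (n := k) (χ.2.1.contDiffAt (x := w)) (by exact_mod_cast le_top)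
  have h2 : ‖(EuclideanSpace.proj (𝕜 := ℝ) i : E3 →L[ℝ] ℝ)‖ ≤ 1 :=
    ContinuousLinearMap.opNorm_le_bound _ zero_le_one fun v => by
      simpa using PiLp.norm_apply_le v i
  exact h1.trans (mul_le_of_le_one_left (norm_nonneg _) h2)

/-- The distribution on vector fields with given components. -/
def vectorDistrib (D : Fin 3 → Distrib T ℝ) : Distrib T E3 where
  toFun :=
    { toFun := fun χ => ∑ i, (D i).toFun (component i χ)
      map_add' := fun χ χ' => by
        rw [← Finset.sum_add_distrib]
        exact Finset.sum_congr rfl fun i _ => map_add (D i).toFun (component i χ) (component i χ')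
      map_smul' := fun c χ => by
        rw [RingHom.id_apply, Finset.smul_sum]
        exact Finset.sum_congr rfl fun i _ => map_smul (D i).toFun c (component i χ) }
  bounded := fun K hK hKT => by
    choose N C h using fun i => (D i).bounded K hK hKT
    refine ⟨Finset.univ.sup N, ∑ i, C i, fun χ hχ M hM => ?_⟩
    change |∑ i, (D i).toFun (component i χ)| ≤ _
    rw [Finset.sum_mul]
    refine (Finset.abs_sum_le_sum_abs (fun i => (D i).toFun (component i χ)) _).trans
      (Finset.sum_le_sum fun i _ => ?_)
    refine h i (component i χ) (fun t ht x => by simp [component, hχ t ht x]) M fun k hk w => ?_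
    exact (norm_iteratedFDeriv_component_le χ i k w).trans
      (hM k (hk.trans (Finset.le_sup (Finset.mem_univ i))) w)

end Densities

/-! ### The distributions D(b,j) and [div(b⊗b)]×b and the energy balance -/

namespace Config

variable {T : ℝ} (D : Config T)

/-- The dissipation distribution `D(b,j)`. -/
def dissipationDistrib : Distrib T ℝ :=
  firstOrderDistrib 0 ((-(1 / 2) : ℝ) • D.E)
    (fun k => D.E * D.J k - (D.J 0 * D.B 0 + D.J 1 * D.B 1 + D.J 2 * D.B 2) * D.B k)
    (integrable_zero _ _ _) D.integrable fun _ => D.integrable.sub D.integrable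

theorem dissipationDistrib_apply (ψ : testSpace T ℝ) :
    D.dissipationDistrib.toFun ψ = ∫ z, D.dissipationDensity ψ z := by
  refine integral_congr_ae (Eventually.of_forall fun z => ?_)
  simp only [dissipationDensity, Fin.sum_univ_three, Pi.smul_apply, smul_eq_mul, Pi.sub_apply,
    Pi.mul_apply, Pi.add_apply, Pi.zero_apply]
  ring

/-- The coefficients of the gradient of a test function in the product `[div (b ⊗ b)] × b`. -/
def emfCoeff (i k : Fin 3) : ST → ℝ :=
  (if k = i + 2 then (1 / 2 : ℝ) • (D.E * D.B (i + 1)) else 0)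
    - if k = i + 1 then (1 / 2 : ℝ) • (D.E * D.B (i + 2)) else 0

/-- The coefficients of a test function in the product `[div (b ⊗ b)] × b`. -/
def emfForce (i : Fin 3) : ST → ℝ :=
  D.V (i + 1) * D.B (i + 2) - D.V (i + 2) * D.B (i + 1) - (1 / 2 : ℝ) • (D.E * D.J i)

theorem integrable_emfForce (i : Fin 3) : Integrable (D.emfForce i) :=
  (D.integrable.sub D.integrable).sub D.integrable

/-- The coefficients are components of |b|²b, so the third moment bound is what makes this
distribution of order one. -/
theorem integrable_emfCoeff (i k : Fin 3) : Integrable (D.emfCoeff i k) := by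
  have h : ∀ l, Integrable ((1 / 2 : ℝ) • (D.E * D.B l)) := fun l =>
    ((D.pairable_cubic (f := slab T) (g := D.E * D.B l)).integrable).smul _
  refine Integrable.sub ?_ ?_ <;> split_ifs <;> first | exact h _ | exact integrable_zero _ _ _

/-- The distribution `[div (b ⊗ b)] × b`. -/
def emfDistrib : Distrib T E3 :=
  vectorDistrib fun i => firstOrderDistrib
    (D.emfForce i) 0
    (D.emfCoeff i) (D.integrable_emfForce i) (integrable_zero _ _ _) (D.integrable_emfCoeff i)

theorem emfDistrib_apply (χ : testSpace T E3) :
    D.emfDistrib.toFun χ = ∫ z, D.emfDensity χ z := by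
  have h : D.emfDistrib.toFun χ = ∑ i, ∫ z, (D.emfForce i z * tf (component i χ) z
      + (0 : ST → ℝ) z * dt (component i χ) z
      + ∑ k, D.emfCoeff i k z * dx k (component i χ) z) := rfl
  rw [h, ← integral_finsetSum _ fun i _ => integrable_firstOrder (D.integrable_emfForce i)
    (integrable_zero _ _ _) (D.integrable_emfCoeff i) _]
  refine integral_congr_ae (Eventually.of_forall fun z => ?_)
  simp only [emfDensity, emfForce, emfCoeff, testCross, Fin.sum_univ_three, Pi.smul_apply, smul_eq_mul,
    Pi.sub_apply, Pi.mul_apply, Pi.zero_apply, Fin.reduceAdd, Fin.reduceEq, if_true, if_false,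
    zero_add]
  ring

variable {b j : ℝ → T3 → E3}

/-- The |b|²b terms carry curl ∇ψ = 0. The double product (j×b)×b gives (j·b)b − |b|²j, and the
further −½|b|²j accounts for the 3/2. -/
theorem emfDensity_testGrad (ψ : testSpace T ℝ) (z : ST) :
    D.emfDensity (testGrad ψ) z = (∑ k, (∑ i, D.J i z * D.B i z) * D.B k z * dx k ψ z)
      - (3 / 2) * ∑ k, D.E z * D.J k z * dx k ψ z := by
  have h := fun i k => dx_component_testGrad_comm i k ψ z
  simp only [emfDensity, testCross, tf_component_testGrad, Fin.sum_univ_three, Pi.sub_apply,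
    Pi.mul_apply, Fin.reduceAdd, zero_add, h 2 1, h 2 0, h 1 0]
  simp only [V, E, Pi.sub_apply, Pi.add_apply, Pi.mul_apply, Matrix.cons_val]
  ring

theorem integrable_β : Integrable D.β := by
  have h1 := (D.pair 0 0 1 0 (by norm_num) (by norm_num)).integrable
  rw [D.monom_zero_right one_ne_zero] at h1
  simpa using h1

theorem E_apply (z : ST) : D.E z = ∑ i, D.B i z ^ 2 := by
  simp [E, Fin.sum_univ_three, sq]

theorem norm_sq_eq_E (hb : Agrees T b D.B) {z : ST} (hz : z.1 ∈ Ioo 0 T) :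
    ‖b z.1 z.2‖ ^ 2 = D.E z := by
  simp [EuclideanSpace.norm_sq_eq, hb z.1 hz, E_apply]

/-- Against ∇ψ, the term −½F contributes −½(j·b)b + ¾|b|²j. Together with ¼|b|²j − ½(j·b)b this is
|b|²j − (j·b)b, the flux in the dissipation density. -/
theorem localEnergyBalance (hb : Agrees T b D.B) (hj : Agrees T j D.J) :
    LocalEnergyBalance b j D.emfDistrib D.dissipationDistrib := by
  intro ψ
  have h1 : ∫ z, (1 / 2) * ‖b z.1 z.2‖ ^ 2 * tderiv (ψ : ℝ → T3 → ℝ) z.1 z.2 ∂spaceTime T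
      = ∫ z, (1 / 2) * (D.E z * dt ψ z) :=
    integral_spaceTime_eq (fun z hz => by rw [D.norm_sq_eq_E hb hz, mul_assoc]; rfl)
      fun z hz => by simp [dt_of_notMem hz]
  have h2 : vpair (fun t x => ‖b t x‖ ^ 2 • j t x) (testGrad ψ)
      = ∫ z, ∑ k, D.E z * D.J k z * dx k ψ z :=
    integral_spaceTime_eq (fun z hz => by
      simp only [D.norm_sq_eq_E hb hz, inner_eq_sum, PiLp.smul_apply, smul_eq_mul, hj z.1 hz]
      rfl) fun z hz => by simp [dx_of_notMem hz]
  have h3 : vpair (fun t x => ⟪j t x, b t x⟫ • b t x) (testGrad ψ)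
      = ∫ z, ∑ k, (∑ i, D.J i z * D.B i z) * D.B k z * dx k ψ z :=
    integral_spaceTime_eq (fun z hz => by
      simp only [inner_eq_sum, PiLp.smul_apply, smul_eq_mul, hj z.1 hz, hb z.1 hz]
      rfl) fun z hz => by simp [dx_of_notMem hz]
  have i1 : Integrable fun z => D.E z * dt ψ z := D.integrable (f := D.E * dt ψ)
  have i2 : Integrable fun z => ∑ k, D.E z * D.J k z * dx k ψ z :=
    integrable_finsetSum _ fun k _ => D.integrable (f := D.E * D.J k * dx k ψ)
  have i3 : Integrable fun z => ∑ k, (∑ i, D.J i z * D.B i z) * D.B k z * dx k ψ z := by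
    simp only [Finset.sum_mul]
    exact integrable_finsetSum _ fun k _ => integrable_finsetSum _ fun i _ =>
      D.integrable (f := D.J i * D.B i * D.B k * dx k ψ)
  have h4 : ∫ z, D.dissipationDensity ψ z = -(1 / 2) * (∫ z, D.E z * dt ψ z)
      + ((∫ z, ∑ k, D.E z * D.J k z * dx k ψ z)
        - ∫ z, ∑ k, (∑ i, D.J i z * D.B i z) * D.B k z * dx k ψ z) := by
    have i4 : Integrable fun z => (∑ k, D.E z * D.J k z * dx k ψ z)
        - ∑ k, (∑ i, D.J i z * D.B i z) * D.B k z * dx k ψ z := i2.sub i3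
    rw [← integral_const_mul, ← integral_sub i2 i3, ← integral_add (i1.const_mul _) i4]
    refine integral_congr_ae (Eventually.of_forall fun z => ?_)
    simp only [dissipationDensity, sub_mul, Finset.sum_sub_distrib]
  rw [D.dissipationDistrib_apply, h4, D.emfDistrib_apply, h1, h2, h3]
  simp only [D.emfDensity_testGrad]
  rw [integral_sub i3 (i2.const_mul _), integral_const_mul, integral_const_mul]
  ring

theorem isDivCross (hb : Agrees T b D.B) : IsDivCross b D.emfDistrib := fun φ hφ χ => by
  rw [D.emfDistrib_apply]
  exact D.tendsto_vpair_mollifiedDiv χ hb hφ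

theorem vpair_cross (hb : Agrees T b D.B) (G : ℝ → T3 → E3) (χ : testSpace T E3) :
    vpair (fun t x => cross (G t x) (b t x)) χ = ∫ z, ∑ i, extend T G i z * D.testCross χ i z :=
  integral_spaceTime_eq (fun z hz => by
    rw [inner_cross]
    simp only [extend_of_mem hz, hb z.1 hz]
    rfl) fun z hz => by simp [extend_of_notMem hz]

theorem emfDistrib_eq_of_weakDivTensor (hb : Agrees T b D.B) {G : ℝ → T3 → E3}
    (hGm : AEStronglyMeasurable (fun z : ℝ × T3 => G z.1 z.2) (spaceTime T))
    (hG : IsWeakDivTensor T b G) (P : Pairable (size T G) D.β) (χ : testSpace T E3) :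
    D.emfDistrib.toFun χ = vpair (fun t x => cross (G t x) (b t x)) χ := by
  rw [D.emfDistrib_apply, D.vpair_cross hb]
  refine D.integral_emfDensity_of_weakDiv χ (fun i ψ => ?_) fun i => ?_
  · have h1 := hG (axisField i ψ)
    rw [vpair_axisField, integral_spaceTime_eq (F' := fun z => ∑ k, (D.B k * D.B i) z * dx k ψ z)
      (fun z hz => by
        simp only [pderiv_axisField, mul_ite, mul_zero, hb z.1 hz]
        rw [Finset.sum_comm]
        simp) fun z hz => by simp [dx_of_notMem hz]] at h1
    simp only [Pi.zero_apply, zero_mul, zero_add]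
    linarith
  · obtain ⟨C, hC⟩ := (inferInstance : D.Dom (D.testCross χ i) 1 0).bound
    refine P.mono (aesm_extend hGm i) (D.integrable (f := D.testCross χ i)).1 (c := 1) (d := C)
      (fun z => ?_) fun z => ?_
    · rw [one_mul, Real.norm_of_nonneg (size_nonneg z)]
      exact abs_extend_le i z
    · have h1 := hC z
      rw [D.monom_zero_right one_ne_zero] at h1
      simpa using h1

end Config

namespace Config

variable {T : ℝ} (D : Config T) {b j : ℝ → T3 → E3}

theorem measurable_smul_sphere (lam : ℝ) :
    Measurable fun θ : Metric.sphere (0 : E3) 1 => lam • (θ : E3) :=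
  Continuous.measurable (by fun_prop)

theorem integrable_gradient_rescale {φ : E3 → ℝ} (hφ : IsKernel φ) {ε : ℝ} (hε : 0 < ε)
    (k : Fin 3) : Integrable fun l => gradient (rescale φ ε) l k := by
  have hk := (isKernel_rescale hφ hε).pd k
  simp only [gradient_apply]
  exact hk.smooth.continuous.integrable_of_hasCompactSupport hk.compact

theorem integrable_structureFn_mul {f g h : ℝ → T3 → E3} {F G H : Fin 3 → ST → ℝ}
    (hf : Agrees T f F) (hg : Agrees T g G) (hh : Agrees T h H)
    (P : ∀ k i, TriPairable (slab T) (F k) (G i) (H i)) (lam : ℝ) (ψ : testSpace T ℝ) :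
    Integrable (fun z : ST => structureFn f g h lam z.1 z.2 * tf ψ z) (spaceTime T) := by
  have h1 := (integrable_integral_cubic_mul hf hg hh ψ P (measurable_smul_sphere lam)
    integrable_sphere_coord).const_mul (1 / lam * (4 * Real.pi)⁻¹)
  refine h1.congr (Eventually.of_forall fun z => ?_)
  simp only [structureFn, integral_div]
  ring

/-- Each structure function is separately integrable against ψ, so the separate limits may be
combined and compared with the limit of the combination by uniqueness. -/
theorem structureFn_limits (hb : Agrees T b D.B) (hj : Agrees T j D.J) {S₁ S₂ : Distrib T ℝ}
    (h1 : TendstoDistrib (fun lam t x => -structureFn j b b lam t x) S₁)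
    (h2 : TendstoDistrib (fun lam t x => -structureFn b j b lam t x) S₂) :
    -(1 / 2 : ℝ) • S₁.toFun + S₂.toFun = -(4 / 3 : ℝ) • D.dissipationDistrib.toFun := by
  ext ψ
  have h3 := ((h1 ψ).const_mul (1 / 2)).sub (h2 ψ)
  have h4 : ∀ lam, 1 / 2 * EMHD.pair (fun t x => -structureFn j b b lam t x) ψ
      - EMHD.pair (fun t x => -structureFn b j b lam t x) ψ
      = EMHD.pair (fun t x => -(1 / 2) * structureFn j b b lam t x
        + structureFn b j b lam t x) ψ := fun lam => by
    have i1 := integrable_structureFn_mul hj hb hb (D.triPairable_current (slab T)) lam ψ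
    have i2 := integrable_structureFn_mul hb hj hb (D.triPairable_field (slab T)) lam ψ
    have e : ∀ {g : ℝ → T3 → ℝ}, EMHD.pair (fun t x => -g t x) ψ
        = -∫ z : ST, g z.1 z.2 * tf ψ z ∂spaceTime T := fun {g} => by
      rw [← integral_neg]
      exact integral_congr_ae (Eventually.of_forall fun z => neg_mul _ _)
    rw [e, e, EMHD.pair, mul_neg, ← neg_mul, sub_neg_eq_add, ← integral_const_mul,
      ← integral_add (i1.const_mul _) i2]
    exact integral_congr_ae (Eventually.of_forall fun z => by simp only [tf]; ring)
  simp only [h4] at h3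
  have h5 := tendsto_nhds_unique h3 (D.tendsto_pair_structureFn hb hj ψ)
  simp only [LinearMap.add_apply, LinearMap.smul_apply, smul_eq_mul, D.dissipationDistrib_apply]
  linarith

end Config

end EMHD

end

theorem theorem1p1 (T : ℝ) (hT : 0 < T) (p q m n : ℝ)
    (hp : 1 < p) (hq : 1 < q) (hm : 1 < m) (hn : 1 < n)
    (hpm : 2 / p + 1 / m = 1) (hqn : 2 / q + 1 / n = 1)
    (b j : ℝ → EMHD.T3 → EMHD.E3)
    (hb_energy : EMHD.MemLpLq T ⊤ 2 b)
    (hb : EMHD.MemLpLq T (ENNReal.ofReal p) (ENNReal.ofReal q) b)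
    (hj : EMHD.MemLpLq T (ENNReal.ofReal m) (ENNReal.ofReal n) j)
    (hsol : EMHD.IsWeakSolution T b j) :
    -- the increments entering `D(b,j;ε)` and the structure functions are absolutely integrable
    (∀ φ : EMHD.E3 → ℝ, EMHD.IsMollifier φ → ∀ ε : ℝ, 0 < ε →
      Integrable (fun z : (ℝ × EMHD.T3) × EMHD.E3 => EMHD.cubic (j z.1.1) (b z.1.1) (b z.1.1)
        (gradient (EMHD.rescale φ ε) z.2) z.2 z.1.2) ((EMHD.spaceTime T).prod volume) ∧
      Integrable (fun z : (ℝ × EMHD.T3) × EMHD.E3 => EMHD.cubic (b z.1.1) (j z.1.1) (b z.1.1)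
        (gradient (EMHD.rescale φ ε) z.2) z.2 z.1.2) ((EMHD.spaceTime T).prod volume)) ∧
    (∀ lam : ℝ, 0 < lam →
      Integrable (fun z : (ℝ × EMHD.T3) × Metric.sphere (0 : EMHD.E3) 1 =>
        EMHD.cubic (j z.1.1) (b z.1.1) (b z.1.1) (z.2 : EMHD.E3) (lam • (z.2 : EMHD.E3)) z.1.2)
        ((EMHD.spaceTime T).prod EMHD.sphereMeasure) ∧
      Integrable (fun z : (ℝ × EMHD.T3) × Metric.sphere (0 : EMHD.E3) 1 =>
        EMHD.cubic (b z.1.1) (j z.1.1) (b z.1.1) (z.2 : EMHD.E3) (lam • (z.2 : EMHD.E3)) z.1.2)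
        ((EMHD.spaceTime T).prod EMHD.sphereMeasure)) ∧
    ∃ (D : EMHD.Distrib T ℝ) (F : EMHD.Distrib T EMHD.E3),
      -- `D(b,j;ε) → D(b,j)` in the sense of distributions
      (∀ φ : EMHD.E3 → ℝ, EMHD.IsMollifier φ →
        EMHD.TendstoDistrib (EMHD.dissipation φ b j) D) ∧
      -- `F = [div(b ⊗ b)] × b`, which is the pointwise product if `div(b ⊗ b)` is a function
      -- in the space dual to that of `b`
      EMHD.IsDivCross b F ∧
      (∀ G : ℝ → EMHD.T3 → EMHD.E3,
        EMHD.MemLpLq T (ENNReal.ofReal (p / (p - 1))) (ENNReal.ofReal (q / (q - 1))) G →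
        EMHD.IsWeakDivTensor T b G →
        ∀ χ : EMHD.testSpace T EMHD.E3,
          F.toFun χ = EMHD.vpair (fun t x => EMHD.cross (G t x) (b t x)) χ) ∧
      -- local energy equation
      EMHD.LocalEnergyBalance b j F D ∧
      -- 4/3 law: `-½ S₁ + S₂ = -(4/3) D`, where `Sᵢ = -lim Sᵢ(λ)` as `λ → 0`
      (∀ ψ : EMHD.testSpace T ℝ,
        Tendsto (fun lam : ℝ => -EMHD.pair (fun t x =>
          -(1 / 2) * EMHD.structureFn j b b lam t x + EMHD.structureFn b j b lam t x) ψ)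
          (𝓝[>] 0) (𝓝 (-(4 / 3) * D.toFun ψ))) ∧
      (∀ S₁ S₂ : EMHD.Distrib T ℝ,
        EMHD.TendstoDistrib (fun lam t x => -EMHD.structureFn j b b lam t x) S₁ →
        EMHD.TendstoDistrib (fun lam t x => -EMHD.structureFn b j b lam t x) S₂ →
        -(1 / 2 : ℝ) • S₁.toFun + S₂.toFun = -(4 / 3 : ℝ) • D.toFun) := by
  -- The configuration is kept opaque except for its fields and the size of b, the only data needed
  -- to pass between the extended fields and b, j.
  obtain ⟨D, hDB, hDJ, hDβ⟩ : ∃ D : EMHD.Config T,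
      D.B = EMHD.extend T b ∧ D.J = EMHD.extend T j ∧ D.β = EMHD.size T b :=
    ⟨EMHD.configOfSolution hp hq hm hn hpm hqn hb_energy hb hj hsol, rfl, rfl, rfl⟩
  have hbB : EMHD.Agrees T b D.B := hDB ▸ EMHD.agrees_extend T b
  have hjJ : EMHD.Agrees T j D.J := hDJ ▸ EMHD.agrees_extend T j
  refine ⟨fun φ hφ ε hε => ⟨?_, ?_⟩, fun lam _ => ⟨?_, ?_⟩, D.dissipationDistrib, D.emfDistrib,
    fun φ hφ ψ => ?_, D.isDivCross hbB, fun G hG hGw χ => ?_, D.localEnergyBalance hbB hjJ,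
    fun ψ => ?_, fun S₁ S₂ h1 h2 => D.structureFn_limits hbB hjJ h1 h2⟩
  · exact EMHD.integrable_cubic (p := fun l => l) hjJ hbB hbB (D.triPairable_current _)
      measurable_id (EMHD.Config.integrable_gradient_rescale hφ.isKernel hε)
  · exact EMHD.integrable_cubic (p := fun l => l) hbB hjJ hbB (D.triPairable_field _)
      measurable_id (EMHD.Config.integrable_gradient_rescale hφ.isKernel hε)
  · exact EMHD.integrable_cubic
      (p := fun θ : Metric.sphere (0 : EMHD.E3) 1 => lam • (θ : EMHD.E3))
      (V := fun θ => (θ : EMHD.E3)) hjJ hbB hbB (D.triPairable_current _)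
      (EMHD.Config.measurable_smul_sphere lam) EMHD.Config.integrable_sphere_coord
  · exact EMHD.integrable_cubic
      (p := fun θ : Metric.sphere (0 : EMHD.E3) 1 => lam • (θ : EMHD.E3))
      (V := fun θ => (θ : EMHD.E3)) hbB hjJ hbB (D.triPairable_field _)
      (EMHD.Config.measurable_smul_sphere lam) EMHD.Config.integrable_sphere_coord
  · rw [D.dissipationDistrib_apply]
    exact D.tendsto_pair_dissipation hbB hjJ ψ hφ
  · have dp : (p / (p - 1)).HolderConjugate p := (Real.HolderConjugate.conjExponent hp).symm
    have dq : (q / (q - 1)).HolderConjugate q := (Real.HolderConjugate.conjExponent hq).symm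
    -- The size of G pairs with |b| because the exponents of G are dual to (p, q).
    exact D.emfDistrib_eq_of_weakDivTensor hbB hG.1 hGw
      (.of_mixedNorm dp dq (EMHD.aesm_size hG.1) D.integrable_β
        (EMHD.mixedNorm_size_ne_top dp.pos dq.pos hG)
        (hDβ ▸ EMHD.mixedNorm_size_ne_top (by linarith) (by linarith) hb)) χ
  · rw [D.dissipationDistrib_apply, neg_mul]
    exact (D.tendsto_pair_structureFn hbB hjJ ψ).neg
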